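/- Let $\{\tau_k\}_{k\ge1}$ list the nontrivial zeros $\rho=\tfrac12\pm i\tau_k$ of the Riemann zeta function in pairs, with multiplicity, $\operatorname{Re}\tau_k$ being positive and non-decreasing in $k$. The Riemann hypothesis is not assumed. Let $v\in\mathbb R$ with $v>-\operatorname{Re}(\tau_1^2)$ (that is, $v>-\tau_1^2$, since the first zero lies on the critical line), and put $x_k=\tau_k^2+v$. A sequence of nonzero complex numbers $x_k$ is called *admissible of order* $\mu_0$, where $0<\mu_0<1$, if $|x_k|\to\infty$; $\sum_k|x_k|^{-1}<\infty$; the entire function $\Delta(z)=\prod_k(1+z/x_k)$ satisfies $\log|\Delta(z)|\le\varepsilon|z|^{\mu_0+\delta}$ for all $\delta,\varepsilon>0$ and all sufficiently large $|z|$; and, for some $\theta>0$, one has $|\arg x_k|\le\pi-\theta$ for all $k$ and, in the sector $|\arg z|<\theta$, $\log\Delta(z)=\sum_k\log(1+z/x_k)$ is $o(|z|^{\mu_0+\delta})$ for every $\delta>0$ and has a complete uniform asymptotic expansion $$\log\Delta(z)\sim\sum_{n\ge0}(\tilde a_{\mu_n}\log z+a_{\mu_n})\,z^{\mu_n}\qquad(z\to\infty)$$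 with real exponents $\mu_0>\mu_1>\cdots$, $\mu_n\to-\infty$, and $(\tilde a_{\mu_0},a_{\mu_0})\ne(0,0)$. Then: 1. The sequence $\{\tau_k^2+v\}$ is admissible of order $\tfrac12$. More precisely, for some $\theta>0$ with $|\arg(\tau_k^2+v)|\le\pi-\theta$ for all $k$, the expansion holds in $|\arg z|<\theta$ with $\mu_n=\tfrac12(1-n)$ and, for every $v$, $\tilde a_{1/2}=\tfrac14$, $a_{1/2}=-\tfrac12(1+\log2\pi)$, $\tilde a_0=\tfrac78$ and $\tilde a_{-m}=0$ for all $m\ge1$; for $v=\tfrac14$ moreover $a_0=\tfrac14\log8\pi$. 2. The series $\mathcal Z(\sigma,v)=\sum_k(\tau_k^2+v)^{-\sigma}$ (principal powers) converges absolutely for $\operatorname{Re}\sigma>\tfrac12$ and extends to a meromorphic function of $\sigma\in\mathbb C$, which is holomorphic away from the points $\tfrac12-m$, $m=0,1,2,\ldots$, and has at most a double pole at each of these points. 3. The function $$\mathcal Z(\sigma,v)-\frac1{8\pi}\frac1{(\sigma-\frac12)^2}+\frac{\log2\pi}{4\pi}\frac1{\sigma-\frac12}$$ is holomorphic at $\sigma=\tfrac12$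 (after removal of the singularity); in particular the polar part there does not depend on $v$. 4. $\mathcal Z(0,v)=\tfrac78$; and for $v=\tfrac14$, with $Z(\sigma)=\mathcal Z(\sigma,\tfrac14)$, one has $Z'(0)=\tfrac14\log8\pi$. -/

import Mathlib

open Filter Topology Asymptotics Complex

noncomputable section

/-- The Delta function (Weierstrass product of genus zero) `Δ(z) = ∏ₖ (1 + z / xₖ)` of a sequence;
the labels `k = 1, 2, …` of the mathematics are shifted to `k = 0, 1, …` throughout. -/
def deltaFn (x : ℕ → ℂ) (z : ℂ) : ℂ := ∏' k, (1 + z / x k)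

/-- The logarithm of the Delta function, `log Δ(z) = ∑ₖ log (1 + z / xₖ)`: the holomorphic branch
vanishing at `z = 0`, on any sector `|arg z| < θ` which contains none of the zeros `-xₖ` of `Δ`. -/
def logDelta (x : ℕ → ℂ) (z : ℂ) : ℂ := ∑' k, log (1 + z / x k)

theorem summable_log_factor {x : ℕ → ℂ} (hs : Summable fun k => ‖x k‖⁻¹) (z : ℂ) :
    Summable fun k => log (1 + z / x k) := by
  have h : Summable fun k => ‖z / x k‖ := by
    simpa [div_eq_mul_inv] using hs.mul_left ‖z‖
  exact Complex.summable_log_one_add_of_summable h.of_norm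

/-- `logDelta` is a logarithm of `deltaFn` off the zeros of the latter. -/
theorem exp_logDelta {x : ℕ → ℂ} (hs : Summable fun k => ‖x k‖⁻¹) {z : ℂ}
    (hz : ∀ k, 1 + z / x k ≠ 0) : exp (logDelta x z) = deltaFn x z :=
  Complex.cexp_tsum_eq_tprod hz (summable_log_factor hs z)

/-- `z → ∞` inside the open sector `|arg z| < θ`. -/
def sectorAtInfinity (θ : ℝ) : Filter ℂ :=
  Bornology.cobounded ℂ ⊓ 𝓟 {z : ℂ | |arg z| < θ}

/-- Generalized Stirling expansion: `log Δ(z) ∼ ∑ₙ (ãₙ log z + aₙ) z ^ μₙ`, as a complete asymptotic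
expansion for `z → ∞`, uniformly in the sector `|arg z| < θ`. -/
def HasStirlingExpansion (x : ℕ → ℂ) (θ : ℝ) (μ : ℕ → ℝ) (a' a : ℕ → ℂ) : Prop :=
  ∀ N : ℕ, (fun z : ℂ => logDelta x z -
      ∑ n ∈ Finset.range (N + 1), (a' n * log z + a n) * z ^ (μ n : ℂ))
    =o[sectorAtInfinity θ] fun z : ℂ => ‖z‖ ^ μ N

/-- Admissible sequences of order `μ₀`, for complex sequences. The arguments of the `xₖ` are bounded
so that the sector `|arg z| < θ` of the asymptotic expansion contains none of the zeros `-xₖ` of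
`Δ`; a real positive sequence meets this with any `θ ≤ π`. -/
structure IsAdmissible (x : ℕ → ℂ) (μ₀ : ℝ) : Prop where
  order_pos : 0 < μ₀
  order_lt_one : μ₀ < 1
  ne_zero : ∀ k, x k ≠ 0
  tendsto : Tendsto (fun k => ‖x k‖) atTop atTop
  summable_inv : Summable fun k => ‖x k‖⁻¹
  /-- `log |Δ(z)| ≤ o(|z| ^ (μ₀ + δ))` in the whole plane: `Δ` is entire of order at most `μ₀`. -/
  growth : ∀ δ > 0, ∀ ε > 0, ∀ᶠ z in Bornology.cobounded ℂ,
    ‖deltaFn x z‖ ≤ Real.exp (ε * ‖z‖ ^ (μ₀ + δ))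
  expansion : ∃ θ : ℝ, 0 < θ ∧ (∀ k, |arg (x k)| ≤ Real.pi - θ) ∧
    (∀ δ > 0, logDelta x =o[sectorAtInfinity θ] fun z : ℂ => ‖z‖ ^ (μ₀ + δ)) ∧
    ∃ (μ : ℕ → ℝ) (a' a : ℕ → ℂ), μ 0 = μ₀ ∧ StrictAnti μ ∧ Tendsto μ atTop atBot ∧
      (a' 0 ≠ 0 ∨ a 0 ≠ 0) ∧ HasStirlingExpansion x θ μ a' a

/-- `τ` lists the nontrivial zeros `1/2 ± i τₖ` of the Riemann zeta function in pairs, with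
multiplicity, `Re τₖ` being positive and non-decreasing. As `ζ` has no zero on the real segment
`(0, 1)` and by the symmetry `s ↔ 1 - s`, this means that the `1/2 + i τₖ` are the zeros with
positive imaginary part, each listed as many times as its order. -/
structure IsRiemannZeroSequence (τ : ℕ → ℂ) : Prop where
  re_pos : ∀ k, 0 < (τ k).re
  monotone_re : Monotone fun k => (τ k).re
  multiplicity : ∀ w : ℂ, 0 < w.re →
    {k | τ k = w}.encard = analyticOrderAt riemannZeta (1 / 2 + I * w)

/-- The terms of the Dirichlet series `𝒵(σ, v) = ∑ₖ (τₖ² + v) ^ (-σ)` (principal powers). -/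
def zetaTerm (τ : ℕ → ℂ) (v : ℝ) (σ : ℂ) (k : ℕ) : ℂ := (τ k ^ 2 + v) ^ (-σ)

end

/-! Write ξ(s) = s(s-1)Λ(s), an entire function invariant under s ↔ 1-s, and let Ξ be the entire
function with Ξ(w²) = ξ(1/2+w). The Mellin transform defining Λ₀ has a positive kernel, so |Λ₀(s)| ≤
Λ₀(Re s). Comparison with the values at even integers shows that ξ has order at most 1, hence Ξ has
order at most 1/2. Positivity of the kernel and the value of Λ₀ at 1 also give ξ > 0 on the real
axis. Hence Ξ has no zero on [0,∞), its zeros are exactly the -τ_k² with multiplicity, and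
`hadamard_genus_zero` yields Δ(z) = Ξ(z+v)/Ξ(v).

When z → ∞ in a sector about the positive axis, the point s = 1/2 + √(z+v) moves far to the right.
There log ξ(s) = log s + log(s-1) - (s/2) log π + log Γ(s/2) + log ζ(s), with log ζ exponentially
small and log Γ given by Stirling's formula (`Gamma_eq_exp_stirlingLogGamma`,
`exists_gudermannSeries_asymptotic`). In the variable q = z^(-1/2) all remaining ingredients are
analytic at 0 or asymptotic power series, which gives the expansion (`exists_xiExponent_expansion`).
The logarithm log z is multiplied by √z(√(1+vq²)/4 + 7q/8). Apart from its linear term the bracket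
is even in q, which is why no logarithm accompanies z^(-m) for m ≥ 1. The two logarithms of Δ agree
up to a constant κ with exp κ = 1/Ξ(v). For v = 1/4 one has Ξ(1/4) = ξ(1) = 1, and reality on the
positive axis excludes nonzero multiples of 2πi (`logDelta_const_eq_zero`).

For the Dirichlet series, the Mellin transform of log(1+y/x) at -σ is x^(-σ) π/(σ sin πσ). Summation
gives 𝒵(σ,v) = (σ sin πσ/π) ∫ log Δ(y) y^(-σ-1) dy for 1/2 < Re σ < 1 (`hasSum_mellin_logDelta`).
Removing the head of the expansion on (1,∞) continues the integral to the left: a term (b log y +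
c)y^μ contributes b/(σ-μ)² + c/(σ-μ) (`exists_extMellin_eq_add_pole`). The sine factor has a double
zero at 0, so 𝒵(0,v) and 𝒵'(0,v) are the coefficients ã₀ and a₀. Its simple zeros at the negative
integers cancel the simple poles there, and only the points 1/2-m remain. The polar part at 1/2
comes from the leading term and the first-order Taylor expansion of the sine factor. -/

noncomputable section

/-! ### Hadamard factorisation in genus zero -/

/-- Counting functions of order `α` give convergence of `∑ ‖xₖ‖ ^ (-β)` for `β > α`. -/
theorem summable_norm_rpow_neg_of_card_le {x : ℕ → ℂ} {α β C : ℝ} (hβ : 0 < β) (hαβ : α < β)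
    (hcard : ∀ r : ℝ, 1 ≤ r → ∀ S : Finset ℕ, (∀ k ∈ S, ‖x k‖ ≤ r) → (S.card : ℝ) ≤ C * r ^ α)
    (hx : ∀ k, x k ≠ 0) : Summable fun k => ‖x k‖ ^ (-β) := by
  have hx0 : ∀ k, 0 < ‖x k‖ := fun k => norm_pos_iff.2 (hx k)
  have hlog2 : 0 < Real.log 2 := Real.log_pos (by norm_num)
  have hC0 : 0 ≤ C := by simpa using hcard 1 le_rfl ∅ (by simp)
  -- The dyadic shell of index i holds at most C·2^(iα) points, each contributing at most
  -- 2^β·2^(-iβ), so `q` is the ratio of the geometric majorant.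
  set q : ℝ := (2 : ℝ) ^ (α - β) with hq
  have hq0 : 0 < q := by positivity
  have hq1 : q < 1 := Real.rpow_lt_one_of_one_lt_of_neg (by norm_num) (by linarith)
  -- the shell index of `k`
  let j : ℕ → ℕ := fun k => ⌈Real.log ‖x k‖ / Real.log 2⌉₊
  have hj : ∀ k, ‖x k‖ ≤ (2 : ℝ) ^ (j k : ℝ) := by
    intro k
    rw [← Real.log_le_log_iff (hx0 k) (by positivity), Real.log_rpow (by norm_num),
      ← div_le_iff₀ hlog2]
    exact Nat.le_ceil _
  -- Below norm 1 the index `j` is truncated to 0 and gives no lower bound for the norm; these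
  -- finitely many terms are discarded.
  have hfin : Set.Finite {k | ‖x k‖ < 1} := by
    by_contra hinf
    obtain ⟨S, hS, hc⟩ := Set.Infinite.exists_subset_card_eq hinf (⌊C⌋₊ + 1)
    have := hcard 1 le_rfl S (fun k hk => (show ‖x k‖ < 1 from hS hk).le)
    rw [hc] at this
    have h2 := Nat.lt_floor_add_one C
    push_cast at this
    simp at this
    linarith
  rw [← hfin.summable_compl_iff]
  have hbound : ∀ k, 1 ≤ ‖x k‖ → ‖x k‖ ^ (-β) ≤ 2 ^ β * (2 : ℝ) ^ (-(β * j k)) := by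
    intro k hk
    have h1 : (j k : ℝ) < Real.log ‖x k‖ / Real.log 2 + 1 :=
      Nat.ceil_lt_add_one (div_nonneg (Real.log_nonneg hk) hlog2.le)
    have h2 : (2 : ℝ) ^ ((j k : ℝ) - 1) ≤ ‖x k‖ := by
      rw [← Real.log_le_log_iff (by positivity) (hx0 k), Real.log_rpow (by norm_num),
        ← le_div_iff₀ hlog2]
      linarith
    calc ‖x k‖ ^ (-β) ≤ ((2 : ℝ) ^ ((j k : ℝ) - 1)) ^ (-β) :=
          Real.rpow_le_rpow_of_nonpos (by positivity) h2 (by linarith)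
      _ = 2 ^ β * (2 : ℝ) ^ (-(β * j k)) := by
          rw [← Real.rpow_mul (by norm_num), ← Real.rpow_add (by norm_num)]
          ring_nf
  have hgeo : Summable fun i : ℕ => C * 2 ^ β * q ^ i :=
    (summable_geometric_of_lt_one hq0.le hq1).mul_left _
  refine summable_of_sum_le (c := ∑' i : ℕ, C * 2 ^ β * q ^ i) (fun k => Real.rpow_nonneg (norm_nonneg _) _) ?_
  intro u
  set S : Finset ℕ := u.map (Function.Embedding.subtype _) with hS
  have hS1 : ∀ k ∈ S, 1 ≤ ‖x k‖ := by
    intro k hk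
    simp only [hS, Finset.mem_map, Function.Embedding.subtype_apply] at hk
    obtain ⟨a, _, rfl⟩ := hk
    exact not_lt.1 a.2
  have hsum : ∑ k ∈ u, ‖x k‖ ^ (-β) = ∑ k ∈ S, ‖x k‖ ^ (-β) := by simp [hS]
  have hmaps : ∀ k ∈ S, j k ∈ S.image j := fun k hk => Finset.mem_image_of_mem _ hk
  calc ∑ k ∈ u, ‖x k‖ ^ (-β) = ∑ k ∈ S, ‖x k‖ ^ (-β) := hsum
    _ ≤ ∑ k ∈ S, 2 ^ β * (2 : ℝ) ^ (-(β * j k)) := Finset.sum_le_sum fun k hk => hbound k (hS1 k hk)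
    _ = ∑ i ∈ S.image j, ∑ k ∈ S with j k = i, 2 ^ β * (2 : ℝ) ^ (-(β * j k)) :=
        (Finset.sum_fiberwise_of_maps_to hmaps _).symm
    _ = ∑ i ∈ S.image j, ((S.filter fun k => j k = i).card : ℝ) * (2 ^ β * (2 : ℝ) ^ (-(β * i))) := by
        refine Finset.sum_congr rfl fun i _ => ?_
        rw [← nsmul_eq_mul]
        refine Finset.sum_eq_card_nsmul fun k hk => ?_
        rw [(Finset.mem_filter.1 hk).2]
    _ ≤ ∑ i ∈ S.image j, C * 2 ^ β * q ^ i := by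
        refine Finset.sum_le_sum fun i _ => ?_
        have h1 : ((S.filter fun k => j k = i).card : ℝ) ≤ C * ((2 : ℝ) ^ (i : ℝ)) ^ α := by
          refine hcard _ (Real.one_le_rpow (by norm_num) (Nat.cast_nonneg i)) _ fun k hk => ?_
          rw [← (Finset.mem_filter.1 hk).2]
          exact hj k
        calc _ ≤ C * ((2 : ℝ) ^ (i : ℝ)) ^ α * (2 ^ β * (2 : ℝ) ^ (-(β * i))) := by gcongr
          _ = C * 2 ^ β * (((2 : ℝ) ^ (i : ℝ)) ^ α * (2 : ℝ) ^ (-(β * i))) := by ring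
          _ = C * 2 ^ β * q ^ i := by
            rw [← Real.rpow_mul (by norm_num), ← Real.rpow_add (by norm_num), hq,
              ← Real.rpow_natCast, ← Real.rpow_mul (by norm_num)]
            ring_nf
    _ ≤ ∑' i : ℕ, C * 2 ^ β * q ^ i := hgeo.sum_le_tsum _ fun i _ => by positivity

/-- Division of an entire function by finitely many of its zeros. -/
theorem exists_eq_mul_prod_one_add_div {f : ℂ → ℂ} (hf : Differentiable ℂ f) {x : ℕ → ℂ}
    (hx : ∀ k, x k ≠ 0) (S : Finset ℕ)
    (hS : ∀ z, ((S.filter fun k => x k = -z).card : ℕ∞) ≤ analyticOrderAt f z) :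
    ∃ g : ℂ → ℂ, Differentiable ℂ g ∧ (∀ z, f z = g z * ∏ k ∈ S, (1 + z / x k)) ∧
      ∀ z, analyticOrderAt f z = analyticOrderAt g z + (S.filter fun k => x k = -z).card := by
  classical
  induction S using Finset.induction_on with
  | empty => exact ⟨f, hf, by simp, by simp⟩
  | insert a S ha ih =>
    obtain ⟨g, hg, hfg, hord⟩ := ih fun z => le_trans (by
      gcongr
      exact Finset.subset_insert a S) (hS z)
    -- The new index raises the multiplicity required at `-x a` by one, so the quotient obtained so
    -- far must still vanish there.
    have h0 : g (-x a) = 0 := by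
      have h1 := hS (-x a)
      rw [Finset.filter_insert, if_pos (by simp), Finset.card_insert_of_notMem (by simp [ha]),
        hord (-x a)] at h1
      refine apply_eq_zero_of_analyticOrderAt_ne_zero (f := g) fun h => ?_
      rw [h, zero_add] at h1
      norm_cast at h1
      omega
    have hd : Differentiable ℂ (dslope g (-x a)) := fun z =>
      (((differentiableOn_dslope (s := Set.univ) univ_mem).2 hg.differentiableOn) z
        (Set.mem_univ z)).differentiableAt univ_mem
    refine ⟨fun z => x a * dslope g (-x a) z, hd.const_mul _, fun z => ?_, fun z => ?_⟩
    · have h2 := sub_smul_dslope g (-x a) z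
      rw [h0, sub_zero, smul_eq_mul] at h2
      rw [hfg, Finset.prod_insert ha, ← h2]
      field_simp [hx a]
      ring
    · have hg' : g = (fun z => (z - -x a)) * (dslope g (-x a)) := by
        funext z
        have h2 := sub_smul_dslope g (-x a) z
        rw [h0, sub_zero, smul_eq_mul] at h2
        exact h2.symm
      have e1 : analyticOrderAt (fun z => x a * dslope g (-x a) z) z
          = analyticOrderAt (dslope g (-x a)) z := by
        have := analyticOrderAt_mul (𝕜 := ℂ) (f := fun _ => x a) (g := dslope g (-x a)) (z₀ := z)
          analyticAt_const (hd.analyticAt z)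
        have h3 : analyticOrderAt (fun _ : ℂ => x a) z = 0 :=
          analyticOrderAt_eq_zero.2 (Or.inr (hx a))
        rw [h3, zero_add] at this
        exact this
      have e2 : analyticOrderAt g z = (if x a = -z then 1 else 0)
          + analyticOrderAt (dslope g (-x a)) z := by
        conv_lhs => rw [hg']
        rw [analyticOrderAt_mul (by fun_prop) (hd.analyticAt z)]
        congr 1
        split_ifs with h
        · rw [show z = -x a by rw [h, neg_neg]]
          simpa using analyticOrderAt_id_sub_const_self (𝕜 := ℂ) (c := -x a)
        · refine analyticOrderAt_eq_zero.2 (Or.inr ?_)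
          intro h'
          apply h
          linear_combination h'
      rw [hord z, e1, e2, Finset.filter_insert]
      split_ifs with h
      · rw [Finset.card_insert_of_notMem (by simp [ha])]
        push_cast
        ring
      · simp

/-- On a disc g'/g has a primitive H, and g·exp(-(H - H 0)) has derivative zero, so it keeps its
value 1 at the centre. -/
theorem exists_log_on_ball {g : ℂ → ℂ} (hg : Differentiable ℂ g) (hg0 : g 0 = 1) {R : ℝ}
    (hR : 0 < R) (hne : ∀ z ∈ Metric.ball (0 : ℂ) R, g z ≠ 0) :
    ∃ h : ℂ → ℂ, DifferentiableOn ℂ h (Metric.ball 0 R) ∧ h 0 = 0 ∧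
      ∀ z ∈ Metric.ball (0 : ℂ) R, exp (h z) = g z := by
  have hd : DifferentiableOn ℂ (fun z => deriv g z / g z) (Metric.ball 0 R) :=
    (hg.deriv.differentiableOn).div hg.differentiableOn hne
  obtain ⟨H, hH⟩ := hd.isExactOn_ball
  have hmem0 : (0 : ℂ) ∈ Metric.ball (0 : ℂ) R := Metric.mem_ball_self hR
  have hder : ∀ z ∈ Metric.ball (0 : ℂ) R,
      HasDerivAt (fun z => g z * exp (-(H z - H 0))) 0 z := by
    intro z hz
    have h1 := ((hg z).hasDerivAt).mul (((hH z hz).sub_const (H 0)).neg.cexp)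
    convert! h1 using 1
    field_simp [hne z hz]
    ring
  have hopen : IsOpen (Metric.ball (0 : ℂ) R) := Metric.isOpen_ball
  refine ⟨fun z => H z - H 0, fun z hz =>
    ((hH z hz).sub_const _).differentiableAt.differentiableWithinAt, by simp, fun z hz => ?_⟩
  have hconst := hopen.is_const_of_deriv_eq_zero (convex_ball (0 : ℂ) R).isPreconnected
    (fun w hw => (hder w hw).differentiableAt.differentiableWithinAt)
    (fun w hw => (hder w hw).deriv) hz hmem0
  simp only [sub_self, neg_zero, exp_zero, mul_one, hg0] at hconst
  have h2 : exp (H z - H 0) * exp (-(H z - H 0)) = 1 := by rw [← exp_add]; simp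
  have h3 := exp_ne_zero (-(H z - H 0))
  exact mul_right_cancel₀ h3 (h2.trans hconst.symm)

/-- The zeros of a nonzero entire function in a closed disc are finite in number, and each has
finite order, so it accounts for finitely many indices. -/
theorem finite_zero_index {f : ℂ → ℂ} (hf : Differentiable ℂ f) (hf0 : f 0 = 1) {x : ℕ → ℂ}
    (hmult : ∀ z, {k | x k = -z}.encard = analyticOrderAt f z) (r : ℝ) :
    {k | ‖x k‖ ≤ r}.Finite := by
  have hfan : AnalyticOnNhd ℂ f Set.univ := fun z _ => hf.analyticAt z
  have htop : ∀ z, analyticOrderAt f z ≠ ⊤ := fun z h => by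
    have := (AnalyticOnNhd.analyticOrderAt_eq_top_iff_eq_zero z fun w => hf.analyticAt w).1 h
    simp [this] at hf0
  have hcod := AnalyticOnNhd.preimage_zero_mem_codiscrete hfan (x := 0) (by simp [hf0])
  have hzeros : (Metric.closedBall (0 : ℂ) r ∩ f ⁻¹' {0}).Finite := by
    have h1 := Filter.codiscreteWithin_mono (Set.subset_univ (Metric.closedBall (0 : ℂ) r)) hcod
    have h2 := (isCompact_closedBall (0 : ℂ) r).finite_sdiff_of_mem_codiscreteWithin h1
    simpa [Set.sdiff_eq] using h2
  have hsub : {k | ‖x k‖ ≤ r} ⊆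
      ⋃ z ∈ Metric.closedBall (0 : ℂ) r ∩ f ⁻¹' {0}, {k | x k = -z} := by
    intro k hk
    simp only [Set.mem_iUnion]
    refine ⟨-x k, ⟨by simpa using hk, ?_⟩, by simp⟩
    refine apply_eq_zero_of_analyticOrderAt_ne_zero (f := f) ?_
    rw [← hmult]
    simp only [ne_eq, Set.encard_eq_zero]
    exact Set.nonempty_iff_ne_empty.1 ⟨k, by simp⟩
  refine (hzeros.biUnion fun z _ => ?_).subset hsub
  rw [← Set.encard_ne_top_iff, hmult]
  exact htop z

theorem card_filter_le_order {f : ℂ → ℂ} {x : ℕ → ℂ}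
    (hmult : ∀ z, {k | x k = -z}.encard = analyticOrderAt f z) (S : Finset ℕ) (z : ℂ) :
    ((S.filter fun k => x k = -z).card : ℕ∞) ≤ analyticOrderAt f z := by
  rw [← hmult, ← Set.encard_coe_eq_coe_finsetCard]
  exact Set.encard_le_encard fun k hk => by simpa using (Finset.mem_filter.1 hk).2

/-- Maximum principle for the quotient of an entire function by its zeros in a disc. -/
theorem norm_le_of_eq_mul_prod {f g : ℂ → ℂ} (hg : Differentiable ℂ g) {x : ℕ → ℂ}
    (hx : ∀ k, x k ≠ 0) {S : Finset ℕ} (hfg : ∀ z, f z = g z * ∏ k ∈ S, (1 + z / x k))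
    {R M : ℝ} (hR : 0 < R) (hSR : ∀ k ∈ S, ‖x k‖ ≤ R) (hM : ∀ z, ‖z‖ = 4 * R → ‖f z‖ ≤ M) {z : ℂ}
    (hz : ‖z‖ ≤ 4 * R) : ‖g z‖ ≤ M / 3 ^ S.card := by
  have hb : Bornology.IsBounded (Metric.ball (0 : ℂ) (4 * R)) := Metric.isBounded_ball
  refine Complex.norm_le_of_forall_mem_frontier_norm_le hb hg.diffContOnCl (fun w hw => ?_)
    (z := z) ?_
  · rw [frontier_ball _ (by positivity)] at hw
    have hw' : ‖w‖ = 4 * R := by simpa using hw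
    -- On the circle of radius 4R each factor has modulus at least 4 - 1 = 3.
    have h3 : (3 : ℝ) ^ S.card ≤ ‖∏ k ∈ S, (1 + w / x k)‖ := by
      rw [norm_prod, ← Finset.prod_const]
      refine Finset.prod_le_prod (fun _ _ => by norm_num) fun k hk => ?_
      have hk0 : 0 < ‖x k‖ := norm_pos_iff.2 (hx k)
      have h4 : 4 ≤ ‖w / x k‖ := by
        rw [norm_div, hw', le_div_iff₀ hk0]
        linarith [hSR k hk]
      have h5 := norm_sub_norm_le (w / x k) (-1)
      rw [norm_neg, norm_one, sub_neg_eq_add, add_comm (w / x k)] at h5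
      linarith
    rw [le_div_iff₀ (by positivity)]
    calc ‖g w‖ * 3 ^ S.card ≤ ‖g w‖ * ‖∏ k ∈ S, (1 + w / x k)‖ := by gcongr
      _ = ‖f w‖ := by rw [hfg, norm_mul]
      _ ≤ M := hM w hw'
  · rw [closure_ball _ (by positivity)]
    simpa using hz

/-- Hadamard's theorem in genus zero. -/
theorem hadamard_genus_zero {f : ℂ → ℂ} (hf : Differentiable ℂ f) (hf0 : f 0 = 1) {x : ℕ → ℂ}
    (hmult : ∀ z, {k | x k = -z}.encard = analyticOrderAt f z) {α C : ℝ} (hα : 0 < α) (hα1 : α < 1)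
    (hC : 0 < C) (hgrow : ∀ z, ‖f z‖ ≤ Real.exp (C * (1 + ‖z‖ ^ α))) :
    (∀ β, α < β → Summable fun k => ‖x k‖ ^ (-β)) ∧ f = deltaFn x := by
  have hx : ∀ k, x k ≠ 0 := by
    intro k hk
    have h0 : analyticOrderAt f 0 = 0 := analyticOrderAt_eq_zero.2 (Or.inr (by simp [hf0]))
    rw [← hmult 0, Set.encard_eq_zero] at h0
    have : k ∈ {k | x k = -0} := by simpa using hk
    rw [h0] at this
    exact this
  have hfin := finite_zero_index hf hf0 hmult
  have hlog3 : 0 < Real.log 3 := Real.log_pos (by norm_num)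
  have hM : ∀ R : ℝ, ∀ z : ℂ, ‖z‖ = 4 * R → ‖f z‖ ≤ Real.exp (C * (1 + (4 * R) ^ α)) := by
    intro R z hz
    rw [← hz]
    exact hgrow z
  -- A crude form of Jensen's inequality: the quotient by the zeros equals 1 at the origin and is at
  -- most the maximum of f on |z| = 4r divided by 3 to the number of zeros.
  have hcard : ∀ r : ℝ, 1 ≤ r → ∀ S : Finset ℕ, (∀ k ∈ S, ‖x k‖ ≤ r) →
      (S.card : ℝ) ≤ (C * (1 + 4 ^ α) / Real.log 3) * r ^ α := by
    intro r hr S hS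
    obtain ⟨g, hg, hfg, -⟩ := exists_eq_mul_prod_one_add_div hf hx S (card_filter_le_order hmult S)
    have h1 := norm_le_of_eq_mul_prod hg hx hfg (by linarith) hS (hM r) (z := 0)
      (by simpa using by linarith)
    have h2 : g 0 = 1 := by simpa [hf0] using (hfg 0).symm
    rw [h2, norm_one, le_div_iff₀ (by positivity), one_mul,
      ← Real.log_le_iff_le_exp (by positivity), Real.log_pow] at h1
    have h3 : 1 ≤ r ^ α := Real.one_le_rpow hr hα.le
    rw [div_mul_eq_mul_div, le_div_iff₀ hlog3]
    refine h1.trans ?_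
    rw [Real.mul_rpow (by norm_num) (by linarith), mul_assoc]
    gcongr
    nlinarith
  have hsum : ∀ β, α < β → Summable fun k => ‖x k‖ ^ (-β) := fun β hβ =>
    summable_norm_rpow_neg_of_card_le (hα.trans hβ) hβ hcard hx
  refine ⟨hsum, ?_⟩
  have hinv : Summable fun k => ‖x k‖⁻¹ := by
    simpa [Real.rpow_neg_one] using hsum 1 hα1
  funext z
  have hmul : Multipliable fun k => (1 + z / x k) := by
    refine multipliable_one_add_of_summable ?_
    simpa [div_eq_mul_inv] using hinv.mul_left ‖z‖
  -- the finite sets of zeros in the discs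
  let S : ℕ → Finset ℕ := fun n => (hfin n).toFinset
  have hSmem : ∀ n k, k ∈ S n ↔ ‖x k‖ ≤ n := fun n k => by simp [S]
  have hStop : Tendsto S atTop atTop := by
    refine tendsto_atTop_finset_of_monotone (fun m n hmn k hk => ?_) fun k => ?_
    · rw [hSmem] at hk ⊢
      exact hk.trans (by exact_mod_cast hmn)
    · obtain ⟨n, hn⟩ := exists_nat_ge ‖x k‖
      exact ⟨n, (hSmem n k).2 hn⟩
  have hprod := hmul.hasProd.comp hStop
  have hdiv := fun n => exists_eq_mul_prod_one_add_div hf hx (S n) (card_filter_le_order hmult (S n))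
  choose g hg hfg hord using hdiv
  have htop : ∀ z, analyticOrderAt f z ≠ ⊤ := fun z h => by
    have := (AnalyticOnNhd.analyticOrderAt_eq_top_iff_eq_zero z fun w => hf.analyticAt w).1 h
    simp [this] at hf0
  -- All zeros of f in the closed disc of radius n have been divided out with full multiplicity.
  have hgne : ∀ n : ℕ, ∀ w : ℂ, ‖w‖ ≤ n → g n w ≠ 0 := by
    intro n w hw
    have h1 : ((S n).filter fun k => x k = -w : Finset ℕ).card = analyticOrderAt f w := by
      rw [← hmult, ← Set.encard_coe_eq_coe_finsetCard]
      congr 1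
      ext k
      simp only [Finset.coe_filter, Set.mem_ofPred_eq, hSmem, and_iff_right_iff_imp]
      intro h
      simpa [h] using hw
    have h2 := hord n w
    rw [h1] at h2
    have h3 : analyticOrderAt (g n) w = 0 := by
      have h4 := htop w
      lift analyticOrderAt f w to ℕ using h4 with a
      have h5 : analyticOrderAt (g n) w ≠ ⊤ := by
        rintro h6
        simp [h6] at h2
      lift analyticOrderAt (g n) w to ℕ using h5 with b
      norm_cast at h2 ⊢
      omega
    exact (((hg n).analyticAt w).analyticOrderAt_eq_zero).1 h3
  have hg1 : Tendsto (fun n => g n z) atTop (𝓝 1) := by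
    have hg0 : ∀ n, g n 0 = 1 := fun n => by simpa [hf0] using (hfg n 0).symm
    -- On the disc of radius n the quotient has a logarithm with real part at most C(1 + (4n)^α).
    -- Borel–Carathéodory bounds this logarithm at the fixed point z by O(n^(α-1)), which tends to 0
    -- because α < 1; no exponential factor is left.
    have hbound : ∀ᶠ n : ℕ in atTop, ∃ h : ℂ, exp h = g n z ∧
        ‖h‖ ≤ 2 * (C * (1 + (4 * (n : ℝ)) ^ α)) * ‖z‖ / (n - ‖z‖) := by
      filter_upwards [eventually_gt_atTop ⌈‖z‖⌉₊] with n hn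
      have hzn : ‖z‖ < n := (Nat.le_ceil _).trans_lt (by exact_mod_cast hn)
      have hn0 : (0 : ℝ) < n := (norm_nonneg z).trans_lt hzn
      obtain ⟨h, hh, hh0, hhe⟩ := exists_log_on_ball (hg n) (hg0 n) hn0
        fun w hw => hgne n w (by simpa using (Metric.mem_ball.1 hw).le)
      have hzmem : z ∈ Metric.ball (0 : ℂ) n := by simpa using hzn
      refine ⟨h z, hhe z hzmem, borelCaratheodory_zero (by positivity) hh ?_ hn0 hzmem hh0⟩
      intro w hw
      have hwn : ‖w‖ < n := by simpa using hw
      have h1 := norm_le_of_eq_mul_prod (hg n) hx (hfg n) hn0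
        (fun k hk => (hSmem n k).1 hk) (hM n) (z := w) (by linarith)
      have h2 : Real.exp (C * (1 + (4 * (n : ℝ)) ^ α)) / 3 ^ (S n).card
          ≤ Real.exp (C * (1 + (4 * (n : ℝ)) ^ α)) :=
        div_le_self (by positivity) (one_le_pow₀ (by norm_num))
      have h3 := h1.trans h2
      rw [← hhe w hw, norm_exp, Real.exp_le_exp] at h3
      exact h3
    have hlim : Tendsto (fun n : ℕ => 2 * (C * (1 + (4 * (n : ℝ)) ^ α)) * ‖z‖ / (n - ‖z‖))
        atTop (𝓝 0) := by
      have h1 : Tendsto (fun n : ℕ => (n : ℝ)⁻¹) atTop (𝓝 0) := tendsto_inv_atTop_nhds_zero_nat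
      have h2 : Tendsto (fun n : ℕ => (n : ℝ) ^ (α - 1)) atTop (𝓝 0) := by
        have := (tendsto_rpow_neg_atTop (y := 1 - α) (by linarith)).comp
          (tendsto_natCast_atTop_atTop (R := ℝ))
        simpa [Function.comp_def] using this
      have h3 : Tendsto (fun n : ℕ => 2 * (C * ((n : ℝ)⁻¹ + 4 ^ α * (n : ℝ) ^ (α - 1))) * ‖z‖ /
          (1 - ‖z‖ * (n : ℝ)⁻¹)) atTop (𝓝 (2 * (C * (0 + 4 ^ α * 0)) * ‖z‖ / (1 - ‖z‖ * 0))) := by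
        refine Tendsto.div ?_ ?_ (by simp)
        · exact (((h1.add (h2.const_mul _)).const_mul _).const_mul _).mul_const _
        · exact (h1.const_mul _).const_sub _
      simp only [mul_zero, add_zero, sub_zero, zero_mul, div_one] at h3
      refine h3.congr' ?_
      filter_upwards [eventually_gt_atTop 0] with n hn
      have hn0 : (0 : ℝ) < n := by exact_mod_cast hn
      rw [Real.mul_rpow (by norm_num) hn0.le, Real.rpow_sub_one hn0.ne',
        ← mul_div_mul_right _ _ hn0.ne']
      congr 1
      · field_simp
      · field_simp
    rw [Metric.tendsto_nhds]
    intro ε hε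
    have hc : Tendsto exp (𝓝 0) (𝓝 1) := by simpa using continuous_exp.tendsto 0
    obtain ⟨δ, hδ, hδ'⟩ := Metric.eventually_nhds_iff.1 ((Metric.tendsto_nhds.1 hc) ε hε)
    filter_upwards [hbound, hlim.eventually (gt_mem_nhds hδ)] with n ⟨h, h1, h2⟩ hn
    rw [← h1]
    exact hδ' (by simpa using h2.trans_lt hn)
  have hlim : Tendsto (fun _ : ℕ => f z) atTop (𝓝 (1 * ∏' k, (1 + z / x k))) :=
    (hg1.mul hprod).congr fun n => (hfg n z).symm
  rw [one_mul] at hlim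
  exact tendsto_nhds_unique tendsto_const_nhds hlim

theorem tendsto_norm_atTop_of_finite {x : ℕ → ℂ} (h : ∀ r : ℝ, {k | ‖x k‖ ≤ r}.Finite) :
    Tendsto (fun k => ‖x k‖) atTop atTop := by
  rw [← Nat.cofinite_eq_atTop]
  refine tendsto_atTop.2 fun r => ?_
  refine ((h r).subset fun k hk => ?_)
  exact (not_le.1 (show ¬ r ≤ ‖x k‖ from hk)).le

/-! ### The positive kernel of the completed zeta function -/

open HurwitzZeta in
/-- The positive kernel whose Mellin transform is `completedRiemannZeta₀`. -/
def zetaKernel : ℝ → ℝ :=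
  (Set.Ioi 1).indicator (fun t => evenKernel 0 t - 1) +
  (Set.Ioo 0 1).indicator (fun t => evenKernel 0 t - t ^ (-(1 / 2) : ℝ))

open HurwitzZeta in
theorem one_le_evenKernel_zero {t : ℝ} (ht : 0 < t) : 1 ≤ evenKernel 0 t := by
  have h := hasSum_int_evenKernel 0 ht
  have h1 := h.summable.le_tsum (0 : ℤ) fun _ _ => (Real.exp_pos _).le
  rw [h.tsum_eq] at h1
  simpa using h1

-- The theta function is at least 1 because of its term of index 0; on (0,1) the functional equation
-- turns this into θ(t) ≥ t^(-1/2). Positivity is what reduces all later bounds to the real axis.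
open HurwitzZeta in
theorem zetaKernel_nonneg (t : ℝ) : 0 ≤ zetaKernel t := by
  refine add_nonneg (Set.indicator_nonneg (fun t ht => ?_) _)
    (Set.indicator_nonneg (fun t ht => ?_) _)
  · linarith [one_le_evenKernel_zero (zero_lt_one.trans (show 1 < t from ht))]
  · have h1 := evenKernel_functional_equation 0 t
    rw [← evenKernel_eq_cosKernel_of_zero] at h1
    have h2 := one_le_evenKernel_zero (t := 1 / t) (one_div_pos.2 ht.1)
    have h3 : 0 < t ^ (1 / 2 : ℝ) := Real.rpow_pos_of_pos ht.1 _
    rw [h1, Real.rpow_neg ht.1.le, ← one_div]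
    have := mul_le_mul_of_nonneg_left h2 (one_div_pos.2 h3).le
    linarith

open HurwitzZeta in
theorem f_modif_eq_zetaKernel (t : ℝ) : (hurwitzEvenFEPair 0).f_modif t = (zetaKernel t : ℂ) := by
  simp only [WeakFEPair.f_modif, zetaKernel, hurwitzEvenFEPair, Pi.add_apply, Set.indicator]
  split_ifs <;> simp

open HurwitzZeta in
theorem hasMellin_zetaKernel (s : ℂ) :
    HasMellin (fun t => (zetaKernel t : ℂ)) (s / 2) (2 * completedRiemannZeta₀ s) := by
  have h := (hurwitzEvenFEPair 0).isStrongFEPair_toStrongFEPair.hasMellin (s / 2)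
  have h1 : (hurwitzEvenFEPair 0).toStrongFEPair.f = fun t => (zetaKernel t : ℂ) :=
    funext f_modif_eq_zetaKernel
  rw [h1] at h
  refine ⟨h.1, ?_⟩
  have h2 : completedRiemannZeta₀ s = (hurwitzEvenFEPair 0).Λ₀ (s / 2) / 2 := rfl
  rw [h2, WeakFEPair.Λ₀, show (hurwitzEvenFEPair 0).f_modif = fun t => (zetaKernel t : ℂ) from h1]
  ring

/-- The real Mellin transform of `zetaKernel`. -/
def zetaKernelMoment (σ : ℝ) : ℝ := (∫ t in Set.Ioi (0 : ℝ), t ^ (σ / 2 - 1) * zetaKernel t) / 2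

theorem integrableOn_zetaKernel (σ : ℝ) :
    MeasureTheory.IntegrableOn (fun t : ℝ => t ^ (σ / 2 - 1) * zetaKernel t) (Set.Ioi 0) := by
  have h := (hasMellin_zetaKernel (σ : ℂ)).1.norm
  refine (MeasureTheory.integrableOn_congr_fun (fun t ht => ?_) measurableSet_Ioi).1 h
  have ht' : (0 : ℝ) < t := ht
  rw [norm_smul, norm_cpow_eq_rpow_re_of_pos ht', norm_real, Real.norm_of_nonneg
    (zetaKernel_nonneg t)]
  simp

theorem completedRiemannZeta₀_ofReal (σ : ℝ) :
    completedRiemannZeta₀ σ = (zetaKernelMoment σ : ℂ) := by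
  have h := (hasMellin_zetaKernel (σ : ℂ)).2
  rw [mellin] at h
  have h1 : (∫ t in Set.Ioi (0 : ℝ), (t : ℂ) ^ ((σ : ℂ) / 2 - 1) • (zetaKernel t : ℂ)) =
      ((∫ t in Set.Ioi (0 : ℝ), t ^ (σ / 2 - 1) * zetaKernel t : ℝ) : ℂ) := by
    rw [← integral_complex_ofReal]
    refine MeasureTheory.setIntegral_congr_fun measurableSet_Ioi fun t ht => ?_
    have ht' : (0 : ℝ) < t := ht
    simp only [smul_eq_mul]
    push_cast [ofReal_cpow ht'.le]
    rfl
  rw [h1] at h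
  rw [zetaKernelMoment]
  push_cast
  rw [h]
  ring

/-- The modulus of t^(s/2-1) depends only on Re s, and the kernel is nonnegative. -/
theorem norm_completedRiemannZeta₀_le (s : ℂ) :
    ‖completedRiemannZeta₀ s‖ ≤ zetaKernelMoment s.re := by
  have h := (hasMellin_zetaKernel s).2
  have h1 : completedRiemannZeta₀ s = mellin (fun t => (zetaKernel t : ℂ)) (s / 2) / 2 := by
    rw [h]; ring
  rw [h1, norm_div, zetaKernelMoment, mellin]
  simp only [norm_ofNat]
  gcongr
  refine MeasureTheory.norm_integral_le_of_norm_le (integrableOn_zetaKernel s.re) ?_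
  refine (MeasureTheory.ae_restrict_iff' measurableSet_Ioi).2 (MeasureTheory.ae_of_all _ fun t ht => ?_)
  have ht' : (0 : ℝ) < t := ht
  rw [norm_smul, norm_cpow_eq_rpow_re_of_pos ht', norm_real, Real.norm_of_nonneg
    (zetaKernel_nonneg t)]
  simp

theorem zetaKernelMoment_nonneg (σ : ℝ) : 0 ≤ zetaKernelMoment σ :=
  (norm_nonneg _).trans (norm_completedRiemannZeta₀_le σ)

/-- Interpolation between two exponents: t^σ is dominated by t^a for t ≤ 1 and by t^b for t ≥ 1. -/
theorem zetaKernelMoment_le {a σ b : ℝ} (h1 : a ≤ σ) (h2 : σ ≤ b) :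
    zetaKernelMoment σ ≤ zetaKernelMoment a + zetaKernelMoment b := by
  rw [zetaKernelMoment, zetaKernelMoment, zetaKernelMoment, ← add_div,
    ← MeasureTheory.integral_add (integrableOn_zetaKernel a) (integrableOn_zetaKernel b)]
  refine div_le_div_of_nonneg_right ?_ zero_le_two
  refine MeasureTheory.setIntegral_mono_on (integrableOn_zetaKernel σ)
    ((integrableOn_zetaKernel a).add (integrableOn_zetaKernel b)) measurableSet_Ioi fun t ht => ?_
  have ht' : (0 : ℝ) < t := ht
  rw [← add_mul]
  refine mul_le_mul_of_nonneg_right ?_ (zetaKernel_nonneg t)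
  have ha : 0 < t ^ (a / 2 - 1) := Real.rpow_pos_of_pos ht' _
  have hb : 0 < t ^ (b / 2 - 1) := Real.rpow_pos_of_pos ht' _
  rcases le_total t 1 with h | h
  · have := Real.rpow_le_rpow_of_exponent_ge ht' h (show a / 2 - 1 ≤ σ / 2 - 1 by linarith)
    linarith
  · have := Real.rpow_le_rpow_of_exponent_le h (show σ / 2 - 1 ≤ b / 2 - 1 by linarith)
    linarith

/-- Both moments equal Λ₀(1) = (γ - log 4π)/2 + 1, which is below 4/3. The bound 4 is what is needed
against σ(1-σ) ≤ 1/4 to make ξ positive on [0,1]. -/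
theorem zetaKernelMoment_zero_add_one_lt : zetaKernelMoment 0 + zetaKernelMoment 1 < 4 := by
  have h0 : zetaKernelMoment 0 = zetaKernelMoment 1 := by
    have := completedRiemannZeta₀_one_sub 1
    rw [sub_self] at this
    have h1 := completedRiemannZeta₀_ofReal 0
    have h2 := completedRiemannZeta₀_ofReal 1
    rw [ofReal_zero] at h1
    rw [ofReal_one] at h2
    rw [h1, h2] at this
    exact_mod_cast this
  have h1 : zetaKernelMoment 1 = (Real.eulerMascheroniConstant - Real.log (4 * Real.pi)) / 2 + 1 := by
    have h2 := completedRiemannZeta₀_ofReal 1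
    rw [ofReal_one, completedRiemannZeta₀_one] at h2
    have h3 : Complex.log (4 * Real.pi) = (Real.log (4 * Real.pi) : ℂ) := by
      rw [ofReal_log (by positivity)]; push_cast; rfl
    rw [h3] at h2
    exact_mod_cast h2.symm
  have h2 : 0 < Real.log (4 * Real.pi) := Real.log_pos (by linarith [Real.pi_gt_three])
  linarith [Real.eulerMascheroniConstant_lt_two_thirds]

/-! ### The function ξ: real positivity, zeros and growth -/

/-- The entire function `s (s - 1) Λ(s)`. -/
def riemannXi (s : ℂ) : ℂ := 1 + s * (s - 1) * completedRiemannZeta₀ s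

theorem differentiable_riemannXi : Differentiable ℂ riemannXi := by
  have := differentiable_completedZeta₀
  unfold riemannXi
  fun_prop

theorem riemannXi_one_sub (s : ℂ) : riemannXi (1 - s) = riemannXi s := by
  simp only [riemannXi, completedRiemannZeta₀_one_sub]
  ring

theorem riemannXi_one : riemannXi 1 = 1 := by simp [riemannXi]

theorem riemannXi_eq_completedZeta {s : ℂ} (h0 : s ≠ 0) (h1 : s ≠ 1) :
    riemannXi s = s * (s - 1) * completedRiemannZeta s := by
  have h1' : 1 - s ≠ 0 := sub_ne_zero.2 h1.symm
  rw [riemannXi, completedRiemannZeta_eq]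
  field_simp
  ring

theorem riemannZeta_eq_riemannXi {s : ℂ} (h0 : s ≠ 0) (h1 : s ≠ 1) :
    riemannZeta s = riemannXi s * ((Gammaℝ s)⁻¹ / (s * (s - 1))) := by
  have h1' : s - 1 ≠ 0 := sub_ne_zero.2 h1
  rw [riemannXi_eq_completedZeta h0 h1, riemannZeta_def_of_ne_zero h0]
  field_simp

/-- On [0,1] one has σ(1-σ) ≤ 1/4 while Λ₀(σ) < 4; outside [0,1] both σ(σ-1) and Λ₀(σ) are
nonnegative. This excludes real zeros and later fixes branches of the logarithm. -/
theorem riemannXi_ofReal_pos (σ : ℝ) : ∃ r : ℝ, 0 < r ∧ riemannXi σ = r := by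
  refine ⟨1 + σ * (σ - 1) * zetaKernelMoment σ, ?_, by
    rw [riemannXi, completedRiemannZeta₀_ofReal]; push_cast; ring⟩
  have h := zetaKernelMoment_nonneg σ
  by_cases hσ : 0 ≤ σ ∧ σ ≤ 1
  · have h1 := zetaKernelMoment_le hσ.1 hσ.2
    have h2 := zetaKernelMoment_zero_add_one_lt
    nlinarith [sq_nonneg (σ - 1 / 2), mul_nonneg hσ.1 (sub_nonneg.2 hσ.2)]
  · have : 0 ≤ σ * (σ - 1) := by
      by_cases h0 : 0 ≤ σ
      · have : 1 < σ := by
          by_contra h3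
          exact hσ ⟨h0, not_lt.1 h3⟩
        nlinarith
      · nlinarith
    have := mul_nonneg this h
    linarith

theorem Gammaℝ_ne_zero_of_im_pos {s : ℂ} (hs : 0 < s.im) : Gammaℝ s ≠ 0 := by
  rw [ne_eq, Gammaℝ_eq_zero_iff]
  rintro ⟨n, rfl⟩
  simp at hs

theorem analyticOrderAt_riemannZeta_eq {s : ℂ} (hs : 0 < s.im) :
    analyticOrderAt riemannZeta s = analyticOrderAt riemannXi s := by
  have h0 : s ≠ 0 := by rintro rfl; simp at hs
  have h1 : s ≠ 1 := by rintro rfl; simp at hs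
  have hev : riemannZeta =ᶠ[𝓝 s] riemannXi * fun s => (Gammaℝ s)⁻¹ / (s * (s - 1)) := by
    filter_upwards [isOpen_ne.mem_nhds h0, isOpen_ne.mem_nhds h1] with z hz0 hz1
    exact riemannZeta_eq_riemannXi hz0 hz1
  have hne : s * (s - 1) ≠ 0 := mul_ne_zero h0 (sub_ne_zero.2 h1)
  have han : AnalyticAt ℂ (fun s => (Gammaℝ s)⁻¹ / (s * (s - 1))) s :=
    (differentiable_Gammaℝ_inv.analyticAt s).div (by fun_prop) hne
  rw [analyticOrderAt_congr hev, analyticOrderAt_mul (differentiable_riemannXi.analyticAt s) han,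
    han.analyticOrderAt_eq_zero.2, add_zero]
  exact div_ne_zero (inv_ne_zero (Gammaℝ_ne_zero_of_im_pos hs)) hne

theorem riemannXi_ne_zero_of_one_le_re {s : ℂ} (hs : 1 ≤ s.re) : riemannXi s ≠ 0 := by
  by_cases h1 : s = 1
  · simp [h1, riemannXi_one]
  have h0 : s ≠ 0 := by rintro rfl; norm_num at hs
  intro h
  have := riemannZeta_eq_riemannXi h0 h1
  rw [h, zero_mul] at this
  exact riemannZeta_ne_zero_of_one_le_re hs this

theorem re_mem_Ioo_of_riemannXi_eq_zero {s : ℂ} (hs : riemannXi s = 0) : s.re ∈ Set.Ioo 0 1 := by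
  constructor
  · by_contra h
    refine riemannXi_ne_zero_of_one_le_re (s := 1 - s) ?_ (by rw [riemannXi_one_sub, hs])
    simp only [sub_re, one_re]
    linarith
  · by_contra h
    exact riemannXi_ne_zero_of_one_le_re (not_lt.1 h) hs

theorem exists_norm_riemannZeta_le : ∃ K : ℝ, 0 < K ∧ ∀ n : ℕ, ‖riemannZeta (2 * n + 2)‖ ≤ K := by
  have hs : Summable fun k : ℕ => 1 / ((k : ℝ) + 1) ^ 2 := by
    have := (summable_nat_add_iff 1).2 (Real.summable_one_div_nat_pow (p := 2).2 (by norm_num))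
    simpa using this
  refine ⟨∑' k : ℕ, 1 / ((k : ℝ) + 1) ^ 2, ?_, fun n => ?_⟩
  · exact hs.tsum_pos (fun k => by positivity) 0 (by norm_num)
  · have hre : ((2 * n + 2 : ℂ)).re = 2 * n + 2 := by simp
    rw [zeta_eq_tsum_one_div_nat_add_one_cpow (by rw [hre]; linarith [n.cast_nonneg (α := ℝ)])]
    refine tsum_of_norm_bounded hs.hasSum fun k => ?_
    have hk : (0 : ℝ) < (k : ℝ) + 1 := by positivity
    rw [norm_div, norm_one, show ((k : ℂ) + 1) = (((k : ℝ) + 1 : ℝ) : ℂ) by push_cast; rfl,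
      norm_cpow_eq_rpow_re_of_pos hk, hre]
    have : ((k : ℝ) + 1) ^ 2 ≤ ((k : ℝ) + 1) ^ (2 * (n : ℝ) + 2) := by
      rw [← Real.rpow_natCast]
      exact Real.rpow_le_rpow_of_exponent_le (by linarith [k.cast_nonneg (α := ℝ)])
        (by push_cast; linarith [n.cast_nonneg (α := ℝ)])
    gcongr

/-- At even integers Λ(2n+2) = π^(-n-1) n! ζ(2n+2), with ζ bounded and n! ≤ n^n; the two pole terms
separating Λ from Λ₀ are bounded. -/
theorem exists_zetaKernelMoment_le : ∃ K : ℝ, 0 < K ∧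
    ∀ n : ℕ, zetaKernelMoment (2 * n + 2) ≤ K * (n : ℝ) ^ n := by
  obtain ⟨K, hK, hζ⟩ := exists_norm_riemannZeta_le
  refine ⟨K + 2, by linarith, fun n => ?_⟩
  have hn0 : (0 : ℝ) ≤ n := n.cast_nonneg
  have hfac : ((n.factorial : ℕ) : ℝ) ≤ (n : ℝ) ^ n := by exact_mod_cast Nat.factorial_le_pow n
  have hone : (1 : ℝ) ≤ (n : ℝ) ^ n := by
    refine le_trans ?_ hfac
    exact_mod_cast n.factorial_pos
  have h0 : (2 * n + 2 : ℂ) ≠ 0 := by exact_mod_cast (by omega : 2 * n + 2 ≠ 0)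
  have hre : (2 * n + 2 : ℂ).re = 2 * n + 2 := by simp
  have hG : Gammaℝ (2 * n + 2) = (Real.pi : ℂ) ^ (-(n + 1 : ℂ)) * n.factorial := by
    rw [Gammaℝ_def, show (2 * n + 2 : ℂ) / 2 = n + 1 by ring, Complex.Gamma_nat_eq_factorial,
      show -(2 * n + 2 : ℂ) / 2 = -(n + 1 : ℂ) by ring]
  have hGn : ‖Gammaℝ (2 * n + 2)‖ ≤ (n : ℝ) ^ n := by
    rw [hG, norm_mul, norm_cpow_eq_rpow_re_of_pos Real.pi_pos, norm_natCast]
    have : Real.pi ^ (-(n + 1 : ℂ)).re ≤ 1 := by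
      refine Real.rpow_le_one_of_one_le_of_nonpos (by linarith [Real.pi_gt_three]) ?_
      simp
      linarith
    calc _ ≤ 1 * (n.factorial : ℝ) := by gcongr
      _ ≤ _ := by simpa using hfac
  have hG0 : Gammaℝ (2 * n + 2) ≠ 0 := Gammaℝ_ne_zero_of_re_pos (by rw [hre]; linarith)
  have h1 : completedRiemannZeta (2 * n + 2) = Gammaℝ (2 * n + 2) * riemannZeta (2 * n + 2) := by
    rw [riemannZeta_def_of_ne_zero h0, mul_div_cancel₀ _ hG0]
  have h2 : ‖completedRiemannZeta (2 * n + 2)‖ ≤ K * (n : ℝ) ^ n := by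
    rw [h1, norm_mul, mul_comm]
    gcongr
    exact hζ n
  have h3 : completedRiemannZeta₀ (2 * n + 2) = completedRiemannZeta (2 * n + 2)
      + 1 / (2 * n + 2) + 1 / (1 - (2 * n + 2)) := by
    rw [completedRiemannZeta_eq]; ring
  have h4 := completedRiemannZeta₀_ofReal (2 * n + 2)
  push_cast at h4
  have h5 : zetaKernelMoment (2 * n + 2) = ‖completedRiemannZeta₀ (2 * n + 2)‖ := by
    rw [h4, norm_real, Real.norm_of_nonneg (zetaKernelMoment_nonneg _)]
  have h6 : ‖(1 / (2 * n + 2) : ℂ)‖ ≤ 1 := by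
    rw [norm_div, norm_one, show (2 * n + 2 : ℂ) = ((2 * n + 2 : ℝ) : ℂ) by push_cast; rfl,
      norm_real, Real.norm_of_nonneg (by positivity), div_le_one (by positivity)]
    linarith
  have h7 : ‖(1 / (1 - (2 * n + 2)) : ℂ)‖ ≤ 1 := by
    rw [norm_div, norm_one, show (1 - (2 * n + 2) : ℂ) = -((2 * n + 1 : ℝ) : ℂ) by push_cast; ring,
      norm_neg, norm_real, Real.norm_of_nonneg (by positivity), div_le_one (by positivity)]
    linarith
  rw [h5, h3]
  have := norm_add₃_le (a := completedRiemannZeta (2 * n + 2)) (b := (1 / (2 * n + 2) : ℂ))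
    (c := (1 / (1 - (2 * n + 2)) : ℂ))
  nlinarith


/-- For Re w ≥ 0 the moment at Re(1/2+w) is interpolated between 0 and an even integer 2n+2 with n ≤
|w| + 1, so the growth is that of r^r = exp(r log r) with r = |w| + 1. The other half-plane follows
from the functional equation. -/
theorem exists_norm_riemannXi_le {β : ℝ} (hβ : 1 < β) : ∃ C : ℝ, 0 < C ∧
    ∀ w : ℂ, ‖riemannXi (1 / 2 + w)‖ ≤ Real.exp (C * (1 + ‖w‖ ^ β)) := by
  obtain ⟨K, hK, hmom⟩ := exists_zetaKernelMoment_le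
  have hL0 := zetaKernelMoment_nonneg 0
  set A : ℝ := 1 + 2 * (zetaKernelMoment 0 + K) with hA
  have hA1 : 1 ≤ A := by rw [hA]; linarith
  have hlogA : 0 ≤ Real.log A := Real.log_nonneg hA1
  have hβ0 : 0 < β - 1 := by linarith
  -- The three summands absorb log A, 2 log r and r log r in log(A r² r^r), the last through log r ≤
  -- r^(β-1)/(β-1).
  set B : ℝ := Real.log A + 2 + 1 / (β - 1) with hB
  have hB0 : 0 < B := by positivity
  -- the bound in terms of `r = ‖w‖ + 1`
  have hmain : ∀ w : ℂ, 0 ≤ w.re → ‖riemannXi (1 / 2 + w)‖ ≤ Real.exp (B * (‖w‖ + 1) ^ β) := by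
    intro w hw
    set r : ℝ := ‖w‖ + 1 with hr
    have hr1 : 1 ≤ r := by linarith [norm_nonneg w]
    set n : ℕ := ⌈‖w‖⌉₊ with hn
    have hn1 : ‖w‖ ≤ n := Nat.le_ceil _
    have hn2 : (n : ℝ) ≤ r := (Nat.ceil_lt_add_one (norm_nonneg w)).le
    have hrr : (1 : ℝ) ≤ r ^ r := Real.one_le_rpow hr1 (by linarith)
    have hnn : (n : ℝ) ^ n ≤ r ^ r := by
      calc (n : ℝ) ^ n ≤ r ^ n := by gcongr
        _ = r ^ (n : ℝ) := (Real.rpow_natCast _ _).symm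
        _ ≤ r ^ r := Real.rpow_le_rpow_of_exponent_le hr1 hn2
    have hre : (1 / 2 + w).re ≤ 2 * n + 2 := by
      simp only [add_re, one_div, inv_re, re_ofNat, normSq_ofNat]
      have := w.re_le_norm
      linarith
    have hre0 : 0 ≤ (1 / 2 + w).re := by
      simp only [add_re, one_div, inv_re, re_ofNat, normSq_ofNat]
      linarith
    have h1 : ‖completedRiemannZeta₀ (1 / 2 + w)‖ ≤ (zetaKernelMoment 0 + K) * r ^ r := by
      refine (norm_completedRiemannZeta₀_le _).trans ((zetaKernelMoment_le hre0 hre).trans ?_)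
      have h2 := hmom n
      have h3 : K * (n : ℝ) ^ n ≤ K * r ^ r := by gcongr
      nlinarith
    have h2 : ‖(1 / 2 + w) * (1 / 2 + w - 1)‖ ≤ 2 * r ^ 2 := by
      rw [show (1 / 2 + w) * (1 / 2 + w - 1) = w * w - 1 / 4 by ring]
      refine (norm_sub_le _ _).trans ?_
      rw [norm_mul]
      have : ‖(1 / 4 : ℂ)‖ ≤ 1 := by norm_num
      nlinarith [norm_nonneg w]
    have h3 : ‖riemannXi (1 / 2 + w)‖ ≤ A * r ^ 2 * r ^ r := by
      rw [riemannXi]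
      refine (norm_add_le _ _).trans ?_
      rw [norm_mul, norm_one]
      have h4 := mul_le_mul h2 h1 (norm_nonneg _) (by positivity)
      have h5 : 1 ≤ r ^ 2 * r ^ r := by nlinarith
      calc _ ≤ r ^ 2 * r ^ r + 2 * r ^ 2 * ((zetaKernelMoment 0 + K) * r ^ r) := add_le_add h5 h4
        _ = _ := by rw [hA]; ring
    refine h3.trans ?_
    have hrpos : 0 < r := by linarith
    have hrβ : r ≤ r ^ β := by
      simpa using Real.rpow_le_rpow_of_exponent_le hr1 hβ.le
    have h1β : 1 ≤ r ^ β := hr1.trans hrβ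
    rw [← Real.log_le_iff_le_exp (by positivity), Real.log_mul (by positivity) (by positivity),
      Real.log_mul (by positivity) (by positivity), Real.log_pow, Real.log_rpow hrpos]
    have h6 : Real.log r ≤ r - 1 := Real.log_le_sub_one_of_pos hrpos
    have h7 : r * Real.log r ≤ r ^ β * (1 / (β - 1)) := by
      have := Real.log_le_rpow_div hrpos.le hβ0
      calc r * Real.log r ≤ r * (r ^ (β - 1) / (β - 1)) := by gcongr
        _ = r ^ β * (1 / (β - 1)) := by
          rw [Real.rpow_sub_one hrpos.ne']
          field_simp
    have h8 : Real.log A ≤ Real.log A * r ^ β := le_mul_of_one_le_right hlogA h1β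
    push_cast
    rw [hB]
    nlinarith
  refine ⟨B * 2 ^ β, by positivity, fun w => ?_⟩
  have hw : ‖riemannXi (1 / 2 + w)‖ ≤ Real.exp (B * (‖w‖ + 1) ^ β) := by
    rcases le_total 0 w.re with h | h
    · exact hmain w h
    · have := hmain (-w) (by simpa using h)
      rwa [norm_neg, ← riemannXi_one_sub, show 1 - (1 / 2 + -w) = 1 / 2 + w by ring] at this
  refine hw.trans (Real.exp_le_exp.2 ?_)
  rw [mul_assoc]
  gcongr
  have hw0 := norm_nonneg w
  have h2 : (0 : ℝ) ≤ 2 ^ β := by positivity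
  rcases le_total ‖w‖ 1 with h | h
  · calc (‖w‖ + 1) ^ β ≤ 2 ^ β := Real.rpow_le_rpow (by positivity) (by linarith) (by linarith)
      _ ≤ 2 ^ β * (1 + ‖w‖ ^ β) :=
        le_mul_of_one_le_right h2 (by linarith [Real.rpow_nonneg hw0 β])
  · calc (‖w‖ + 1) ^ β ≤ (2 * ‖w‖) ^ β :=
          Real.rpow_le_rpow (by positivity) (by linarith) (by linarith)
      _ = 2 ^ β * ‖w‖ ^ β := Real.mul_rpow (by norm_num) hw0
      _ ≤ 2 ^ β * (1 + ‖w‖ ^ β) := by gcongr; linarith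

/-! ### The function Ξ in the variable w² -/

/-- The entire function `Ξ` with `Ξ(w ^ 2) = riemannXi (1 / 2 + w)`. -/
def riemannXiSq (u : ℂ) : ℂ := riemannXi (1 / 2 + u ^ (1 / 2 : ℂ))

theorem cpow_half_sq (u : ℂ) : (u ^ (1 / 2 : ℂ)) ^ 2 = u := by
  rw [← cpow_nat_mul]
  simp

theorem norm_cpow_half (u : ℂ) : ‖u ^ (1 / 2 : ℂ)‖ = ‖u‖ ^ (1 / 2 : ℝ) := by
  have h := congrArg norm (cpow_half_sq u)
  rw [norm_pow] at h
  rw [← Real.sqrt_eq_rpow, ← h, Real.sqrt_sq (norm_nonneg _)]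

theorem riemannXi_half_sub (w : ℂ) : riemannXi (1 / 2 + -w) = riemannXi (1 / 2 + w) := by
  rw [← riemannXi_one_sub]
  congr 1
  ring

theorem riemannXiSq_sq (w : ℂ) : riemannXiSq (w ^ 2) = riemannXi (1 / 2 + w) := by
  rw [riemannXiSq]
  rcases sq_eq_sq_iff_eq_or_eq_neg.1 (cpow_half_sq (w ^ 2)) with h | h
  · rw [h]
  · rw [h, riemannXi_half_sub]

/-- Evenness of ξ(1/2+w) makes the choice of root immaterial: off the cut the principal root is
holomorphic, on the cut i√(-u) serves, and at 0 continuity removes the singularity. -/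
theorem differentiable_riemannXiSq : Differentiable ℂ riemannXiSq := by
  have hne : ∀ u : ℂ, u ≠ 0 → DifferentiableAt ℂ riemannXiSq u := by
    intro u hu
    by_cases hs : u ∈ slitPlane
    · have h1 : DifferentiableAt ℂ (fun u : ℂ => u ^ (1 / 2 : ℂ)) u :=
        differentiableAt_id.cpow_const hs
      exact (differentiable_riemannXi _).comp u (h1.const_add (1 / 2 : ℂ))
    · have hs' : -u ∈ slitPlane := by
        rw [mem_slitPlane_iff] at hs ⊢
        push Not at hs
        left
        rw [neg_re]
        rcases hs.1.lt_or_eq with h | h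
        · linarith
        · exact absurd (Complex.ext h hs.2) hu
      have h1 : DifferentiableAt ℂ (fun u : ℂ => I * (-u) ^ (1 / 2 : ℂ)) u :=
        ((differentiableAt_id.neg).cpow_const hs').const_mul I
      have h2 : DifferentiableAt ℂ (fun u => riemannXi (1 / 2 + I * (-u) ^ (1 / 2 : ℂ))) u :=
        (differentiable_riemannXi _).comp u (h1.const_add (1 / 2 : ℂ))
      refine h2.congr_of_eventuallyEq (Eventually.of_forall fun z => ?_)
      show riemannXiSq z = riemannXi (1 / 2 + I * (-z) ^ (1 / 2 : ℂ))
      rw [← riemannXiSq_sq, mul_pow, cpow_half_sq, I_sq]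
      simp
  intro u
  by_cases hu : u = 0
  · subst hu
    refine (analyticAt_of_differentiable_on_punctured_nhds_of_continuousAt
      (eventually_nhdsWithin_of_forall fun z hz => hne z hz) ?_).differentiableAt
    have h1 : ContinuousAt (fun u : ℂ => u ^ (1 / 2 : ℂ)) 0 := by
      rw [ContinuousAt, zero_cpow (by norm_num), tendsto_zero_iff_norm_tendsto_zero]
      simp only [norm_cpow_half]
      have : ContinuousAt (fun u : ℂ => ‖u‖ ^ (1 / 2 : ℝ)) 0 :=
        continuousAt_id.norm.rpow_const (Or.inr (by norm_num))
      simpa [ContinuousAt] using this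
    exact ContinuousAt.comp (g := riemannXi) (differentiable_riemannXi _).continuousAt
      (continuousAt_const.add h1)
  · exact hne u hu

theorem exists_norm_riemannXiSq_le {α : ℝ} (hα : 1 / 2 < α) : ∃ C : ℝ, 0 < C ∧
    ∀ u : ℂ, ‖riemannXiSq u‖ ≤ Real.exp (C * (1 + ‖u‖ ^ α)) := by
  obtain ⟨C, hC, h⟩ := exists_norm_riemannXi_le (β := 2 * α) (by linarith)
  refine ⟨C, hC, fun u => ?_⟩
  have := h (u ^ (1 / 2 : ℂ))
  rwa [norm_cpow_half, ← Real.rpow_mul (norm_nonneg u), show 1 / 2 * (2 * α) = α by ring] at this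

/-- Orders are preserved because squaring has nonzero derivative at iw ≠ 0, and because off the real
axis ζ and ξ differ by a nonvanishing holomorphic factor. -/
theorem analyticOrderAt_riemannXiSq_neg_sq {w : ℂ} (hw : 0 < w.re) :
    analyticOrderAt riemannXiSq (-w ^ 2) = analyticOrderAt riemannZeta (1 / 2 + I * w) := by
  have hw0 : w ≠ 0 := by rintro rfl; simp at hw
  have him : 0 < (1 / 2 + I * w).im := by simpa using hw
  rw [analyticOrderAt_riemannZeta_eq him]
  have h1 : analyticOrderAt (riemannXi ∘ fun w => 1 / 2 + w) (I * w) =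
      analyticOrderAt riemannXi (1 / 2 + I * w) := by
    refine analyticOrderAt_comp_of_deriv_ne_zero (g := fun w : ℂ => 1 / 2 + w) (by fun_prop) ?_
    simp
  have h2 : analyticOrderAt (riemannXiSq ∘ fun w => w ^ 2) (I * w) =
      analyticOrderAt riemannXiSq ((I * w) ^ 2) := by
    refine analyticOrderAt_comp_of_deriv_ne_zero (g := fun w : ℂ => w ^ 2) (by fun_prop) ?_
    simp [hw0]
  have h3 : (riemannXiSq ∘ fun w => w ^ 2) = riemannXi ∘ fun w => 1 / 2 + w :=
    funext riemannXiSq_sq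
  rw [← h1, ← h3, h2, mul_pow, I_sq, neg_one_mul]

theorem riemannXiSq_ofReal_pos {u : ℝ} (hu : 0 ≤ u) : ∃ r : ℝ, 0 < r ∧ riemannXiSq u = r := by
  obtain ⟨r, hr, h⟩ := riemannXi_ofReal_pos (1 / 2 + √u)
  refine ⟨r, hr, ?_⟩
  rw [← h, ← Real.sq_sqrt hu]
  push_cast
  rw [riemannXiSq_sq]
  simp [Real.sqrt_sq]

/-! ### Stirling's formula through Gudermann's series -/

/-- An analytic function vanishing at `0` is divisible by the coordinate. -/
theorem exists_eventually_eq_mul {f : ℂ → ℂ} (hf : AnalyticAt ℂ f 0) (h0 : f 0 = 0) :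
    ∃ g : ℂ → ℂ, AnalyticAt ℂ g 0 ∧ ∀ᶠ q in 𝓝 0, f q = q * g q := by
  have h1 : ((1 : ℕ) : ℕ∞) ≤ analyticOrderAt f 0 := by
    have := (hf.analyticOrderAt_ne_zero).2 h0
    exact_mod_cast Order.one_le_iff_ne_zero.2 this
  obtain ⟨g, hg, h⟩ := (natCast_le_analyticOrderAt hf).1 h1
  exact ⟨g, hg, by simpa using h⟩

/-- The difference between log(1+q) and its quadratic Taylor polynomial vanishes at 0 and has
derivative q²/(1+q), hence vanishes to order three. -/
theorem exists_log_one_add_eq : ∃ k : ℂ → ℂ, AnalyticAt ℂ k 0 ∧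
    ∀ᶠ q in 𝓝 (0 : ℂ), log (1 + q) = q - q ^ 2 / 2 + q ^ 3 * k q := by
  have hslit : ∀ᶠ q in 𝓝 (0 : ℂ), 1 + q ∈ slitPlane := by
    have : ContinuousAt (fun q : ℂ => 1 + q) 0 := by fun_prop
    exact this.eventually_mem (isOpen_slitPlane.mem_nhds (by simp))
  have hlog : AnalyticAt ℂ (fun q : ℂ => log (1 + q)) 0 :=
    AnalyticAt.clog (by fun_prop) (by simp)
  set f : ℂ → ℂ := fun q => log (1 + q) - (q - q ^ 2 / 2) with hf
  have hfan : AnalyticAt ℂ f 0 := hlog.sub (by fun_prop)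
  have hder : deriv f =ᶠ[𝓝 0] fun q => q ^ 2 * (1 + q)⁻¹ := by
    filter_upwards [hslit] with q hq
    have h1 : HasDerivAt (fun q : ℂ => log (1 + q)) (1 / (1 + q)) q :=
      ((hasDerivAt_id q).const_add 1).clog hq
    have h2 : HasDerivAt (fun q : ℂ => q - q ^ 2 / 2) (1 - q) q := by
      have := (hasDerivAt_id q).sub (((hasDerivAt_id q).pow 2).div_const 2)
      convert! this using 1
      simp
    have h3 : deriv f q = _ := (h1.sub h2).deriv
    rw [h3]
    have : 1 + q ≠ 0 := slitPlane_ne_zero hq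
    field_simp
    ring
  have hord : ((3 : ℕ) : ℕ∞) ≤ analyticOrderAt f 0 := by
    have h1 := hfan.analyticOrderAt_deriv_add_one
    have h2 : (fun q => f q - f 0) = f := by funext q; simp [hf]
    rw [h2, analyticOrderAt_congr hder] at h1
    rw [← h1]
    have h3 : ((2 : ℕ) : ℕ∞) ≤ analyticOrderAt (fun q : ℂ => q ^ 2 * (1 + q)⁻¹) 0 := by
      have han : AnalyticAt ℂ (fun q : ℂ => (1 + q)⁻¹) 0 :=
        AnalyticAt.inv (by fun_prop) (by simp)
      refine (natCast_le_analyticOrderAt ?_).2 ⟨fun q => (1 + q)⁻¹, han, ?_⟩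
      · exact AnalyticAt.mul (by fun_prop) han
      · simp
    calc ((3 : ℕ) : ℕ∞) = ((2 : ℕ) : ℕ∞) + 1 := by norm_num
      _ ≤ _ := by gcongr
  obtain ⟨k, hk, h⟩ := (natCast_le_analyticOrderAt hfan).1 hord
  refine ⟨k, hk, h.mono fun q hq => ?_⟩
  simp only [hf, sub_zero, smul_eq_mul] at hq
  linear_combination hq

/-- The terms of Gudermann's series for `log Γ`. -/
def gudermannTerm (w : ℂ) : ℂ := (w + 1 / 2) * log (1 + 1 / w) - 1

/-- Gudermann's series, the remainder in Stirling's formula. -/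
def gudermannSeries (w : ℂ) : ℂ := ∑' n : ℕ, gudermannTerm (w + n)

/-- With q = 1/w, the shift 1/2 is exactly what cancels the term linear in q; the resulting decay
1/w² makes the series converge. -/
theorem exists_gudermannTerm_inv_eq : ∃ g : ℂ → ℂ, AnalyticAt ℂ g 0 ∧
    ∀ᶠ q in 𝓝[≠] (0 : ℂ), gudermannTerm q⁻¹ = q ^ 2 * g q := by
  obtain ⟨k, hk, h⟩ := exists_log_one_add_eq
  refine ⟨fun q => k q - 1 / 4 + q * k q / 2, by fun_prop, ?_⟩
  filter_upwards [h.filter_mono nhdsWithin_le_nhds, self_mem_nhdsWithin] with q hq hq0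
  have hq0' : q ≠ 0 := hq0
  rw [gudermannTerm, one_div q⁻¹, inv_inv, hq]
  field_simp
  ring


/-- The shift w ↦ w+1 reads q ↦ q/(1+q), and q^(N+1) - (q/(1+q))^(N+1) has leading term
(N+1)q^(N+2). Hence the leading term of the error is removed by a difference that telescopes under
summation, with coefficient g(0)/(N+1). This plays the part of Euler–Maclaurin summation, without
Bernoulli numbers. -/
theorem exists_gudermannTerm_telescope (N : ℕ) : ∃ P : Polynomial ℂ, ∃ g : ℂ → ℂ,
    AnalyticAt ℂ g 0 ∧ ∀ᶠ q in 𝓝[≠] (0 : ℂ),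
      gudermannTerm q⁻¹ = P.eval q - P.eval (q / (1 + q)) + q ^ (N + 2) * g q := by
  induction N with
  | zero =>
    obtain ⟨g, hg, h⟩ := exists_gudermannTerm_inv_eq
    exact ⟨0, g, hg, by simpa using h⟩
  | succ N ih =>
    obtain ⟨P, g, hg, h⟩ := ih
    set c : ℂ := g 0 / (N + 1) with hc
    have hN : (N + 1 : ℂ) ≠ 0 := by exact_mod_cast N.succ_ne_zero
    set t : ℂ → ℂ := fun q => (∑ i ∈ Finset.range (N + 1), (1 + q) ^ i) / (1 + q) ^ (N + 1) with ht
    have htan : AnalyticAt ℂ t 0 := by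
      refine AnalyticAt.div ?_ (by fun_prop) (by simp)
      exact Finset.analyticAt_fun_sum _ fun i _ => by fun_prop
    have ht0 : t 0 = N + 1 := by simp [ht]
    obtain ⟨g', hg', h'⟩ := exists_eventually_eq_mul (f := fun q => g q - c * t q)
      (by fun_prop) (by simp only [ht0, hc]; field_simp; ring)
    refine ⟨P + Polynomial.C c * Polynomial.X ^ (N + 1), g', hg', ?_⟩
    have hne : ∀ᶠ q in 𝓝 (0 : ℂ), 1 + q ≠ 0 := by
      have : ContinuousAt (fun q : ℂ => 1 + q) 0 := by fun_prop
      exact this.eventually_ne (by simp)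
    filter_upwards [h, h'.filter_mono nhdsWithin_le_nhds, hne.filter_mono nhdsWithin_le_nhds]
      with q hq hq' hq1
    rw [hq]
    simp only [Polynomial.eval_add, Polynomial.eval_mul, Polynomial.eval_C, Polynomial.eval_pow,
      Polynomial.eval_X]
    have h1 : q ^ (N + 1) - (q / (1 + q)) ^ (N + 1) = q ^ (N + 2) * t q := by
      have h2 := geom_sum_mul (1 + q) (N + 1)
      rw [add_sub_cancel_left] at h2
      rw [ht, div_pow]
      have h3 : (1 + q) ^ (N + 1) ≠ 0 := pow_ne_zero _ hq1
      field_simp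
      linear_combination -q ^ (N + 1) * h2
    linear_combination q ^ (N + 2) * hq' - c * h1

theorem norm_le_norm_add_natCast {w : ℂ} (hw : 0 < w.re) (n : ℕ) : ‖w‖ ≤ ‖w + n‖ := by
  rw [Complex.norm_def, Complex.norm_def]
  refine Real.sqrt_le_sqrt ?_
  simp only [normSq_apply, add_re, natCast_re, add_im, natCast_im, add_zero]
  have : (0 : ℝ) ≤ n := n.cast_nonneg
  nlinarith

theorem half_succ_le_norm_add_natCast {w : ℂ} (hw : 0 < w.re) (hw1 : 1 ≤ ‖w‖) (n : ℕ) :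
    ((n : ℝ) + 1) / 2 ≤ ‖w + n‖ := by
  have h1 := norm_le_norm_add_natCast hw n
  have h2 := re_le_norm (w + n)
  simp only [add_re, natCast_re] at h2
  rcases Nat.eq_zero_or_pos n with h | h
  · subst h
    norm_num at h1 h2 ⊢
    linarith
  · have : (1 : ℝ) ≤ n := by exact_mod_cast h
    linarith

theorem summable_gudermann_majorant : Summable fun n : ℕ => (4 / ((n : ℝ) + 1) ^ 2) := by
  have := (summable_nat_add_iff 1).2 (Real.summable_one_div_nat_pow (p := 2).2 (by norm_num))
  simpa [div_eq_mul_inv] using this.mul_left 4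

/-- Summing the telescoped identity leaves P(1/w) - P(0) and an error series. Since |w+n| dominates
both |w| and (n+1)/2, its terms are O(|w|^(-N) (n+1)^(-2)). -/
theorem exists_gudermannSeries_asymptotic (N : ℕ) : ∃ P : Polynomial ℂ, P.eval 0 = 0 ∧
    ∃ C R : ℝ, 0 < R ∧ ∀ w : ℂ, 0 < w.re → R ≤ ‖w‖ →
      (Summable fun n : ℕ => gudermannTerm (w + n)) ∧
      ‖gudermannSeries w - P.eval w⁻¹‖ ≤ C * (‖w‖ ^ N)⁻¹ := by
  obtain ⟨P, g, hg, h⟩ := exists_gudermannTerm_telescope N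
  obtain ⟨M, hM⟩ : ∃ M, ∀ᶠ q in 𝓝 (0 : ℂ), ‖g q‖ ≤ M :=
    ⟨‖g 0‖ + 1, hg.continuousAt.norm.eventually (eventually_le_nhds (lt_add_one _))⟩
  obtain ⟨δ, hδ, hball⟩ := Metric.eventually_nhds_iff.1
    ((eventually_nhdsWithin_iff.1 h).and hM)
  have hM0 : 0 ≤ M := (norm_nonneg _).trans (hball (y := 0) (by simpa using hδ)).2
  refine ⟨P - Polynomial.C (P.eval 0), by simp, ∑' n : ℕ, M * (4 / ((n : ℝ) + 1) ^ 2),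
    max 1 (2 / δ), by positivity, fun w hw hwR => ?_⟩
  have hw1 : 1 ≤ ‖w‖ := (le_max_left _ _).trans hwR
  have hwδ : 2 / δ ≤ ‖w‖ := (le_max_right _ _).trans hwR
  have hne : ∀ n : ℕ, w + n ≠ 0 := fun n hn => by
    have := norm_le_norm_add_natCast hw n
    rw [hn, norm_zero] at this
    linarith
  set e : ℕ → ℂ := fun n => (w + n)⁻¹ ^ (N + 2) * g (w + n)⁻¹ with he
  have hq : ∀ n : ℕ, dist (w + n)⁻¹ 0 < δ := by
    intro n
    rw [dist_zero_right, norm_inv]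
    have h1 := norm_le_norm_add_natCast hw n
    have h2 : 2 / δ ≤ ‖w + n‖ := hwδ.trans h1
    rw [div_le_iff₀ hδ] at h2
    rw [inv_lt_iff_one_lt_mul₀ (by linarith)]
    linarith
  have hterm : ∀ n : ℕ, gudermannTerm (w + n) =
      P.eval (w + n)⁻¹ - P.eval (w + (n + 1 : ℕ))⁻¹ + e n := by
    intro n
    have h1 := (hball (hq n)).1 (inv_ne_zero (hne n))
    rw [inv_inv] at h1
    rw [h1]
    have h2 : (w + n)⁻¹ / (1 + (w + n)⁻¹) = (w + (n + 1 : ℕ))⁻¹ := by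
      have h3 := hne n
      have h4 := hne (n + 1)
      rw [show 1 + (w + n)⁻¹ = (w + (n + 1 : ℕ)) / (w + n) by field_simp; push_cast; ring]
      field_simp
    rw [h2]
  have hebound : ∀ n, ‖e n‖ ≤ (‖w‖ ^ N)⁻¹ * (M * (4 / ((n : ℝ) + 1) ^ 2)) := by
    intro n
    rw [he]
    simp only [norm_mul, norm_pow, norm_inv]
    have h1 := norm_le_norm_add_natCast hw n
    have h2 := half_succ_le_norm_add_natCast hw hw1 n
    have h3 := (hball (hq n)).2
    have hpos : 0 < ‖w‖ := by linarith
    have h4 : ‖w + n‖⁻¹ ^ N ≤ (‖w‖ ^ N)⁻¹ := by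
      rw [inv_pow]
      gcongr
    have h5 : ‖w + n‖⁻¹ ^ 2 ≤ 4 / ((n : ℝ) + 1) ^ 2 := by
      calc ‖w + n‖⁻¹ ^ 2 ≤ (((n : ℝ) + 1) / 2)⁻¹ ^ 2 := by gcongr
        _ = _ := by field_simp; norm_num
    rw [pow_add]
    calc _ ≤ (‖w‖ ^ N)⁻¹ * (4 / ((n : ℝ) + 1) ^ 2) * M := by gcongr
      _ = _ := by ring
  have hmaj := (summable_gudermann_majorant.mul_left M).mul_left (‖w‖ ^ N)⁻¹
  have hesum : Summable e := Summable.of_norm_bounded hmaj hebound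
  have hnorm : Tendsto (fun n : ℕ => (w + n)⁻¹) atTop (𝓝 0) := by
    refine squeeze_zero_norm (a := fun n : ℕ => 2 * (1 / ((n : ℝ) + 1))) (fun n => ?_) ?_
    · rw [norm_inv]
      have h2 := half_succ_le_norm_add_natCast hw hw1 n
      calc ‖w + n‖⁻¹ ≤ (((n : ℝ) + 1) / 2)⁻¹ := by gcongr
        _ = _ := by field_simp
    · simpa using tendsto_one_div_add_atTop_nhds_zero_nat.const_mul (2 : ℝ)
  have hPlim : Tendsto (fun n : ℕ => P.eval (w + n)⁻¹) atTop (𝓝 (P.eval 0)) :=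
    (P.continuous.tendsto 0).comp hnorm
  -- Telescoping only controls the partial sums; unconditional summability is taken from the
  -- termwise bound O(n^(-2)).
  have hshift : Summable fun n : ℕ => gudermannTerm (w + n) := by
    obtain ⟨g2, hg2, h2⟩ := exists_gudermannTerm_inv_eq
    obtain ⟨M2, hM2⟩ : ∃ M, ∀ᶠ q in 𝓝 (0 : ℂ), ‖g2 q‖ ≤ M :=
      ⟨‖g2 0‖ + 1, hg2.continuousAt.norm.eventually (eventually_le_nhds (lt_add_one _))⟩
    refine Summable.of_norm_bounded_eventually_nat (summable_gudermann_majorant.mul_left M2) ?_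
    filter_upwards [hnorm.eventually (eventually_nhdsWithin_iff.1 h2), hnorm.eventually hM2]
      with n hn hn2
    have h3 := hn (inv_ne_zero (hne n))
    rw [inv_inv] at h3
    rw [h3, norm_mul, norm_pow, norm_inv, mul_comm]
    have h2 := half_succ_le_norm_add_natCast hw hw1 n
    have h5 : ‖w + n‖⁻¹ ^ 2 ≤ 4 / ((n : ℝ) + 1) ^ 2 := by
      calc ‖w + n‖⁻¹ ^ 2 ≤ (((n : ℝ) + 1) / 2)⁻¹ ^ 2 := by gcongr
        _ = _ := by field_simp; norm_num
    gcongr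
    exact (norm_nonneg _).trans hn2
  refine ⟨hshift, ?_⟩
  have hlim : Tendsto (fun n : ℕ => ∑ i ∈ Finset.range n, gudermannTerm (w + i)) atTop
      (𝓝 (P.eval w⁻¹ - P.eval 0 + ∑' n, e n)) := by
    have h1 := (hPlim.const_sub (P.eval w⁻¹)).add hesum.hasSum.tendsto_sum_nat
    refine h1.congr fun n => ?_
    rw [Finset.sum_congr rfl fun i _ => hterm i, Finset.sum_add_distrib,
      Finset.sum_range_sub' fun i : ℕ => P.eval (w + i)⁻¹]
    simp
  have hval : gudermannSeries w = P.eval w⁻¹ - P.eval 0 + ∑' n, e n :=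
    tendsto_nhds_unique hshift.hasSum.tendsto_sum_nat hlim
  rw [hval]
  simp only [Polynomial.eval_sub, Polynomial.eval_C]
  rw [add_sub_cancel_left]
  refine (tsum_of_norm_bounded hmaj.hasSum hebound).trans ?_
  rw [tsum_mul_left, mul_comm]

theorem summable_gudermannTerm {w : ℂ} (hw : 0 < w.re) :
    Summable fun n : ℕ => gudermannTerm (w + n) := by
  obtain ⟨P, -, C, R, -, h⟩ := exists_gudermannSeries_asymptotic 0
  obtain ⟨m, hm⟩ := exists_nat_ge R
  have h1 : R ≤ ‖w + m‖ := by
    refine hm.trans (le_trans ?_ (re_le_norm _))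
    simp only [add_re, natCast_re]
    linarith
  have h2 := (h (w + m) (by simp only [add_re, natCast_re]; positivity) h1).1
  refine (summable_nat_add_iff m).1 (h2.congr fun n => ?_)
  push_cast
  ring_nf

/-- Stirling's expression for `log Γ`. -/
def stirlingLogGamma (w : ℂ) : ℂ :=
  (w - 1 / 2) * log w - w + Real.log (2 * Real.pi) / 2 + gudermannSeries w

theorem log_one_add_inv {w : ℂ} (hw : 0 < w.re) : log (1 + 1 / w) = log (w + 1) - log w := by
  have hw0 : w ≠ 0 := by rintro rfl; simp at hw
  have hre : 0 < (1 + 1 / w).re := by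
    rw [add_re, one_re, one_div, inv_re]
    have : 0 < normSq w := normSq_pos.2 hw0
    positivity
  have h1 : 1 + 1 / w ≠ 0 := by intro h; rw [h] at hre; simp at hre
  have h2 := (abs_lt.1 (abs_arg_lt_pi_div_two_iff.2 (Or.inl hw)))
  have h3 := (abs_lt.1 (abs_arg_lt_pi_div_two_iff.2 (Or.inl hre)))
  rw [show w + 1 = w * (1 + 1 / w) by field_simp, log_mul hw0 h1 ⟨by linarith, by linarith⟩]
  ring

/-- The Gudermann term at w is the defect of the elementary part of Stirling's expression in the
recursion log Γ(w+1) = log Γ(w) + log w, so adding the series of shifted terms repairs the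
recursion. -/
theorem stirlingLogGamma_add_one {w : ℂ} (hw : 0 < w.re) :
    stirlingLogGamma (w + 1) = stirlingLogGamma w + log w := by
  have h1 : gudermannSeries w = gudermannTerm w + gudermannSeries (w + 1) := by
    rw [gudermannSeries, (summable_gudermannTerm hw).tsum_eq_zero_add, gudermannSeries]
    congr 1
    · simp
    · refine tsum_congr fun n => ?_
      push_cast
      ring_nf
  rw [stirlingLogGamma, stirlingLogGamma, h1, gudermannTerm, log_one_add_inv hw]
  ring

theorem exp_stirlingLogGamma_mul_prod {w : ℂ} (hw : 0 < w.re) (n : ℕ) :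
    exp (stirlingLogGamma w) * ∏ j ∈ Finset.range n, (w + j) = exp (stirlingLogGamma (w + n)) := by
  induction n with
  | zero => simp
  | succ n ih =>
    have hre : 0 < (w + n).re := by simp only [add_re, natCast_re]; positivity
    have h0 : w + n ≠ 0 := by intro h; rw [h] at hre; simp at hre
    rw [Finset.prod_range_succ, ← mul_assoc, ih, Nat.cast_succ, ← add_assoc,
      stirlingLogGamma_add_one hre, exp_add, exp_log h0]

theorem tendsto_gudermannSeries_add_natCast (w : ℂ) :
    Tendsto (fun n : ℕ => gudermannSeries (w + n)) atTop (𝓝 0) := by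
  refine (tendsto_sum_nat_add fun n : ℕ => gudermannTerm (w + n)).congr fun n => ?_
  refine tsum_congr fun k => ?_
  push_cast
  ring_nf

/-- The subtracted expression is log(n^w n!) with n! replaced by Stirling's approximation, so this
is the comparison with Euler's limit for Γ(w). -/
theorem stirlingLogGamma_tendsto {w : ℂ} (hw : 0 < w.re) :
    Tendsto (fun n : ℕ => stirlingLogGamma (w + (n + 1 : ℕ)) -
      (w * log n + (Real.log (2 * n * Real.pi) / 2 : ℝ) + n * log n - n)) atTop (𝓝 0) := by
  have h1 : Tendsto (fun n : ℕ => (n : ℂ)⁻¹) atTop (𝓝 0) := tendsto_inv_atTop_nhds_zero_nat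
  have hg : Tendsto (fun n : ℕ => (n : ℂ) * ((w + 1) * (n : ℂ)⁻¹)) atTop (𝓝 (w + 1)) := by
    refine tendsto_const_nhds.congr' ?_
    filter_upwards [eventually_gt_atTop 0] with n hn
    have : (n : ℂ) ≠ 0 := by exact_mod_cast hn.ne'
    field_simp
  have h2 := tendsto_nat_mul_log_one_add_of_tendsto hg
  have h3 : Tendsto (fun n : ℕ => log (1 + (w + 1) * (n : ℂ)⁻¹)) atTop (𝓝 0) := by
    have h4 : Tendsto (fun n : ℕ => 1 + (w + 1) * (n : ℂ)⁻¹) atTop (𝓝 1) := by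
      simpa using (h1.const_mul (w + 1)).const_add 1
    simpa using h4.clog (by simp)
  have h4 := (tendsto_gudermannSeries_add_natCast w).comp (tendsto_add_atTop_nat 1)
  have h5 := ((h2.add (h3.const_mul (w + 1 / 2))).sub_const (w + 1)).add h4
  simp only [mul_zero, add_zero, sub_self] at h5
  refine h5.congr' ?_
  filter_upwards [eventually_gt_atTop 0] with n hn
  have hn0 : (0 : ℝ) < n := by exact_mod_cast hn
  have hnc : (n : ℂ) ≠ 0 := by exact_mod_cast hn.ne'
  have hlog : log (w + (n + 1 : ℕ)) = log n + log (1 + (w + 1) * (n : ℂ)⁻¹) := by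
    have e : w + (n + 1 : ℕ) = (1 + (w + 1) * (n : ℂ)⁻¹) * ((n : ℝ) : ℂ) := by
      push_cast
      field_simp
      ring
    have hne : 1 + (w + 1) * (n : ℂ)⁻¹ ≠ 0 := by
      intro h
      rw [h, zero_mul] at e
      have := congrArg re e
      simp only [add_re, natCast_re, zero_re] at this
      have hn1 : (0 : ℝ) ≤ (n + 1 : ℕ) := Nat.cast_nonneg _
      linarith
    rw [e, log_mul_ofReal _ hn0 _ hne, ofReal_log hn0.le]
    simp
  have hlog2 : ((Real.log (2 * n * Real.pi) / 2 : ℝ) : ℂ) =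
      Real.log (2 * Real.pi) / 2 + log n / 2 := by
    rw [show (2 * n * Real.pi : ℝ) = (2 * Real.pi) * n by ring,
      Real.log_mul (by positivity) hn0.ne']
    push_cast [ofReal_log hn0.le]
    ring
  simp only [Function.comp_apply]
  rw [stirlingLogGamma, hlog, hlog2]
  push_cast
  ring

/-- **Stirling's formula** for the complex Gamma function, with Gudermann's remainder. -/
theorem Gamma_eq_exp_stirlingLogGamma {w : ℂ} (hw : 0 < w.re) :
    Complex.Gamma w = exp (stirlingLogGamma w) := by
  have h1 := GammaSeq_tendsto_Gamma w
  have h2 : Tendsto (fun n : ℕ => ((n.factorial : ℝ) / (√(2 * n * Real.pi) *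
      (n / Real.exp 1) ^ n) : ℝ)) atTop (𝓝 1) := by
    refine (isEquivalent_iff_tendsto_one ?_).1 Stirling.factorial_isEquivalent_stirling
    filter_upwards [eventually_gt_atTop 0] with n hn
    have : (0 : ℝ) < n := by exact_mod_cast hn
    positivity
  have h3 := (continuous_exp.tendsto 0).comp (stirlingLogGamma_tendsto hw)
  -- Euler's sequence `GammaSeq w n` equals exp of Stirling's expression at w times a quotient whose
  -- numerator and denominator both tend to 1.
  have h4 : Tendsto (fun n : ℕ => exp (stirlingLogGamma w) *
      (((((n.factorial : ℝ) / (√(2 * n * Real.pi) * (n / Real.exp 1) ^ n) : ℝ)) : ℂ) /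
      exp (stirlingLogGamma (w + (n + 1 : ℕ)) -
      (w * log n + (Real.log (2 * n * Real.pi) / 2 : ℝ) + n * log n - n)))) atTop
      (𝓝 (exp (stirlingLogGamma w) * (((1 : ℝ) : ℂ) / exp 0))) :=
    ((h2.ofReal).div h3 (exp_ne_zero _)).const_mul _
  simp only [ofReal_one, exp_zero, div_one, mul_one] at h4
  refine tendsto_nhds_unique h1 (h4.congr' ?_)
  filter_upwards [eventually_gt_atTop 0] with n hn
  have hn0 : (0 : ℝ) < n := by exact_mod_cast hn
  have hnc : (n : ℂ) ≠ 0 := by exact_mod_cast hn.ne'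
  have hprod : ∏ j ∈ Finset.range (n + 1), (w + j) ≠ 0 := by
    refine Finset.prod_ne_zero_iff.2 fun j _ h => ?_
    have := congrArg re h
    simp only [add_re, natCast_re, zero_re] at this
    have hj : (0 : ℝ) ≤ j := Nat.cast_nonneg _
    linarith
  have e1 : ((√(2 * n * Real.pi) : ℝ) : ℂ) = exp ((Real.log (2 * n * Real.pi) / 2 : ℝ)) := by
    rw [← ofReal_exp, Real.sqrt_eq_rpow, Real.rpow_def_of_pos (by positivity)]
    ring_nf
  have e2 : (((n / Real.exp 1) ^ n : ℝ) : ℂ) = exp (n * log n - n) := by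
    push_cast
    rw [exp_sub, exp_nat_mul, exp_log hnc, div_pow, ← exp_nat_mul, mul_one]
  have e3 : exp (stirlingLogGamma (w + (n + 1 : ℕ)) -
      (w * log n + (Real.log (2 * n * Real.pi) / 2 : ℝ) + n * log n - n)) =
      exp (stirlingLogGamma w) * (∏ j ∈ Finset.range (n + 1), (w + j)) /
        (exp (log n * w) * exp ((Real.log (2 * n * Real.pi) / 2 : ℝ)) * exp (n * log n - n)) := by
    rw [exp_sub, exp_stirlingLogGamma_mul_prod hw, ← exp_add, ← exp_add]
    ring_nf
  rw [e3, GammaSeq, cpow_def_of_ne_zero hnc, ofReal_div, ofReal_mul, e1, e2, ofReal_natCast]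
  field_simp [exp_ne_zero]

/-! ### Asymptotic power series -/

/-- Taylor coefficients at `0`. -/
def taylorCoeff (f : ℂ → ℂ) (n : ℕ) : ℂ := iteratedDeriv n f 0 / n.factorial

theorem taylorCoeff_zero (f : ℂ → ℂ) : taylorCoeff f 0 = f 0 := by simp [taylorCoeff]

theorem taylorCoeff_one (f : ℂ → ℂ) : taylorCoeff f 1 = deriv f 0 := by
  simp [taylorCoeff, iteratedDeriv_one]

theorem isBigO_sub_sum_taylorCoeff {f : ℂ → ℂ} (hf : AnalyticAt ℂ f 0) (N : ℕ) :
    (fun q => f q - ∑ n ∈ Finset.range N, taylorCoeff f n * q ^ n) =O[𝓝 0] fun q => q ^ N := by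
  have h := hf.hasFPowerSeriesAt.isBigO_sub_partialSum_pow N
  simp only [zero_add, FormalMultilinearSeries.partialSum,
    FormalMultilinearSeries.ofScalars_apply_eq, smul_eq_mul] at h
  refine h.trans (IsBigO.of_norm_norm ?_)
  simpa using isBigO_refl _ _

/-- A polynomial which is `O(q ^ N)` at `0` has no coefficients below `N`. -/
theorem Polynomial.coeff_eq_zero_of_isBigO {α : Type*} {l : Filter α} [NeBot l] {p : α → ℂ}
    (hp : Tendsto p l (𝓝[≠] 0)) {N : ℕ} {P : Polynomial ℂ}
    (h : (fun z => P.eval (p z)) =O[l] fun z => p z ^ N) : ∀ i < N, P.coeff i = 0 := by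
  induction N generalizing P with
  | zero => simp
  | succ N ih =>
    have hp0 : Tendsto p l (𝓝 0) := hp.mono_right nhdsWithin_le_nhds
    have hne : ∀ᶠ z in l, p z ≠ 0 := hp.eventually self_mem_nhdsWithin
    have h0 : P.coeff 0 = 0 := by
      have h1 : Tendsto (fun z => P.eval (p z)) l (𝓝 0) := by
        refine h.trans_tendsto ?_
        simpa using hp0.pow (N + 1)
      have h2 : Tendsto (fun z => P.eval (p z)) l (𝓝 (P.eval 0)) := (P.continuous.tendsto 0).comp hp0
      rw [Polynomial.coeff_zero_eq_eval_zero]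
      exact tendsto_nhds_unique h2 h1
    have h3 : ∀ z, P.eval (p z) = p z * P.divX.eval (p z) := by
      intro z
      conv_lhs => rw [← P.X_mul_divX_add]
      simp [h0]
    have h4 : (fun z => P.divX.eval (p z)) =O[l] fun z => p z ^ N := by
      obtain ⟨C, hC⟩ := h.bound
      refine IsBigO.of_bound C ?_
      filter_upwards [hC, hne] with z hz hz0
      rw [h3, pow_succ', norm_mul, norm_mul] at hz
      have hpos : 0 < ‖p z‖ := norm_pos_iff.2 hz0
      nlinarith [norm_nonneg (Polynomial.eval (p z) P.divX), norm_nonneg (p z ^ N)]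
    intro i hi
    cases i with
    | zero => exact h0
    | succ i => rw [← Polynomial.coeff_divX]; exact ih h4 i (by omega)

/-- Polynomial approximation of every order yields an asymptotic power series. -/
theorem exists_coeff_of_polynomial_approx {α : Type*} {l : Filter α} [NeBot l] {p : α → ℂ}
    (hp : Tendsto p l (𝓝[≠] 0)) {R : α → ℂ}
    (h : ∀ N : ℕ, ∃ P : Polynomial ℂ, (fun z => R z - P.eval (p z)) =O[l] fun z => p z ^ N) :
    ∃ c : ℕ → ℂ, ∀ N : ℕ,
      (fun z => R z - ∑ n ∈ Finset.range N, c n * p z ^ n) =O[l] fun z => p z ^ N := by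
  have hp0 : Tendsto p l (𝓝 0) := hp.mono_right nhdsWithin_le_nhds
  choose P hP using h
  have hpow : ∀ {m n : ℕ}, m ≤ n → (fun z => p z ^ n) =O[l] fun z => p z ^ m := by
    intro m n hmn
    have := (isBigO_refl (fun z => p z ^ m) l).mul ((hp0.pow (n - m)).isBigO_one ℂ)
    simpa [← pow_add, Nat.add_sub_cancel' hmn] using this
  -- Two approximations of order above n differ by a polynomial that is O(p^(n+1)), so their
  -- coefficients of index n agree and `P (n + 1)` may define the series.
  have hstable : ∀ n N, n < N → (P N).coeff n = (P (n + 1)).coeff n := by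
    intro n N hnN
    have h1 : (fun z => (P N - P (n + 1)).eval (p z)) =O[l] fun z => p z ^ (n + 1) := by
      have := (hP (n + 1)).sub ((hP N).trans (hpow (show n + 1 ≤ N from hnN)))
      refine this.congr_left fun z => ?_
      simp only [Polynomial.eval_sub]
      ring
    have := Polynomial.coeff_eq_zero_of_isBigO hp h1 n (Nat.lt_succ_self n)
    rwa [Polynomial.coeff_sub, sub_eq_zero] at this
  refine ⟨fun n => (P (n + 1)).coeff n, fun N => ?_⟩
  have hsplit : ∀ z, (P N).eval (p z) - ∑ n ∈ Finset.range N, (P (n + 1)).coeff n * p z ^ n =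
      ∑ n ∈ Finset.Ico N (N + (P N).natDegree + 1), (P N).coeff n * p z ^ n := by
    intro z
    rw [Polynomial.eval_eq_sum_range' (n := N + (P N).natDegree + 1) (by omega),
      ← Finset.sum_range_add_sum_Ico _ (show N ≤ N + (P N).natDegree + 1 by omega),
      Finset.sum_congr rfl fun n hn => by rw [hstable n N (Finset.mem_range.1 hn)]]
    ring
  have htail : (fun z => ∑ n ∈ Finset.Ico N (N + (P N).natDegree + 1), (P N).coeff n * p z ^ n)
      =O[l] fun z => p z ^ N :=
    IsBigO.fun_sum fun n hn => (hpow (Finset.mem_Ico.1 hn).1).const_mul_left _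
  refine ((hP N).add htail).congr_left fun z => ?_
  rw [← hsplit]
  ring

/-! ### Branches of logarithms on connected sets -/

/-- A continuous function on a preconnected set with `exp ∘ D = 1` is constant. -/
theorem eqOn_of_exp_eq_one {α : Type*} [TopologicalSpace α] {S : Set α} (hS : IsPreconnected S)
    {D : α → ℂ} (hD : ContinuousOn D S) (hexp : ∀ z ∈ S, exp (D z) = 1) {a b : α} (ha : a ∈ S)
    (hb : b ∈ S) : D a = D b := by
  have hform : ∀ z ∈ S, ∃ n : ℤ, D z = n * (2 * Real.pi * I) := fun z hz =>
    exp_eq_one_iff.1 (hexp z hz)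
  have hcont : ContinuousOn (fun z => (D z).im / (2 * Real.pi)) S :=
    (continuous_im.comp_continuousOn hD).div_const _
  have him : ∀ z ∈ S, ∃ n : ℤ, (D z).im / (2 * Real.pi) = n ∧ D z = n * (2 * Real.pi * I) := by
    intro z hz
    obtain ⟨n, hn⟩ := hform z hz
    refine ⟨n, ?_, hn⟩
    rw [hn]
    simp
  have hord := (hS.image _ hcont).ordConnected
  have key : ∀ a ∈ S, ∀ b ∈ S, ¬ (D a).im / (2 * Real.pi) < (D b).im / (2 * Real.pi) := by
    intro a ha b hb hlt
    obtain ⟨m, hm, -⟩ := him a ha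
    obtain ⟨n, hn, -⟩ := him b hb
    rw [hm, hn] at hlt
    have hmn : m + 1 ≤ n := by exact_mod_cast hlt
    have hmn' : (m : ℝ) + 1 ≤ n := by exact_mod_cast hmn
    -- Two distinct integer values would force the intermediate value m + 1/2, which is not an
    -- integer.
    have : (m : ℝ) + 1 / 2 ∈ (fun z => (D z).im / (2 * Real.pi)) '' S :=
      hord.out ⟨a, ha, hm⟩ ⟨b, hb, hn⟩ ⟨by linarith, by linarith⟩
    obtain ⟨c, hc, hcm⟩ := this
    obtain ⟨k, hk, -⟩ := him c hc
    simp only [hk] at hcm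
    have : (2 * k : ℤ) = 2 * m + 1 := by
      have : (2 * k : ℝ) = 2 * m + 1 := by linarith
      exact_mod_cast this
    omega
  obtain ⟨m, hm, hm'⟩ := him a ha
  obtain ⟨n, hn, hn'⟩ := him b hb
  have := le_antisymm (not_lt.1 (key b hb a ha)) (not_lt.1 (key a ha b hb))
  rw [hm, hn] at this
  rw [hm', hn', show m = n by exact_mod_cast this]

/-- `logDelta` is continuous off the cuts of its terms. -/
theorem continuousOn_logDelta {x : ℕ → ℂ} (hx : Tendsto (fun k => ‖x k‖) atTop atTop)
    (hs : Summable fun k => ‖x k‖⁻¹) :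
    ContinuousOn (logDelta x) {z | ∀ k, 1 + z / x k ∈ slitPlane} := by
  intro z₀ hz₀
  set ρ : ℝ := ‖z₀‖ + 1 with hρ
  -- Beyond `K` one has |z/x_k| ≤ 1/2 throughout the disc, where the logarithm is at most 3/2 of its
  -- argument; the finitely many earlier terms are treated one by one.
  obtain ⟨K, hK⟩ := eventually_atTop.1 (hx.eventually_ge_atTop (2 * ρ))
  have hρ0 : 0 < ρ := by positivity
  set U : Set ℂ := {z | ∀ k, 1 + z / x k ∈ slitPlane} ∩ Metric.ball 0 ρ with hU
  have hterm : ∀ k, ContinuousOn (fun z => log (1 + z / x k)) U := fun k =>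
    ContinuousOn.clog (by fun_prop) fun z hz => hz.1 k
  have htail : ContinuousOn (fun z => ∑' k, log (1 + z / x (k + K))) U := by
    refine continuousOn_tsum (fun k => hterm (k + K))
      (((summable_nat_add_iff K).2 hs).mul_left (3 / 2 * ρ)) fun k z hz => ?_
    have hk := hK (k + K) (by omega)
    have hzn : ‖z‖ < ρ := by simpa using hz.2
    have h1 : ‖z / x (k + K)‖ ≤ ρ * ‖x (k + K)‖⁻¹ := by
      rw [norm_div, div_eq_mul_inv]
      gcongr
    have h2 : ρ * ‖x (k + K)‖⁻¹ ≤ 1 / 2 := by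
      rw [← div_eq_mul_inv, div_le_div_iff₀ (by linarith) (by norm_num)]
      linarith
    refine (norm_log_one_add_half_le_self (h1.trans h2)).trans ?_
    linarith
  have hall : ContinuousOn (logDelta x) U := by
    have h1 := (continuousOn_finsetSum (Finset.range K) fun k _ => hterm k).add htail
    refine h1.congr fun z _ => ?_
    exact ((summable_log_factor hs z).sum_add_tsum_nat_add K).symm
  have hmem : z₀ ∈ Metric.ball (0 : ℂ) ρ := by simp [hρ]
  exact (hall z₀ ⟨hz₀, hmem⟩).mono_of_mem_nhdsWithin
    (inter_mem self_mem_nhdsWithin (mem_nhdsWithin_of_mem_nhds (Metric.isOpen_ball.mem_nhds hmem)))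

theorem abs_arg_neg {x : ℂ} (hx : x ≠ 0) : |arg (-x)| = Real.pi - |arg x| := by
  have hpi := Real.pi_pos
  rcases lt_trichotomy x.im 0 with h | h | h
  · rw [arg_neg_eq_arg_add_pi_of_im_neg h, abs_of_neg (arg_neg_iff.2 h), abs_of_nonneg]
    · ring
    · linarith [neg_pi_lt_arg x]
  · have hx' : x = (x.re : ℂ) := Complex.ext rfl (by simpa using h)
    have hre : x.re ≠ 0 := fun h0 => hx (Complex.ext h0 h)
    rw [hx', ← ofReal_neg]
    rcases hre.lt_or_gt with h | h
    · rw [arg_ofReal_of_neg h, arg_ofReal_of_nonneg (by linarith)]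
      simp [abs_of_pos hpi]
    · rw [arg_ofReal_of_neg (by linarith), arg_ofReal_of_nonneg h.le]
      simp [abs_of_pos hpi]
  · rw [arg_neg_eq_arg_sub_pi_of_im_pos h, abs_of_nonneg (arg_nonneg_iff.2 h.le), abs_of_nonpos]
    · ring
    · linarith [arg_le_pi x]

/-- If 1 + z/x ≤ 0 then z is a positive multiple of -x, so |arg z| = π - |arg x| ≥ θ. -/
theorem one_add_div_mem_slitPlane {x z : ℂ} (hx : x ≠ 0) {θ : ℝ} (hz : |arg z| < θ)
    (hxθ : |arg x| ≤ Real.pi - θ) : 1 + z / x ∈ slitPlane := by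
  by_contra h
  rw [mem_slitPlane_iff] at h
  push Not at h
  obtain ⟨h1, h2⟩ := h
  simp only [add_re, one_re, add_im, one_im, zero_add] at h1 h2
  have h3 : z / x = ((z / x).re : ℂ) := Complex.ext rfl (by simpa using h2)
  have h4 : z = ((-(z / x).re : ℝ) : ℂ) * (-x) := by
    push_cast
    rw [← h3]
    field_simp
  rw [h4, arg_real_mul _ (by linarith), abs_arg_neg hx] at hz
  linarith

/-! ### A logarithm of ξ far to the right -/

/-- A majorant independent of w, giving uniform convergence and hence continuity of Gudermann's
series. -/
theorem exists_norm_gudermannTerm_le : ∃ M R : ℝ, 0 < R ∧ ∀ w : ℂ, 0 < w.re → R ≤ ‖w‖ → ∀ n : ℕ,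
    ‖gudermannTerm (w + n)‖ ≤ M * (4 / ((n : ℝ) + 1) ^ 2) := by
  obtain ⟨g, hg, h⟩ := exists_gudermannTerm_inv_eq
  obtain ⟨M, hM⟩ : ∃ M, ∀ᶠ q in 𝓝 (0 : ℂ), ‖g q‖ ≤ M :=
    ⟨‖g 0‖ + 1, hg.continuousAt.norm.eventually (eventually_le_nhds (lt_add_one _))⟩
  obtain ⟨δ, hδ, hball⟩ := Metric.eventually_nhds_iff.1
    ((eventually_nhdsWithin_iff.1 h).and hM)
  refine ⟨M, max 1 (2 / δ), by positivity, fun w hw hwR n => ?_⟩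
  have hw1 : 1 ≤ ‖w‖ := (le_max_left _ _).trans hwR
  have hwδ : 2 / δ ≤ ‖w‖ := (le_max_right _ _).trans hwR
  have h1 := norm_le_norm_add_natCast hw n
  have hne : w + n ≠ 0 := fun hn => by
    rw [hn, norm_zero] at h1
    linarith
  have hq : dist (w + n)⁻¹ 0 < δ := by
    rw [dist_zero_right, norm_inv]
    have h2 : 2 / δ ≤ ‖w + n‖ := hwδ.trans h1
    rw [div_le_iff₀ hδ] at h2
    rw [inv_lt_iff_one_lt_mul₀ (by linarith)]
    linarith
  have h3 := (hball hq).1 (inv_ne_zero hne)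
  rw [inv_inv] at h3
  rw [h3, norm_mul, norm_pow, norm_inv, mul_comm]
  have h2 := half_succ_le_norm_add_natCast hw hw1 n
  have h5 : ‖w + n‖⁻¹ ^ 2 ≤ 4 / ((n : ℝ) + 1) ^ 2 := by
    calc ‖w + n‖⁻¹ ^ 2 ≤ (((n : ℝ) + 1) / 2)⁻¹ ^ 2 := by gcongr
      _ = _ := by field_simp; norm_num
  have h6 := (hball hq).2
  gcongr
  exact (norm_nonneg _).trans h6

theorem exists_continuousAt_gudermannSeries :
    ∃ R : ℝ, 0 < R ∧ ∀ w : ℂ, R < w.re → ContinuousAt gudermannSeries w := by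
  obtain ⟨M, R, hR, h⟩ := exists_norm_gudermannTerm_le
  refine ⟨R, hR, fun w hw => ?_⟩
  have hcont : ContinuousOn gudermannSeries {w : ℂ | R < w.re} := by
    refine continuousOn_tsum (fun n => ?_) (summable_gudermann_majorant.mul_left M)
      fun n z hz => h z (hR.trans hz) (le_trans (le_of_lt hz) (re_le_norm z)) n
    unfold gudermannTerm
    have hpos : ∀ z ∈ {w : ℂ | R < w.re}, 0 < (z + n).re := fun z hz => by
      simp only [add_re, natCast_re]
      have : 0 < z.re := hR.trans hz
      positivity
    have hne : ∀ z ∈ {w : ℂ | R < w.re}, z + n ≠ 0 := fun z hz h0 => by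
      have := hpos z hz
      rw [h0] at this
      simp at this
    refine ContinuousOn.sub (ContinuousOn.mul (by fun_prop) (ContinuousOn.clog ?_ fun z hz => ?_))
      continuousOn_const
    · exact continuousOn_const.add (continuousOn_const.div (by fun_prop) hne)
    · left
      rw [add_re, one_re, one_div, inv_re]
      have h1 := hpos z hz
      have h2 : 0 < normSq (z + n) := normSq_pos.2 (hne z hz)
      positivity
  exact hcont.continuousAt ((isOpen_lt continuous_const continuous_re).mem_nhds hw)

/-- For n ≥ 2 and Re s ≥ 2 one has |n^(-s)| ≤ 4·2^(-Re s) n^(-2). This exponential decay is why ζ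
contributes nothing to the asymptotic expansion. -/
theorem exists_norm_riemannZeta_sub_one_le : ∃ C : ℝ, 0 < C ∧ ∀ s : ℂ, 2 ≤ s.re →
    ‖riemannZeta s - 1‖ ≤ C * (2 : ℝ) ^ (-s.re) := by
  have hs : Summable fun k : ℕ => 4 * (1 / (((k + 1 : ℕ) : ℝ) + 1) ^ 2) := by
    have := (summable_nat_add_iff 2).2 (Real.summable_one_div_nat_pow (p := 2).2 (by norm_num))
    refine (this.mul_left 4).congr fun k => ?_
    push_cast
    ring
  refine ⟨∑' k : ℕ, 4 * (1 / (((k + 1 : ℕ) : ℝ) + 1) ^ 2), ?_, fun s hre => ?_⟩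
  · exact hs.tsum_pos (fun k => by positivity) 0 (by norm_num)
  have hsum : Summable fun k : ℕ => 1 / ((k : ℂ) + 1) ^ s := by
    have := (summable_nat_add_iff 1).2 (Complex.summable_one_div_nat_cpow (p := s).2 (by linarith))
    simpa using this
  rw [zeta_eq_tsum_one_div_nat_add_one_cpow (by linarith), hsum.tsum_eq_zero_add]
  simp only [CharP.cast_eq_zero, zero_add, one_cpow, div_one, add_sub_cancel_left]
  rw [mul_comm, ← tsum_mul_left]
  refine tsum_of_norm_bounded (hs.mul_left _).hasSum fun k => ?_
  have hk : (2 : ℝ) ≤ ((k + 1 : ℕ) : ℝ) + 1 := by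
    push_cast
    linarith [k.cast_nonneg (α := ℝ)]
  rw [norm_div, norm_one, show (((k + 1 : ℕ) : ℂ) + 1) = ((((k + 1 : ℕ) : ℝ) + 1 : ℝ) : ℂ) by
    push_cast; rfl, norm_cpow_eq_rpow_re_of_pos (by linarith)]
  set y : ℝ := ((k + 1 : ℕ) : ℝ) + 1 with hy
  have h1 : (2 : ℝ) ^ (s.re - 2) * y ^ 2 ≤ y ^ s.re := by
    calc (2 : ℝ) ^ (s.re - 2) * y ^ 2 ≤ y ^ (s.re - 2) * y ^ 2 := by
          gcongr
      _ = y ^ s.re := by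
          rw [← Real.rpow_natCast y 2, ← Real.rpow_add (by linarith)]
          norm_num
  have hy0 : 0 < y := by linarith
  have h2 : (2 : ℝ) ^ (s.re - 2) = (2 : ℝ) ^ s.re / 4 := by
    rw [Real.rpow_sub (by norm_num)]
    norm_num
  rw [h2] at h1
  rw [Real.rpow_neg (by norm_num)]
  have h3 : 0 < (2 : ℝ) ^ s.re := by positivity
  calc 1 / y ^ s.re ≤ 1 / ((2 : ℝ) ^ s.re / 4 * y ^ 2) := by gcongr
    _ = _ := by field_simp

/-- Stirling's expression for `log (s (s - 1) Λ(s))`. -/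
def xiExponent (s : ℂ) : ℂ :=
  log s + log (s - 1) - s / 2 * Real.log Real.pi + stirlingLogGamma (s / 2) + log (riemannZeta s)

theorem exp_xiExponent {s : ℂ} (hs : 1 < s.re) : exp (xiExponent s) = riemannXi s := by
  have h0 : s ≠ 0 := by rintro rfl; norm_num at hs
  have h1 : s ≠ 1 := by rintro rfl; norm_num at hs
  have hz : riemannZeta s ≠ 0 := riemannZeta_ne_zero_of_one_lt_re hs
  have hG : Gammaℝ s ≠ 0 := Gammaℝ_ne_zero_of_re_pos (by linarith)
  have hpi : (Real.pi : ℂ) ≠ 0 := by exact_mod_cast Real.pi_ne_zero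
  have h2 : riemannXi s = s * (s - 1) * Gammaℝ s * riemannZeta s := by
    have := riemannZeta_eq_riemannXi h0 h1
    have h3 := sub_ne_zero.2 h1
    field_simp at this
    linear_combination -this
  have h4 : 0 < (s / 2).re := by
    rw [div_ofNat_re]
    linarith
  rw [h2, xiExponent, exp_add, exp_add, exp_sub, exp_add, exp_log h0, exp_log (sub_ne_zero.2 h1),
    exp_log hz, ← Gamma_eq_exp_stirlingLogGamma h4, Gammaℝ_def, cpow_def_of_ne_zero hpi,
    ← ofReal_log Real.pi_pos.le, show (Real.log Real.pi : ℂ) * (-s / 2) = -(s / 2 * Real.log Real.pi)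
    by ring, exp_neg]
  ring

theorem exists_riemannZeta_near_one : ∃ R : ℝ, 2 ≤ R ∧ ∀ s : ℂ, R < s.re →
    ‖riemannZeta s - 1‖ ≤ 1 / 2 := by
  obtain ⟨C, hC, h⟩ := exists_norm_riemannZeta_sub_one_le
  have h1 : Tendsto (fun x : ℝ => C * (2 : ℝ) ^ (-x)) atTop (𝓝 (C * 0)) :=
    (((tendsto_rpow_atBot_of_base_gt_one 2 (by norm_num)).comp tendsto_neg_atTop_atBot)).const_mul C
  rw [mul_zero] at h1
  obtain ⟨R, hR⟩ := eventually_atTop.1 (h1.eventually (eventually_le_nhds (b := 1 / 2) (by norm_num)))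
  refine ⟨max 2 R, le_max_left _ _, fun s hs => (h s ?_).trans (hR _ ?_)⟩
  · exact (le_max_left _ _).trans hs.le
  · exact (le_max_right _ _).trans hs.le

/-- Far to the right ζ(s) stays within 1/2 of 1, so its principal logarithm meets no cut. -/
theorem exists_continuousAt_xiExponent :
    ∃ R : ℝ, 2 ≤ R ∧ ∀ s : ℂ, R < s.re → ContinuousAt xiExponent s := by
  obtain ⟨R₁, hR₁, h₁⟩ := exists_continuousAt_gudermannSeries
  obtain ⟨R₂, hR₂, h₂⟩ := exists_riemannZeta_near_one
  refine ⟨max (2 * R₁) R₂, hR₂.trans (le_max_right _ _), fun s hs => ?_⟩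
  have hs1 : 2 * R₁ < s.re := (le_max_left _ _).trans_lt hs
  have hs2 : R₂ < s.re := (le_max_right _ _).trans_lt hs
  have hslit : s ∈ slitPlane := Or.inl (by linarith)
  have hslit1 : s - 1 ∈ slitPlane := Or.inl (by rw [sub_re, one_re]; linarith)
  have hre2 : (s / 2).re = s.re / 2 := by rw [div_ofNat_re]
  have hslit2 : s / 2 ∈ slitPlane := Or.inl (by rw [hre2]; linarith)
  have hzslit : riemannZeta s ∈ slitPlane := by
    left
    have := (abs_le.1 ((abs_re_le_norm _).trans (h₂ s hs2))).1
    rw [sub_re, one_re] at this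
    linarith
  have hne1 : s ≠ 1 := by
    rintro rfl
    rw [one_re] at hs2
    linarith
  have hz : ContinuousAt riemannZeta s := (differentiableAt_riemannZeta hne1).continuousAt
  have hg : ContinuousAt (fun s : ℂ => gudermannSeries (s / 2)) s :=
    ContinuousAt.comp (g := gudermannSeries) (f := fun s : ℂ => s / 2)
      (h₁ _ (by rw [hre2]; linarith)) (by fun_prop)
  have hst : ContinuousAt (fun s : ℂ => stirlingLogGamma (s / 2)) s := by
    unfold stirlingLogGamma
    refine ContinuousAt.add (ContinuousAt.add (ContinuousAt.sub (ContinuousAt.mul (by fun_prop)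
      (ContinuousAt.clog (by fun_prop) hslit2)) (by fun_prop)) continuousAt_const) hg
  unfold xiExponent
  exact ((((continuousAt_id.clog hslit).add (ContinuousAt.clog (by fun_prop) hslit1)).sub
    (by fun_prop)).add hst).add (hz.clog hzslit)

/-! ### Square roots, sectors and the analytic ingredients in q = 1/√z -/

/-- The principal square root. -/
def csqrt (z : ℂ) : ℂ := z ^ (1 / 2 : ℂ)

theorem csqrt_sq (z : ℂ) : csqrt z ^ 2 = z := cpow_half_sq z

theorem csqrt_ne_zero {z : ℂ} (hz : z ≠ 0) : csqrt z ≠ 0 := fun h => hz (by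
  rw [← csqrt_sq z, h]; simp)

theorem norm_csqrt (z : ℂ) : ‖csqrt z‖ = ‖z‖ ^ (1 / 2 : ℝ) := norm_cpow_half z

theorem log_csqrt {z : ℂ} (hz : z ≠ 0) : log (csqrt z) = log z / 2 := by
  have h1 := neg_pi_lt_arg z
  have h2 := arg_le_pi z
  have hpi := Real.pi_pos
  rw [csqrt, cpow_def_of_ne_zero hz, log_exp]
  · ring
  · simp [log_im]
    linarith
  · simp [log_im]
    linarith

theorem arg_csqrt {z : ℂ} (hz : z ≠ 0) : arg (csqrt z) = arg z / 2 := by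
  have := congrArg im (log_csqrt hz)
  rwa [log_im, div_ofNat_im, log_im] at this

theorem half_norm_le_re_of_abs_arg_le {z : ℂ} (hz : |arg z| ≤ Real.pi / 3) : ‖z‖ / 2 ≤ z.re := by
  have h1 : Real.cos (Real.pi / 3) ≤ Real.cos (arg z) := by
    rw [← Real.cos_abs (arg z)]
    exact Real.cos_le_cos_of_nonneg_of_le_pi (abs_nonneg _) (by linarith [Real.pi_pos]) hz
  rw [Real.cos_pi_div_three] at h1
  rw [← norm_mul_cos_arg z]
  nlinarith [norm_nonneg z]

theorem csqrt_cpow {z : ℂ} (hz : z ≠ 0) (n : ℕ) :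
    z ^ (((1 - (n : ℝ)) / 2 : ℝ) : ℂ) = csqrt z * (csqrt z)⁻¹ ^ n := by
  have h := csqrt_ne_zero hz
  have h1 : ((((1 - (n : ℝ)) / 2 : ℝ)) : ℂ) = 1 / 2 - n * (1 / 2) := by push_cast; ring
  rw [h1, cpow_sub _ _ hz, cpow_nat_mul, inv_pow, div_eq_mul_inv]
  rfl

theorem eventually_sectorAtInfinity {θ : ℝ} {P : ℂ → Prop} :
    (∀ᶠ z in sectorAtInfinity θ, P z) ↔ ∃ R : ℝ, ∀ z, R ≤ ‖z‖ → |arg z| < θ → P z := by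
  rw [sectorAtInfinity, eventually_inf_principal, hasBasis_cobounded_norm.eventually_iff]
  simp

instance neBot_sectorAtInfinity {θ : ℝ} [Fact (0 < θ)] : NeBot (sectorAtInfinity θ) := by
  rw [sectorAtInfinity, hasBasis_cobounded_norm.inf_principal_neBot_iff]
  intro R _
  refine ⟨((|R| : ℝ) : ℂ), ?_, ?_⟩
  · simp [le_abs_self]
  · simpa [arg_ofReal_of_nonneg (abs_nonneg R)] using Fact.out

theorem tendsto_norm_sectorAtInfinity (θ : ℝ) :
    Tendsto (fun z : ℂ => ‖z‖) (sectorAtInfinity θ) atTop :=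
  tendsto_norm_cobounded_atTop.mono_left inf_le_left

theorem tendsto_norm_csqrt_sectorAtInfinity (θ : ℝ) :
    Tendsto (fun z : ℂ => ‖csqrt z‖) (sectorAtInfinity θ) atTop := by
  simp only [norm_csqrt]
  exact (tendsto_rpow_atTop (by norm_num)).comp (tendsto_norm_sectorAtInfinity θ)

theorem tendsto_inv_csqrt_sectorAtInfinity (θ : ℝ) :
    Tendsto (fun z : ℂ => (csqrt z)⁻¹) (sectorAtInfinity θ) (𝓝[≠] 0) := by
  refine tendsto_nhdsWithin_iff.2 ⟨?_, ?_⟩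
  · rw [tendsto_zero_iff_norm_tendsto_zero]
    simp only [norm_inv]
    exact tendsto_inv_atTop_zero.comp (tendsto_norm_csqrt_sectorAtInfinity θ)
  · filter_upwards [(tendsto_norm_csqrt_sectorAtInfinity θ).eventually_gt_atTop 0] with z hz
    exact inv_ne_zero (norm_pos_iff.1 hz)

section Expansion

variable (v : ℝ)

/-- `√(1 + v q²)`. -/
def sqrtFactor (q : ℂ) : ℂ := (1 + v * q ^ 2) ^ (1 / 2 : ℂ)

/-- The coefficient of the logarithm in the expansion of `xiExponent`. -/
def logPart (q : ℂ) : ℂ := sqrtFactor v q / 4 + 7 / 8 * q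

/-- The analytic part free of logarithms in the expansion of `xiExponent`. -/
def analyticPart (q : ℂ) : ℂ :=
  q * (log (sqrtFactor v q + q / 2) + log (sqrtFactor v q - q / 2)) +
    (sqrtFactor v q + q / 2) / 2 * (log (sqrtFactor v q / 2 + q / 4) - Real.log Real.pi - 1) -
    q / 2 * log (sqrtFactor v q / 2 + q / 4) + q * (Real.log (2 * Real.pi) / 2)

/-- The point `s = 1 / 2 + √(z + v)`. -/
def xiPoint (z : ℂ) : ℂ := csqrt z * (sqrtFactor v (csqrt z)⁻¹ + (csqrt z)⁻¹ / 2)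

/-- The part of `xiExponent` not given by an analytic function of `1 / √z`. -/
def xiRemainder (z : ℂ) : ℂ := gudermannSeries (xiPoint v z / 2) + log (riemannZeta (xiPoint v z))

theorem hasDerivAt_sqrtFactor : HasDerivAt (sqrtFactor v) 0 0 := by
  have h := (((hasDerivAt_id (0 : ℂ)).pow 2).const_mul (v : ℂ)).const_add 1
  have := h.cpow_const (c := 1 / 2) (by simp)
  convert! this using 1
  simp

theorem analyticAt_sqrtFactor : AnalyticAt ℂ (sqrtFactor v) 0 := by
  unfold sqrtFactor
  exact AnalyticAt.cpow (by fun_prop) analyticAt_const (by simp)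

theorem sqrtFactor_zero : sqrtFactor v 0 = 1 := by simp [sqrtFactor]

theorem sqrtFactor_neg (q : ℂ) : sqrtFactor v (-q) = sqrtFactor v q := by simp [sqrtFactor]

theorem analyticAt_logPart : AnalyticAt ℂ (logPart v) 0 := by
  have := analyticAt_sqrtFactor v
  unfold logPart
  fun_prop

theorem analyticAt_analyticPart : AnalyticAt ℂ (analyticPart v) 0 := by
  have h := analyticAt_sqrtFactor v
  have h1 : AnalyticAt ℂ (fun q => log (sqrtFactor v q + q / 2)) 0 :=
    AnalyticAt.clog (by fun_prop) (by simp [sqrtFactor_zero])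
  have h2 : AnalyticAt ℂ (fun q => log (sqrtFactor v q - q / 2)) 0 :=
    AnalyticAt.clog (by fun_prop) (by simp [sqrtFactor_zero])
  have h3 : AnalyticAt ℂ (fun q => log (sqrtFactor v q / 2 + q / 4)) 0 := by
    refine AnalyticAt.clog (by fun_prop) ?_
    left
    norm_num [sqrtFactor_zero]
  unfold analyticPart
  fun_prop

theorem taylorCoeff_logPart_zero : taylorCoeff (logPart v) 0 = 1 / 4 := by
  simp [taylorCoeff_zero, logPart, sqrtFactor_zero]

/-- Each logarithm in log ξ(s) contributes log z/2. The number 7/8 is 1 from log s + log(s-1), plus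
1/8 from the 1/2 contained in s, minus 1/4 from the exponent s/2 - 1/2 of Stirling's formula. -/
theorem taylorCoeff_logPart_one : taylorCoeff (logPart v) 1 = 7 / 8 := by
  have h := ((hasDerivAt_sqrtFactor v).div_const 4).add ((hasDerivAt_id (0 : ℂ)).const_mul (7 / 8))
  have h2 : deriv (logPart v) 0 = _ := h.deriv
  rw [taylorCoeff_one, h2]
  simp

/-- √(1+vq²) is even in q, and the linear term reaches only the index 1. This is the absence of
logarithms at the negative integer exponents. -/
theorem taylorCoeff_logPart_odd {m : ℕ} (hm : 1 ≤ m) : taylorCoeff (logPart v) (2 * m + 1) = 0 := by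
  have h1 : iteratedDeriv (2 * m + 1) (sqrtFactor v) 0 = 0 := by
    have := iteratedDeriv_comp_neg (2 * m + 1) (sqrtFactor v) 0
    simp only [sqrtFactor_neg, neg_zero] at this
    rw [Odd.neg_one_pow ⟨m, rfl⟩, neg_one_smul] at this
    exact self_eq_neg.1 this
  have h2 : logPart v = fun q => (1 / 4 : ℂ) * sqrtFactor v q + (7 / 8 : ℂ) * q := by
    funext q
    rw [logPart]
    ring
  have h3 : iteratedDeriv (2 * m + 1) (fun q : ℂ => (7 / 8 : ℂ) * q) 0 = 0 := by
    rw [iteratedDeriv_succ']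
    have : deriv (fun q : ℂ => (7 / 8 : ℂ) * q) = fun _ => 7 / 8 := by
      funext q
      simp
    rw [this, iteratedDeriv_const]
    simp
    omega
  have han := (analyticAt_sqrtFactor v).contDiffAt (n := ((2 * m + 1 : ℕ) : WithTop ℕ∞))
  have h4 : iteratedDeriv (2 * m + 1) (logPart v) 0 = 0 := by
    rw [h2, iteratedDeriv_fun_add (contDiffAt_const.mul han) (by fun_prop), h3,
      iteratedDeriv_const_mul_field, h1]
    simp
  rw [taylorCoeff, h4, zero_div]

theorem taylorCoeff_analyticPart_zero :
    taylorCoeff (analyticPart v) 0 = ((-(1 + Real.log (2 * Real.pi)) / 2 : ℝ) : ℂ) := by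
  have h : log (1 / 2 : ℂ) = ((-Real.log 2 : ℝ) : ℂ) := by
    rw [← Real.log_inv, ofReal_log (by norm_num)]
    norm_num
  rw [taylorCoeff_zero, analyticPart, sqrtFactor_zero]
  simp only [zero_mul, zero_div, add_zero, zero_add, sub_zero, h]
  rw [Real.log_mul (by norm_num) Real.pi_ne_zero]
  push_cast
  ring

/-- The parameter v enters through √(1+vq²), which is constant to first order, so the value does not
depend on v. The v-dependence of a₀ comes only from the additive constant of log Δ. -/
theorem taylorCoeff_analyticPart_one :
    taylorCoeff (analyticPart v) 1 = ((Real.log (8 * Real.pi) / 4 : ℝ) : ℂ) := by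
  have hl : log (1 / 2 : ℂ) = ((-Real.log 2 : ℝ) : ℂ) := by
    rw [← Real.log_inv, ofReal_log (by norm_num)]
    norm_num
  have h := hasDerivAt_sqrtFactor v
  have hid := hasDerivAt_id (0 : ℂ)
  have d1 := (h.add (hid.div_const 2)).clog (by simp [sqrtFactor_zero])
  have d2 := (h.sub (hid.div_const 2)).clog (by simp [sqrtFactor_zero])
  have d3 := ((h.div_const 2).add (hid.div_const 4)).clog (by
    left
    norm_num [sqrtFactor_zero])
  have d := (((hid.mul (d1.add d2)).add (((h.add (hid.div_const 2)).div_const 2).mul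
    ((d3.sub_const (Real.log Real.pi : ℂ)).sub_const 1))).sub ((hid.div_const 2).mul d3)).add
    (hid.mul_const (Real.log (2 * Real.pi) / 2 : ℂ))
  have hd : deriv (analyticPart v) 0 = _ := d.deriv
  rw [taylorCoeff_one, hd]
  have h8 : Real.log (8 * Real.pi) = 3 * Real.log 2 + Real.log Real.pi := by
    rw [Real.log_mul (by norm_num) Real.pi_ne_zero, show (8 : ℝ) = 2 ^ 3 by norm_num, Real.log_pow]
    norm_num
  simp only [Pi.add_apply, Pi.sub_apply, sqrtFactor_zero, id, zero_div, add_zero, sub_zero, zero_add,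
    Complex.log_one, hl, h8, Real.log_mul two_ne_zero Real.pi_ne_zero]
  push_cast
  ring

end Expansion

theorem Complex.log_mul_of_re_pos {a b : ℂ} (ha : 0 < a.re) (hb : 0 < b.re) :
    log (a * b) = log a + log b := by
  have ha0 : a ≠ 0 := by rintro rfl; simp at ha
  have hb0 : b ≠ 0 := by rintro rfl; simp at hb
  have h2 := (abs_lt.1 (abs_arg_lt_pi_div_two_iff.2 (Or.inl ha)))
  have h3 := (abs_lt.1 (abs_arg_lt_pi_div_two_iff.2 (Or.inl hb)))
  exact log_mul ha0 hb0 ⟨by linarith, by linarith⟩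

/-! ### The expansion of log ξ(1/2 + √(z+v)) in a sector -/

section

variable (v : ℝ) {θ : ℝ}

theorem riemannXiSq_add_eq {z : ℂ} (hz : z ≠ 0) :
    riemannXiSq (z + v) = riemannXi (xiPoint v z) := by
  have h0 := csqrt_ne_zero hz
  have h1 : z + v = (csqrt z * sqrtFactor v (csqrt z)⁻¹) ^ 2 := by
    rw [mul_pow, sqrtFactor, cpow_half_sq, mul_add, inv_pow]
    rw [csqrt_sq]
    field_simp
  rw [h1, riemannXiSq_sq, xiPoint]
  congr 1
  field_simp
  ring

theorem eventually_half_norm_le_re_csqrt (hθ : θ ≤ Real.pi / 4) :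
    ∀ᶠ z in sectorAtInfinity θ, ‖csqrt z‖ / 2 ≤ (csqrt z).re := by
  rw [eventually_sectorAtInfinity]
  refine ⟨1, fun z hz hzθ => half_norm_le_re_of_abs_arg_le ?_⟩
  have hz0 : z ≠ 0 := by rintro rfl; norm_num at hz
  rw [arg_csqrt hz0, abs_div, abs_two]
  linarith [Real.pi_pos]

theorem eventually_sqrtFactor_near :
    ∀ᶠ q in 𝓝 (0 : ℂ), ‖sqrtFactor v q + q / 2 - 1‖ ≤ 1 / 4 ∧ ‖sqrtFactor v q - q / 2 - 1‖ ≤ 1 / 4 := by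
  have hc := (analyticAt_sqrtFactor v).continuousAt
  have h1 : ContinuousAt (fun q => ‖sqrtFactor v q + q / 2 - 1‖) 0 := by fun_prop
  have h2 : ContinuousAt (fun q => ‖sqrtFactor v q - q / 2 - 1‖) 0 := by fun_prop
  have e1 := h1.eventually (eventually_le_nhds (b := 1 / 4) (by simp [sqrtFactor_zero]))
  have e2 := h2.eventually (eventually_le_nhds (b := 1 / 4) (by simp [sqrtFactor_zero]))
  exact e1.and e2

/-- The argument of √z stays below π/3, so Re √z ≥ |√z|/2, and the correcting factor, within 1/4 of
1, costs at most |√z|/4. -/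
theorem eventually_le_re_xiPoint (hθ : θ ≤ Real.pi / 4) :
    ∀ᶠ z in sectorAtInfinity θ, ‖csqrt z‖ / 4 ≤ (xiPoint v z).re := by
  have hp := (tendsto_inv_csqrt_sectorAtInfinity θ).mono_right nhdsWithin_le_nhds
  filter_upwards [eventually_half_norm_le_re_csqrt hθ,
    hp.eventually (eventually_sqrtFactor_near v)] with z h1 h2
  set y := sqrtFactor v (csqrt z)⁻¹ + (csqrt z)⁻¹ / 2 with hy
  have h3 : xiPoint v z = csqrt z + csqrt z * (y - 1) := by rw [xiPoint]; ring
  have h4 : ‖csqrt z * (y - 1)‖ ≤ ‖csqrt z‖ * (1 / 4) := by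
    rw [norm_mul]
    gcongr
    exact h2.1
  have h5 := (abs_le.1 ((abs_re_le_norm (csqrt z * (y - 1))))).1
  rw [h3, add_re]
  linarith

theorem tendsto_re_xiPoint (hθ : θ ≤ Real.pi / 4) :
    Tendsto (fun z => (xiPoint v z).re) (sectorAtInfinity θ) atTop :=
  tendsto_atTop_mono' _ (eventually_le_re_xiPoint v hθ)
    ((tendsto_norm_csqrt_sectorAtInfinity θ).atTop_div_const (by norm_num))

/-- The points s, s-1 and s/2 are √z times a factor close to 1 or 1/2. Both factors have positive
real part, so the principal logarithms add without a multiple of 2πi. -/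
theorem xiExponent_xiPoint_eq (hθ : θ ≤ Real.pi / 4) :
    ∀ᶠ z in sectorAtInfinity θ, xiExponent (xiPoint v z) =
      csqrt z * (logPart v (csqrt z)⁻¹ * log z + analyticPart v (csqrt z)⁻¹) + xiRemainder v z := by
  have hp := (tendsto_inv_csqrt_sectorAtInfinity θ).mono_right nhdsWithin_le_nhds
  filter_upwards [eventually_half_norm_le_re_csqrt hθ,
    hp.eventually (eventually_sqrtFactor_near v),
    (tendsto_norm_csqrt_sectorAtInfinity θ).eventually_gt_atTop 0] with z h1 h2 h3
  have hr0 : csqrt z ≠ 0 := norm_pos_iff.1 h3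
  have hz0 : z ≠ 0 := by
    rintro rfl
    exact hr0 (by simp [csqrt])
  have hr : 0 < (csqrt z).re := by linarith
  have hlogr := log_csqrt hz0
  have hpos : ∀ y : ℂ, ‖y - 1‖ ≤ 1 / 4 → 0 < y.re := by
    intro y hy
    have := (abs_le.1 ((abs_re_le_norm (y - 1)).trans hy)).1
    rw [sub_re, one_re] at this
    linarith
  set r := csqrt z with hrdef
  set h := sqrtFactor v r⁻¹ with hh
  have hy1 := hpos _ h2.1
  have hy2 := hpos _ h2.2
  have hy3 : 0 < (h / 2 + r⁻¹ / 4).re := by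
    have : h / 2 + r⁻¹ / 4 = (h + r⁻¹ / 2) / 2 := by ring
    rw [this, div_ofNat_re]
    linarith
  have hs : xiPoint v z = r * (h + r⁻¹ / 2) := rfl
  have hs1 : xiPoint v z - 1 = r * (h - r⁻¹ / 2) := by
    rw [hs]
    field_simp
    ring
  have hs2 : xiPoint v z / 2 = r * (h / 2 + r⁻¹ / 4) := by
    rw [hs]
    ring
  have l1 : log (xiPoint v z) = log z / 2 + log (h + r⁻¹ / 2) := by
    rw [hs, log_mul_of_re_pos hr hy1, hlogr]
  have l2 : log (xiPoint v z - 1) = log z / 2 + log (h - r⁻¹ / 2) := by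
    rw [hs1, log_mul_of_re_pos hr hy2, hlogr]
  have l3 : log (xiPoint v z / 2) = log z / 2 + log (h / 2 + r⁻¹ / 4) := by
    rw [hs2, log_mul_of_re_pos hr hy3, hlogr]
  rw [xiExponent, stirlingLogGamma, l1, l2, l3, xiRemainder, logPart, analyticPart, ← hh]
  rw [hs]
  field_simp
  ring

theorem pow_norm_inv_csqrt_isBigO {f : ℂ → ℂ} {C : ℝ} {N : ℕ}
    (h : ∀ᶠ z in sectorAtInfinity θ, ‖f z‖ ≤ C * (‖csqrt z‖ ^ N)⁻¹) :
    f =O[sectorAtInfinity θ] fun z => (csqrt z)⁻¹ ^ N :=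
  IsBigO.of_bound C (h.mono fun z hz => by simpa using hz)

/-- The series is approximated by a polynomial in (s/2)⁻¹ = 2q/(√(1+vq²) + q/2), an analytic
function of q vanishing at 0. -/
theorem gudermannSeries_xiPoint_approx (hθ : θ ≤ Real.pi / 4) (N : ℕ) :
    ∃ f : ℂ → ℂ, AnalyticAt ℂ f 0 ∧ f 0 = 0 ∧
      (fun z => gudermannSeries (xiPoint v z / 2) - f (csqrt z)⁻¹) =O[sectorAtInfinity θ]
        fun z => (csqrt z)⁻¹ ^ N := by
  obtain ⟨P, hP0, C, R, hR, h⟩ := exists_gudermannSeries_asymptotic N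
  have hκ : AnalyticAt ℂ (fun q => 2 * q / (sqrtFactor v q + q / 2)) 0 := by
    have := analyticAt_sqrtFactor v
    exact AnalyticAt.div (by fun_prop) (by fun_prop) (by simp [sqrtFactor_zero])
  refine ⟨fun q => P.eval (2 * q / (sqrtFactor v q + q / 2)), ?_, by simp [hP0], ?_⟩
  · exact (hκ.aeval_polynomial P).congr (Eventually.of_forall fun q => by simp)
  refine pow_norm_inv_csqrt_isBigO (C := |C| * 8 ^ N) ?_
  filter_upwards [eventually_le_re_xiPoint v hθ,
    (tendsto_re_xiPoint v hθ).eventually_ge_atTop (2 * R),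
    (tendsto_norm_csqrt_sectorAtInfinity θ).eventually_gt_atTop 0] with z h1 h2 h3
  have hre : (xiPoint v z / 2).re = (xiPoint v z).re / 2 := by rw [div_ofNat_re]
  have h4 := re_le_norm (xiPoint v z / 2)
  have h5 := (h (xiPoint v z / 2) (by rw [hre]; linarith) (by linarith)).2
  have h6 : (xiPoint v z / 2)⁻¹ =
      2 * (csqrt z)⁻¹ / (sqrtFactor v (csqrt z)⁻¹ + (csqrt z)⁻¹ / 2) := by
    rw [xiPoint, inv_div, div_mul_eq_div_div, div_eq_mul_inv 2 (csqrt z)]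
  rw [h6] at h5
  refine h5.trans ?_
  have h7 : ‖csqrt z‖ / 8 ≤ ‖xiPoint v z / 2‖ := by linarith
  calc C * (‖xiPoint v z / 2‖ ^ N)⁻¹ ≤ |C| * ((‖csqrt z‖ / 8) ^ N)⁻¹ := by
        gcongr
        exact le_abs_self C
    _ = |C| * 8 ^ N * (‖csqrt z‖ ^ N)⁻¹ := by
        rw [div_pow]
        field_simp

/-- Since Re s ≥ |√z|/4, the logarithm is O(2^(-|√z|/4)), smaller than every power of q. -/
theorem log_riemannZeta_xiPoint_isBigO (hθ : θ ≤ Real.pi / 4) (N : ℕ) :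
    (fun z => log (riemannZeta (xiPoint v z))) =O[sectorAtInfinity θ]
        fun z => (csqrt z)⁻¹ ^ N := by
  obtain ⟨C, hC, h⟩ := exists_norm_riemannZeta_sub_one_le
  obtain ⟨R, hR, hhalf⟩ := exists_riemannZeta_near_one
  have hexp : (fun x : ℝ => (2 : ℝ) ^ (-(x / 4))) =O[atTop] fun x : ℝ => (x ^ N)⁻¹ := by
    have h1 := (isLittleO_exp_neg_mul_rpow_atTop (a := Real.log 2 / 4)
      (by have := Real.log_pos one_lt_two; positivity) (-(N : ℝ))).isBigO
    refine (h1.congr_left fun x => ?_).congr' EventuallyEq.rfl ?_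
    · rw [Real.rpow_def_of_pos two_pos]
      ring_nf
    · filter_upwards [eventually_gt_atTop 0] with x hx
      rw [Real.rpow_neg hx.le, Real.rpow_natCast]
  obtain ⟨B, hB⟩ := (hexp.comp_tendsto (tendsto_norm_csqrt_sectorAtInfinity θ)).bound
  refine pow_norm_inv_csqrt_isBigO (C := 3 / 2 * C * B) ?_
  filter_upwards [eventually_le_re_xiPoint v hθ, hB,
    (tendsto_re_xiPoint v hθ).eventually_gt_atTop R] with z h1 h2 h3
  have h4 := h (xiPoint v z) (by linarith)
  have h5 := norm_log_one_add_half_le_self (hhalf _ h3)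
  rw [add_sub_cancel] at h5
  simp only [Function.comp_apply, norm_inv, norm_pow, Real.norm_eq_abs, abs_norm] at h2
  rw [abs_of_pos (by positivity)] at h2
  have h6 : (2 : ℝ) ^ (-(xiPoint v z).re) ≤ (2 : ℝ) ^ (-(‖csqrt z‖ / 4)) :=
    Real.rpow_le_rpow_of_exponent_le one_le_two (by linarith)
  calc _ ≤ 3 / 2 * ‖riemannZeta (xiPoint v z) - 1‖ := h5
    _ ≤ 3 / 2 * (C * (B * (‖csqrt z‖ ^ N)⁻¹)) := by
      gcongr
      exact h4.trans (by gcongr; exact h6.trans h2)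
    _ = _ := by ring

theorem xiRemainder_approx (hθ : θ ≤ Real.pi / 4) (N : ℕ) :
    ∃ f : ℂ → ℂ, AnalyticAt ℂ f 0 ∧ f 0 = 0 ∧
      (fun z => xiRemainder v z - f (csqrt z)⁻¹) =O[sectorAtInfinity θ]
        fun z => (csqrt z)⁻¹ ^ N := by
  obtain ⟨f, hf, hf0, h⟩ := gudermannSeries_xiPoint_approx v hθ N
  refine ⟨f, hf, hf0, (h.add (log_riemannZeta_xiPoint_isBigO v hθ N)).congr_left fun z => ?_⟩
  rw [xiRemainder]
  ring

theorem tendsto_xiRemainder (hθ : θ ≤ Real.pi / 4) :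
    Tendsto (xiRemainder v) (sectorAtInfinity θ) (𝓝 0) := by
  obtain ⟨f, hf, hf0, h⟩ := xiRemainder_approx v hθ 1
  have hp := (tendsto_inv_csqrt_sectorAtInfinity θ).mono_right nhdsWithin_le_nhds
  have h1 := h.trans_tendsto (by simpa using hp)
  have h2 : Tendsto (fun z => f (csqrt z)⁻¹) (sectorAtInfinity θ) (𝓝 (f 0)) :=
    hf.continuousAt.tendsto.comp hp
  rw [hf0] at h2
  simpa using h1.add h2

/-- The approximants depend on the order N; uniqueness of coefficients merges them into one series.
The constant term is κ because the remainder itself tends to 0. -/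
theorem exists_xiRemainder_coeff [Fact (0 < θ)] (hθ : θ ≤ Real.pi / 4) (κ : ℂ) :
    ∃ c : ℕ → ℂ, c 0 = κ ∧ ∀ N : ℕ,
      (fun z => xiRemainder v z + κ - ∑ n ∈ Finset.range N, c n * (csqrt z)⁻¹ ^ n)
        =O[sectorAtInfinity θ] fun z => (csqrt z)⁻¹ ^ N := by
  have hp := tendsto_inv_csqrt_sectorAtInfinity θ
  have hp0 := hp.mono_right nhdsWithin_le_nhds
  obtain ⟨c, hc⟩ := exists_coeff_of_polynomial_approx hp (R := fun z => xiRemainder v z + κ)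
    fun N => by
      obtain ⟨f, hf, -, h⟩ := xiRemainder_approx v hθ N
      refine ⟨∑ n ∈ Finset.range N, Polynomial.C (taylorCoeff f n) * Polynomial.X ^ n +
        Polynomial.C κ, ?_⟩
      refine (h.add ((isBigO_sub_sum_taylorCoeff hf N).comp_tendsto hp0)).congr_left fun z => ?_
      simp only [Function.comp_apply, Polynomial.eval_add, Polynomial.eval_finsetSum,
        Polynomial.eval_mul, Polynomial.eval_C, Polynomial.eval_pow, Polynomial.eval_X]
      ring
  refine ⟨c, ?_, hc⟩
  have h1 := (hc 1).trans_tendsto (by simpa using hp0)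
  have h2 := ((tendsto_xiRemainder v hθ).add_const κ).sub h1
  simp only [Finset.sum_range_one, pow_zero, mul_one, sub_sub_cancel, sub_zero, zero_add] at h2
  exact tendsto_nhds_unique tendsto_const_nhds h2

/-- The complete expansion of `xiExponent` in the sector. -/
theorem exists_xiExponent_expansion [Fact (0 < θ)] (hθ : θ ≤ Real.pi / 4) (κ : ℂ) :
    ∃ a' a : ℕ → ℂ, (∀ N : ℕ, (fun z : ℂ => xiExponent (xiPoint v z) + κ -
        ∑ n ∈ Finset.range (N + 1), (a' n * log z + a n) * z ^ (((1 - (n : ℝ)) / 2 : ℝ) : ℂ))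
        =o[sectorAtInfinity θ] fun z : ℂ => ‖z‖ ^ ((1 - (N : ℝ)) / 2)) ∧
      a' 0 = 1 / 4 ∧ a 0 = ((-(1 + Real.log (2 * Real.pi)) / 2 : ℝ) : ℂ) ∧
      a' 1 = 7 / 8 ∧ (∀ m : ℕ, 1 ≤ m → a' (2 * m + 1) = 0) ∧
      a 1 = ((Real.log (8 * Real.pi) / 4 : ℝ) : ℂ) + κ := by
  have hp := tendsto_inv_csqrt_sectorAtInfinity θ
  have hp0 := hp.mono_right nhdsWithin_le_nhds
  obtain ⟨c, hc0, hc⟩ := exists_xiRemainder_coeff v hθ κ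
  -- The remainder is not multiplied by √z, so after √z is factored out its coefficients are shifted
  -- by one place.
  set b : ℕ → ℂ := fun n => Nat.casesOn n 0 c with hb
  refine ⟨taylorCoeff (logPart v), fun n => taylorCoeff (analyticPart v) n + b n, fun N => ?_,
    taylorCoeff_logPart_zero v, ?_, taylorCoeff_logPart_one v,
    fun m hm => taylorCoeff_logPart_odd v hm, ?_⟩
  rotate_left
  · simp [taylorCoeff_analyticPart_zero, hb]
  · simp [taylorCoeff_analyticPart_one, hb, hc0]
  have hL := (isBigO_sub_sum_taylorCoeff (analyticAt_logPart v) (N + 1)).comp_tendsto hp0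
  have hA := (isBigO_sub_sum_taylorCoeff (analyticAt_analyticPart v) (N + 1)).comp_tendsto hp0
  have hR := (isBigO_refl (fun z => (csqrt z)⁻¹) (sectorAtInfinity θ)).mul (hc N)
  -- the logarithm is negligible against `csqrt`
  have hlog : (fun z => log z * (csqrt z)⁻¹) =o[sectorAtInfinity θ] fun _ => (1 : ℂ) := by
    rw [isLittleO_one_iff, tendsto_zero_iff_norm_tendsto_zero]
    have h1 : Tendsto (fun x : ℝ => (Real.log x + Real.pi) * (x ^ (1 / 2 : ℝ))⁻¹) atTop (𝓝 0) := by
      have e1 := (isLittleO_log_rpow_atTop (r := 1 / 2) (by norm_num)).tendsto_div_nhds_zero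
      have e2 : Tendsto (fun x : ℝ => Real.pi * (x ^ (1 / 2 : ℝ))⁻¹) atTop (𝓝 (Real.pi * 0)) :=
        ((tendsto_rpow_atTop (by norm_num)).inv_tendsto_atTop).const_mul _
      have := e1.add e2
      simp only [mul_zero, add_zero] at this
      refine this.congr fun x => ?_
      ring
    refine squeeze_zero' (Eventually.of_forall fun z => norm_nonneg _) ?_
      (h1.comp (tendsto_norm_sectorAtInfinity θ))
    filter_upwards [(tendsto_norm_sectorAtInfinity θ).eventually_ge_atTop 1] with z hz
    rw [norm_mul, norm_inv, norm_csqrt]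
    simp only [Function.comp_apply]
    gcongr
    refine (norm_le_abs_re_add_abs_im _).trans ?_
    rw [log_re, log_im, abs_of_nonneg (Real.log_nonneg hz)]
    gcongr
    exact abs_arg_le_pi z
  have hstep : (fun z => (csqrt z)⁻¹ ^ (N + 1)) =o[sectorAtInfinity θ] fun z => (csqrt z)⁻¹ ^ N := by
    have h1 : (fun z => (csqrt z)⁻¹) =o[sectorAtInfinity θ] fun _ => (1 : ℂ) :=
      (isLittleO_one_iff ℂ).2 hp0
    have := (isBigO_refl (fun z => (csqrt z)⁻¹ ^ N) (sectorAtInfinity θ)).mul_isLittleO h1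
    simpa [pow_succ] using this
  -- Taylor expansion to one order more pays for the factor log z, which is negligible against √z.
  have hL' : (fun z => log z * (logPart v (csqrt z)⁻¹ -
      ∑ n ∈ Finset.range (N + 1), taylorCoeff (logPart v) n * (csqrt z)⁻¹ ^ n))
      =o[sectorAtInfinity θ] fun z => (csqrt z)⁻¹ ^ N := by
    have h1 : (fun z => log z * (csqrt z)⁻¹ ^ (N + 1)) =o[sectorAtInfinity θ]
        fun z => (csqrt z)⁻¹ ^ N := by
      have := hlog.mul_isBigO (isBigO_refl (fun z => (csqrt z)⁻¹ ^ N) (sectorAtInfinity θ))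
      simp only [one_mul] at this
      refine this.congr_left fun z => ?_
      rw [pow_succ']
      ring
    exact ((isBigO_refl (fun z => log z) _).mul hL).trans_isLittleO h1
  have hR' : (fun z => (csqrt z)⁻¹ * (xiRemainder v z + κ -
      ∑ n ∈ Finset.range N, c n * (csqrt z)⁻¹ ^ n)) =o[sectorAtInfinity θ]
      fun z => (csqrt z)⁻¹ ^ N := by
    refine IsBigO.trans_isLittleO (hR.congr_right fun z => ?_) hstep
    rw [pow_succ']
  have hsum := ((hL'.add (hA.trans_isLittleO hstep)).add hR')
  have hfin := (isBigO_refl (fun z => csqrt z) (sectorAtInfinity θ)).mul_isLittleO hsum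
  have hev : ∀ᶠ z in sectorAtInfinity θ, z ≠ 0 := by
    filter_upwards [(tendsto_norm_sectorAtInfinity θ).eventually_gt_atTop 0] with z hz
    exact norm_pos_iff.1 hz
  refine IsLittleO.trans_isBigO (hfin.congr' ?_ EventuallyEq.rfl) ?_
  · filter_upwards [xiExponent_xiPoint_eq v hθ, hev] with z hz hz0
    have hr := csqrt_ne_zero hz0
    have hb1 : ∑ n ∈ Finset.range (N + 1), b n * (csqrt z)⁻¹ ^ n =
        (csqrt z)⁻¹ * ∑ n ∈ Finset.range N, c n * (csqrt z)⁻¹ ^ n := by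
      have hb0 : b 0 = 0 := rfl
      have hbs : ∀ n, b (n + 1) = c n := fun n => rfl
      rw [Finset.sum_range_succ', Finset.mul_sum, hb0, zero_mul, add_zero]
      refine Finset.sum_congr rfl fun n _ => ?_
      rw [hbs]
      ring
    have hs : ∑ n ∈ Finset.range (N + 1), (taylorCoeff (logPart v) n * log z +
        (taylorCoeff (analyticPart v) n + b n)) * z ^ (((1 - (n : ℝ)) / 2 : ℝ) : ℂ) =
        csqrt z * (log z * ∑ n ∈ Finset.range (N + 1),
            taylorCoeff (logPart v) n * (csqrt z)⁻¹ ^ n +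
          ∑ n ∈ Finset.range (N + 1), taylorCoeff (analyticPart v) n * (csqrt z)⁻¹ ^ n +
          ∑ n ∈ Finset.range (N + 1), b n * (csqrt z)⁻¹ ^ n) := by
      rw [Finset.mul_sum, ← Finset.sum_add_distrib, ← Finset.sum_add_distrib, Finset.mul_sum]
      refine Finset.sum_congr rfl fun n _ => ?_
      rw [csqrt_cpow hz0]
      ring
    rw [hs, hb1, hz]
    simp only [Function.comp_apply]
    field_simp
    ring
  · refine IsBigO.of_bound 1 ?_
    filter_upwards [hev] with z hz0
    rw [← csqrt_cpow hz0, one_mul, norm_cpow_of_ne_zero hz0]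
    simp [abs_of_nonneg (Real.rpow_nonneg (norm_nonneg z) _)]

end

/-! ### The zeros of Ξ and the product Δ -/

theorem sq_mem_slitPlane {w : ℂ} (hw : 0 < w.re) : w ^ 2 ∈ slitPlane := by
  rw [mem_slitPlane_iff]
  by_cases h : w.im = 0
  · left
    rw [pow_two, mul_re, h]
    nlinarith
  · right
    rw [pow_two, mul_im]
    have : w.re * w.im ≠ 0 := mul_ne_zero hw.ne' h
    intro h'
    apply this
    linarith

theorem abs_arg_lt_pi_of_mem_slitPlane {z : ℂ} (hz : z ∈ slitPlane) : |arg z| < Real.pi :=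
  abs_lt.2 ⟨neg_pi_lt_arg z, lt_of_le_of_ne (arg_le_pi z) (slitPlane_arg_ne_pi hz)⟩

theorem isLittleO_rpow_rpow_atTop {a b : ℝ} (h : a < b) :
    (fun x : ℝ => x ^ a) =o[atTop] fun x : ℝ => x ^ b := by
  refine (isLittleO_iff_tendsto' ?_).2 ?_
  · filter_upwards [eventually_gt_atTop 0] with x hx h'
    exact absurd h' (Real.rpow_pos_of_pos hx b).ne'
  · refine (tendsto_rpow_neg_atTop (sub_pos.2 h)).congr' ?_
    filter_upwards [eventually_gt_atTop 0] with x hx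
    rw [← Real.rpow_sub hx, neg_sub]

theorem re_csqrt_pos {z : ℂ} (hz : z ∈ slitPlane) : 0 < (csqrt z).re := by
  have h0 := slitPlane_ne_zero hz
  have h1 : |arg (csqrt z)| < Real.pi / 2 := by
    rw [arg_csqrt h0, abs_div, abs_two]
    have := (abs_arg_lt_pi_of_mem_slitPlane hz)
    linarith
  exact (abs_arg_lt_pi_div_two_iff.1 h1).resolve_right (csqrt_ne_zero h0)

namespace IsRiemannZeroSequence

variable {τ : ℕ → ℂ} (hτ : IsRiemannZeroSequence τ)

-- The real part of 1/2 + iτ is 1/2 - Im τ, and the zeros of ξ lie in the open critical strip. This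
-- bounds the deviation of τ_k² from the positive axis.
include hτ in
theorem abs_im_lt (k : ℕ) : |(τ k).im| < 1 / 2 := by
  have him : 0 < (1 / 2 + I * τ k).im := by simpa using hτ.re_pos k
  have h1 : riemannXi (1 / 2 + I * τ k) = 0 := by
    refine apply_eq_zero_of_analyticOrderAt_ne_zero (f := riemannXi) ?_
    rw [← analyticOrderAt_riemannZeta_eq him, ← hτ.multiplicity _ (hτ.re_pos k)]
    simp only [ne_eq, Set.encard_eq_zero]
    exact Set.nonempty_iff_ne_empty.1 ⟨k, rfl⟩
  have h2 := re_mem_Ioo_of_riemannXi_eq_zero h1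
  simp only [add_re, mul_re, I_re, I_im, zero_mul, one_mul, zero_sub, one_div, inv_re, re_ofNat,
    normSq_ofNat] at h2
  obtain ⟨h3, h4⟩ := h2
  rw [abs_lt]
  constructor <;> linarith

variable {v : ℝ} (hv : -(τ 0 ^ 2).re < v)

-- A real τ_k satisfies τ_k² ≥ (Re τ_0)² ≥ Re τ_0² > -v by monotonicity; otherwise the imaginary
-- part 2 Re τ_k Im τ_k is nonzero.
include hτ hv in
theorem sq_add_mem_slitPlane (k : ℕ) : τ k ^ 2 + (v : ℂ) ∈ slitPlane := by
  have h0 := hτ.re_pos 0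
  have hk := hτ.re_pos k
  have hmono : (τ 0).re ≤ (τ k).re := hτ.monotone_re (Nat.zero_le k)
  rw [mem_slitPlane_iff]
  by_cases h : (τ k).im = 0
  · left
    simp only [pow_two, mul_re, add_re, ofReal_re, h] at hv ⊢
    nlinarith [sq_nonneg (τ 0).im]
  · right
    simp only [pow_two, mul_im, add_im, ofReal_im, add_zero]
    have : (τ k).re * (τ k).im ≠ 0 := mul_ne_zero hk.ne' h
    intro h'
    apply this
    linarith

-- If -(z+v) is off the cut it equals w² with Re w > 0, and τ_k² = w² forces τ_k = w. On the cut z+v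
-- is a nonnegative real, where Ξ is positive, and no τ_k² lies there; both sides vanish.
include hτ in
theorem encard_eq_order (z : ℂ) :
    {k | τ k ^ 2 + (v : ℂ) = -z}.encard = analyticOrderAt riemannXiSq (z + v) := by
  by_cases hs : -(z + v) ∈ slitPlane
  · have hw := re_csqrt_pos hs
    have h1 := analyticOrderAt_riemannXiSq_neg_sq hw
    rw [csqrt_sq, neg_neg] at h1
    rw [h1, ← hτ.multiplicity _ hw]
    congr 1
    ext k
    simp only [Set.mem_ofPred_eq]
    constructor
    · intro h
      have h2 : τ k ^ 2 = csqrt (-(z + v)) ^ 2 := by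
        rw [csqrt_sq]
        linear_combination h
      rcases sq_eq_sq_iff_eq_or_eq_neg.1 h2 with h3 | h3
      · exact h3
      · have := hτ.re_pos k
        rw [h3, neg_re] at this
        linarith
    · intro h
      rw [h, csqrt_sq]
      ring
  · have hempty : {k | τ k ^ 2 + (v : ℂ) = -z} = ∅ := by
      refine Set.eq_empty_of_forall_notMem fun k hk => hs ?_
      have h1 : τ k ^ 2 + (v : ℂ) = -z := hk
      rw [show -(z + v) = τ k ^ 2 by linear_combination -h1]
      exact sq_mem_slitPlane (hτ.re_pos k)
    rw [mem_slitPlane_iff] at hs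
    push Not at hs
    simp only [neg_re, neg_im, neg_eq_zero] at hs
    obtain ⟨r, hr, h⟩ := riemannXiSq_ofReal_pos (u := (z + v).re) (by linarith [hs.1])
    have hz : z + v = ((z + v).re : ℂ) := Complex.ext rfl (by simpa using hs.2)
    rw [hempty, Set.encard_empty, eq_comm, analyticOrderAt_eq_zero]
    right
    rw [hz, h]
    exact_mod_cast hr.ne'

include hτ hv in
theorem riemannXiSq_ne_zero : riemannXiSq v ≠ 0 := by
  have h := hτ.encard_eq_order (v := v) 0
  rw [zero_add] at h
  have hempty : {k | τ k ^ 2 + (v : ℂ) = -0} = ∅ := by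
    refine Set.eq_empty_of_forall_notMem fun k hk => ?_
    have h1 : τ k ^ 2 + (v : ℂ) = -0 := hk
    rw [neg_zero] at h1
    exact slitPlane_ne_zero (hτ.sq_add_mem_slitPlane hv k) h1
  rw [hempty, Set.encard_empty, eq_comm,
    (differentiable_riemannXiSq.analyticAt _).analyticOrderAt_eq_zero] at h
  exact h

/-- The quotient `Ξ(z + v) / Ξ(v)`. -/
def _root_.normalizedXi (v : ℝ) (z : ℂ) : ℂ := riemannXiSq (z + v) / riemannXiSq v

include hτ hv in
theorem normalizedXi_zero : normalizedXi v 0 = 1 := by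
  rw [normalizedXi, zero_add, div_self (hτ.riemannXiSq_ne_zero hv)]

theorem _root_.differentiable_normalizedXi (v : ℝ) : Differentiable ℂ (normalizedXi v) := by
  have := differentiable_riemannXiSq
  unfold normalizedXi
  exact (this.comp (differentiable_id.add_const (v : ℂ))).div_const _

include hτ hv in
theorem encard_eq_order_normalizedXi (z : ℂ) :
    {k | τ k ^ 2 + (v : ℂ) = -z}.encard = analyticOrderAt (normalizedXi v) z := by
  rw [hτ.encard_eq_order]
  have h1 : analyticOrderAt (riemannXiSq ∘ fun z => z + v) z = analyticOrderAt riemannXiSq (z + v) := by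
    refine analyticOrderAt_comp_of_deriv_ne_zero (g := fun z : ℂ => z + v) (by fun_prop) ?_
    simp
  have h2 : normalizedXi v = (fun _ => (riemannXiSq v)⁻¹) * (riemannXiSq ∘ fun z => z + v) := by
    funext z
    simp [normalizedXi, div_eq_inv_mul]
  have h3 : AnalyticAt ℂ (riemannXiSq ∘ fun z => z + v) z :=
    (differentiable_riemannXiSq.comp (differentiable_id.add_const (v : ℂ))).analyticAt z
  have h4 : analyticOrderAt (fun _ : ℂ => (riemannXiSq v)⁻¹) z = 0 :=
    analyticOrderAt_eq_zero.2 (Or.inr (inv_ne_zero (hτ.riemannXiSq_ne_zero hv)))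
  rw [h2, analyticOrderAt_mul analyticAt_const h3, h1, h4, zero_add]

include hτ hv in
theorem exists_norm_normalizedXi_le {α : ℝ} (hα : 1 / 2 < α) (hα1 : α < 1) : ∃ C : ℝ, 0 < C ∧
    ∀ z, ‖normalizedXi v z‖ ≤ Real.exp (C * (1 + ‖z‖ ^ α)) := by
  obtain ⟨C, hC, h⟩ := exists_norm_riemannXiSq_le hα
  have hne := norm_pos_iff.2 (hτ.riemannXiSq_ne_zero hv)
  set B : ℝ := C * (1 + |v| ^ α) + |Real.log ‖riemannXiSq v‖| with hB
  refine ⟨C + B, by positivity, fun z => ?_⟩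
  rw [normalizedXi, norm_div, div_le_iff₀ hne]
  refine (h (z + v)).trans ?_
  have h1 : Real.exp (Real.log ‖riemannXiSq v‖) = ‖riemannXiSq v‖ := Real.exp_log hne
  rw [← h1, ← Real.exp_add, Real.exp_le_exp]
  have h2 : ‖z + v‖ ^ α ≤ ‖z‖ ^ α + |v| ^ α := by
    refine (Real.rpow_le_rpow (norm_nonneg _) (norm_add_le _ _) (by linarith)).trans ?_
    rw [norm_real, Real.norm_eq_abs]
    exact Real.rpow_add_le_add_rpow (norm_nonneg _) (abs_nonneg _) (by linarith) hα1.le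
  have h3 := neg_abs_le (Real.log ‖riemannXiSq v‖)
  have h4 : 0 ≤ ‖z‖ ^ α := by positivity
  have h5 : C * (1 + ‖z + v‖ ^ α) ≤ C * (1 + (‖z‖ ^ α + |v| ^ α)) := by gcongr
  have h6 : 0 ≤ B * ‖z‖ ^ α := by positivity
  nlinarith

include hτ hv in
theorem deltaFn_eq : deltaFn (fun k => τ k ^ 2 + (v : ℂ)) = normalizedXi v := by
  obtain ⟨C, hC, h⟩ := hτ.exists_norm_normalizedXi_le hv (α := 3 / 4) (by norm_num) (by norm_num)
  exact (hadamard_genus_zero (differentiable_normalizedXi v) (hτ.normalizedXi_zero hv)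
    (hτ.encard_eq_order_normalizedXi hv) (by norm_num) (by norm_num) hC h).2.symm

include hτ hv in
theorem summable_norm_rpow {β : ℝ} (hβ : 1 / 2 < β) :
    Summable fun k => ‖τ k ^ 2 + (v : ℂ)‖ ^ (-β) := by
  obtain ⟨α, h1, h2⟩ := exists_between (lt_min hβ (show (1 / 2 : ℝ) < 1 by norm_num))
  obtain ⟨C, hC, h⟩ := hτ.exists_norm_normalizedXi_le hv h1 (h2.trans_le (min_le_right _ _))
  exact (hadamard_genus_zero (differentiable_normalizedXi v) (hτ.normalizedXi_zero hv)
    (hτ.encard_eq_order_normalizedXi hv) (by linarith) (h2.trans_le (min_le_right _ _)) hC h).1 β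
    (h2.trans_le (min_le_left _ _))

include hτ hv in
theorem summable_norm_inv : Summable fun k => ‖τ k ^ 2 + (v : ℂ)‖⁻¹ := by
  simpa [Real.rpow_neg_one] using hτ.summable_norm_rpow hv (β := 1) (by norm_num)

include hτ hv in
theorem tendsto_norm : Tendsto (fun k => ‖τ k ^ 2 + (v : ℂ)‖) atTop atTop :=
  tendsto_norm_atTop_of_finite (finite_zero_index (differentiable_normalizedXi v)
    (hτ.normalizedXi_zero hv) (hτ.encard_eq_order_normalizedXi hv))

-- Since Im τ_k is bounded, x_k eventually lies in the closed right half-plane; the finitely many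
-- remaining arguments stay away from ±π because x_k avoids the cut.
include hτ hv in
theorem exists_sector : ∃ θ : ℝ, 0 < θ ∧ θ ≤ Real.pi / 4 ∧
    ∀ k, |arg (τ k ^ 2 + (v : ℂ))| ≤ Real.pi - θ := by
  have hpi := Real.pi_pos
  have hev : ∀ᶠ k in atTop, |arg (τ k ^ 2 + (v : ℂ))| ≤ Real.pi / 2 := by
    filter_upwards [(hτ.tendsto_norm hv).eventually_ge_atTop (2 * |v| + 1)] with k hk
    rw [abs_arg_le_pi_div_two_iff]
    have h1 := hτ.abs_im_lt k
    have h2 : ‖τ k ^ 2 + (v : ℂ)‖ ≤ (τ k).re ^ 2 + (τ k).im ^ 2 + |v| := by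
      refine (norm_add_le _ _).trans ?_
      rw [norm_pow, Complex.sq_norm, normSq_apply, norm_real, Real.norm_eq_abs]
      nlinarith
    have h3 : (τ k).im ^ 2 ≤ 1 / 4 := by
      rw [← sq_abs]
      nlinarith [abs_nonneg (τ k).im]
    have h4 := neg_abs_le v
    simp only [pow_two, mul_re, add_re, ofReal_re]
    nlinarith
  obtain ⟨K, hK⟩ := eventually_atTop.1 hev
  have hlt : ∀ k, |arg (τ k ^ 2 + (v : ℂ))| < Real.pi := fun k =>
    abs_arg_lt_pi_of_mem_slitPlane (hτ.sq_add_mem_slitPlane hv k)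
  obtain ⟨θ, hθ, hθK⟩ : ∃ θ : ℝ, 0 < θ ∧
      ∀ k ∈ Finset.range (K + 1), θ ≤ Real.pi - |arg (τ k ^ 2 + (v : ℂ))| := by
    obtain ⟨k₀, -, h⟩ := Finset.exists_min_image (Finset.range (K + 1))
      (fun k => Real.pi - |arg (τ k ^ 2 + (v : ℂ))|) ⟨0, by simp⟩
    exact ⟨_, by linarith [hlt k₀], h⟩
  refine ⟨min θ (Real.pi / 4), lt_min hθ (by positivity), min_le_right _ _, fun k => ?_⟩
  by_cases hk : k < K + 1
  · have h1 := hθK k (Finset.mem_range.2 hk)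
    have h2 := min_le_left θ (Real.pi / 4)
    linarith
  · have h1 := hK k (by omega)
    have h2 := min_le_right θ (Real.pi / 4)
    linarith

include hτ hv in
theorem eventually_norm_deltaFn_le {δ ε : ℝ} (hδ : 0 < δ) (hε : 0 < ε) :
    ∀ᶠ z in Bornology.cobounded ℂ, ‖deltaFn (fun k => τ k ^ 2 + (v : ℂ)) z‖ ≤
      Real.exp (ε * ‖z‖ ^ (1 / 2 + δ)) := by
  obtain ⟨α, h1, h2⟩ := exists_between
    (lt_min (show (1 / 2 : ℝ) < 1 / 2 + δ by linarith) (show (1 / 2 : ℝ) < 1 by norm_num))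
  obtain ⟨C, hC, h⟩ := hτ.exists_norm_normalizedXi_le hv h1 (h2.trans_le (min_le_right _ _))
  have hα : α < 1 / 2 + δ := h2.trans_le (min_le_left _ _)
  have ho : (fun x : ℝ => C * (1 + x ^ α)) =o[atTop] fun x : ℝ => x ^ (1 / 2 + δ) := by
    refine IsLittleO.const_mul_left (IsLittleO.add ?_ (isLittleO_rpow_rpow_atTop hα)) _
    simpa using isLittleO_rpow_rpow_atTop (show (0 : ℝ) < 1 / 2 + δ by linarith)
  rw [hτ.deltaFn_eq hv]
  filter_upwards [tendsto_norm_cobounded_atTop.eventually (ho.bound hε)] with z hz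
  refine (h z).trans (Real.exp_le_exp.2 ?_)
  rw [Real.norm_eq_abs, Real.norm_eq_abs, abs_of_nonneg (by positivity),
    abs_of_nonneg (by positivity)] at hz
  exact hz

end IsRiemannZeroSequence

/-! ### Identification of the branch and of the constant -/

theorem tendsto_ofReal_sectorAtInfinity {θ : ℝ} (hθ : 0 < θ) :
    Tendsto (fun y : ℝ => (y : ℂ)) atTop (sectorAtInfinity θ) := by
  refine tendsto_inf.2 ⟨?_, tendsto_principal.2 ?_⟩
  · rw [← tendsto_norm_atTop_iff_cobounded]
    simpa using tendsto_abs_atTop_atTop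
  · filter_upwards [eventually_ge_atTop 0] with y hy
    simpa [arg_ofReal_of_nonneg hy] using hθ

theorem csqrt_ofReal {y : ℝ} (hy : 0 ≤ y) : csqrt y = ((y ^ (1 / 2 : ℝ) : ℝ) : ℂ) := by
  rw [csqrt, ofReal_cpow hy]
  norm_num

theorem continuousAt_csqrt {z : ℂ} (hz : z ∈ slitPlane) : ContinuousAt csqrt z :=
  continuousAt_id.cpow continuousAt_const hz

theorem mem_slitPlane_of_abs_arg_lt {z : ℂ} (hz : z ≠ 0) (h : |arg z| < Real.pi) :
    z ∈ slitPlane :=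
  mem_slitPlane_iff_arg.2 ⟨(lt_of_abs_lt h).ne, hz⟩

/-- The part of a sector outside a disc is connected. -/
theorem isPreconnected_sector {R θ : ℝ} (hR : 0 < R) (hθ : θ ≤ Real.pi) :
    IsPreconnected {z : ℂ | R < ‖z‖ ∧ |arg z| < θ} := by
  have h : {z : ℂ | R < ‖z‖ ∧ |arg z| < θ} = exp '' {w : ℂ | w.re ∈ Set.Ioi (Real.log R) ∧
      w.im ∈ Set.Ioo (-θ) θ} := by
    ext z
    simp only [Set.mem_ofPred_eq, Set.mem_image, Set.mem_Ioi, Set.mem_Ioo]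
    constructor
    · rintro ⟨h1, h2⟩
      refine ⟨log z, ⟨?_, ?_⟩, exp_log (norm_pos_iff.1 (hR.trans h1))⟩
      · rw [log_re]
        exact Real.log_lt_log hR h1
      · rw [log_im]
        exact abs_lt.1 h2
    · rintro ⟨w, ⟨h1, h2, h3⟩, rfl⟩
      refine ⟨?_, ?_⟩
      · rw [norm_exp]
        exact (Real.log_lt_iff_lt_exp hR).1 h1
      · rw [arg_exp, toIocMod_eq_self Real.two_pi_pos |>.2 ⟨by linarith, by linarith⟩]
        exact abs_lt.2 ⟨h2, h3⟩
  rw [h]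
  refine IsPreconnected.image ?_ _ continuous_exp.continuousOn
  exact ((convex_halfSpace_re_gt _).inter ((convex_halfSpace_im_gt _).inter
    (convex_halfSpace_im_lt _))).isPreconnected

theorem eventually_continuousAt_xiExponent_xiPoint (v : ℝ) {θ : ℝ} (hθ : θ ≤ Real.pi / 4) :
    ∀ᶠ z in sectorAtInfinity θ, ContinuousAt (fun z => xiExponent (xiPoint v z)) z := by
  obtain ⟨R, -, hR⟩ := exists_continuousAt_xiExponent
  have hp := (tendsto_inv_csqrt_sectorAtInfinity θ).mono_right nhdsWithin_le_nhds
  have hsec : ∀ᶠ z in sectorAtInfinity θ, |arg z| < θ := eventually_sectorAtInfinity.2 ⟨0, fun z _ h => h⟩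
  filter_upwards [(tendsto_re_xiPoint v hθ).eventually_gt_atTop R,
    (tendsto_norm_sectorAtInfinity θ).eventually_gt_atTop 0, hsec,
    hp.eventually (analyticAt_sqrtFactor v).eventually_analyticAt] with z h1 h2 h3 h4
  have hz0 := norm_pos_iff.1 h2
  have hc := continuousAt_csqrt (mem_slitPlane_of_abs_arg_lt hz0 (by linarith [Real.pi_pos]))
  have hci := hc.inv₀ (csqrt_ne_zero hz0)
  have hs : ContinuousAt (fun z => sqrtFactor v (csqrt z)⁻¹) z :=
    ContinuousAt.comp (f := fun z => (csqrt z)⁻¹) (g := sqrtFactor v) h4.continuousAt hci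
  have hx : ContinuousAt (xiPoint v) z := hc.mul (hs.add (hci.div_const 2))
  exact ContinuousAt.comp (f := xiPoint v) (hR _ h1) hx

/-- The main part of `xiExponent` is real on the positive axis. -/
theorem eventually_im_mainPart (v : ℝ) : ∀ᶠ y : ℝ in atTop,
    (csqrt y * (logPart v (csqrt y)⁻¹ * log y + analyticPart v (csqrt y)⁻¹)).im = 0 := by
  have hlim : Tendsto (fun y : ℝ => (y ^ (1 / 2 : ℝ))⁻¹) atTop (𝓝 0) :=
    tendsto_inv_atTop_zero.comp (tendsto_rpow_atTop (by norm_num))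
  have hlim' : Tendsto (fun y : ℝ => (((y ^ (1 / 2 : ℝ))⁻¹ : ℝ) : ℂ)) atTop (𝓝 0) := by
    exact_mod_cast (continuous_ofReal.tendsto 0).comp hlim
  have hv : ∀ᶠ q : ℝ in 𝓝 0, 0 ≤ 1 + v * q ^ 2 := by
    have : ContinuousAt (fun q : ℝ => 1 + v * q ^ 2) 0 := by fun_prop
    exact this.eventually (eventually_ge_nhds (by simp))
  filter_upwards [hlim'.eventually (eventually_sqrtFactor_near v), hlim.eventually hv,
    eventually_ge_atTop 0] with y h1 h2 hy
  set q : ℝ := (y ^ (1 / 2 : ℝ))⁻¹ with hq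
  have hcq : (csqrt y)⁻¹ = (q : ℂ) := by rw [csqrt_ofReal hy, hq, ofReal_inv]
  set h : ℝ := (1 + v * q ^ 2) ^ (1 / 2 : ℝ) with hh
  have hs : sqrtFactor v q = (h : ℂ) := by
    rw [sqrtFactor, hh, ofReal_cpow h2]
    norm_num
  rw [hs] at h1
  have e1 : |h + q / 2 - 1| ≤ 1 / 4 := by
    have := h1.1
    rw [← Real.norm_eq_abs, ← norm_real]
    exact_mod_cast this
  have e2 : |h - q / 2 - 1| ≤ 1 / 4 := by
    have := h1.2
    rw [← Real.norm_eq_abs, ← norm_real]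
    exact_mod_cast this
  rw [abs_le] at e1 e2
  have l1 : log ((h : ℂ) + q / 2) = ((Real.log (h + q / 2) : ℝ) : ℂ) := by
    rw [ofReal_log (by linarith)]
    push_cast
    rfl
  have l2 : log ((h : ℂ) - q / 2) = ((Real.log (h - q / 2) : ℝ) : ℂ) := by
    rw [ofReal_log (by linarith)]
    push_cast
    rfl
  have l3 : log ((h : ℂ) / 2 + q / 4) = ((Real.log (h / 2 + q / 4) : ℝ) : ℂ) := by
    rw [ofReal_log (by linarith)]
    push_cast
    rfl
  rw [hcq, logPart, analyticPart, hs, l1, l2, l3, csqrt_ofReal hy, ← ofReal_log hy]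
  have : ∀ r : ℝ, ((r : ℂ)).im = 0 := ofReal_im
  convert! this (y ^ (1 / 2 : ℝ) * ((h / 4 + 7 / 8 * q) * Real.log y +
    (q * (Real.log (h + q / 2) + Real.log (h - q / 2)) +
      (h + q / 2) / 2 * (Real.log (h / 2 + q / 4) - Real.log Real.pi - 1) -
      q / 2 * Real.log (h / 2 + q / 4) + q * (Real.log (2 * Real.pi) / 2)))) using 2
  push_cast
  ring

namespace IsRiemannZeroSequence

variable {τ : ℕ → ℂ} (hτ : IsRiemannZeroSequence τ) {v : ℝ} (hv : -(τ 0 ^ 2).re < v)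

include hτ hv in
theorem ne_zero (k : ℕ) : τ k ^ 2 + (v : ℂ) ≠ 0 := slitPlane_ne_zero (hτ.sq_add_mem_slitPlane hv k)

include hτ hv in
theorem continuousOn_logDelta_sector {θ : ℝ}
    (hθ : ∀ k, |arg (τ k ^ 2 + (v : ℂ))| ≤ Real.pi - θ) :
    ContinuousOn (logDelta fun k => τ k ^ 2 + (v : ℂ)) {z | |arg z| < θ} :=
  (continuousOn_logDelta (hτ.tendsto_norm hv) (hτ.summable_norm_inv hv)).mono
    fun _ hz k => one_add_div_mem_slitPlane (hτ.ne_zero hv k) hz (hθ k)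

include hτ hv in
theorem exp_logDelta_eq {θ : ℝ} (hθ : ∀ k, |arg (τ k ^ 2 + (v : ℂ))| ≤ Real.pi - θ) {z : ℂ}
    (hz : |arg z| < θ) : exp (logDelta (fun k => τ k ^ 2 + (v : ℂ)) z) = normalizedXi v z := by
  rw [exp_logDelta (hτ.summable_norm_inv hv), hτ.deltaFn_eq hv]
  exact fun k => slitPlane_ne_zero (one_add_div_mem_slitPlane (hτ.ne_zero hv k) hz (hθ k))

-- Both sides are continuous logarithms of Ξ(z+v), up to the constant factor Ξ(v), on the connected
-- outer part of the sector, so they differ by a constant.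
include hτ hv in
theorem exists_logDelta_eq {θ : ℝ} (hθ0 : 0 < θ) (hθ4 : θ ≤ Real.pi / 4)
    (hθ : ∀ k, |arg (τ k ^ 2 + (v : ℂ))| ≤ Real.pi - θ) :
    ∃ κ : ℂ, (∀ᶠ z in sectorAtInfinity θ,
      logDelta (fun k => τ k ^ 2 + (v : ℂ)) z = xiExponent (xiPoint v z) + κ) ∧
      exp κ * riemannXiSq v = 1 := by
  have hne := hτ.riemannXiSq_ne_zero hv
  obtain ⟨R, hR⟩ := eventually_sectorAtInfinity.1
    ((eventually_continuousAt_xiExponent_xiPoint v hθ4).and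
      ((tendsto_re_xiPoint v hθ4).eventually_gt_atTop 1))
  set R' := max R 1
  have hR'0 : 0 < R' := by positivity
  set S : Set ℂ := {z | R' < ‖z‖ ∧ |arg z| < θ} with hS
  have hRS : ∀ z ∈ S, ContinuousAt (fun z => xiExponent (xiPoint v z)) z ∧ 1 < (xiPoint v z).re :=
    fun z hz => hR z ((le_max_left _ _).trans hz.1.le) hz.2
  set D : ℂ → ℂ := fun z => logDelta (fun k => τ k ^ 2 + (v : ℂ)) z - xiExponent (xiPoint v z) +
    log (riemannXiSq v) with hD
  have hDc : ContinuousOn D S := by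
    refine ContinuousOn.add (ContinuousOn.sub ?_ ?_) continuousOn_const
    · exact (hτ.continuousOn_logDelta_sector hv hθ).mono fun z hz => hz.2
    · exact fun z hz => (hRS z hz).1.continuousWithinAt
  have hDe : ∀ z ∈ S, exp (D z) = 1 := by
    intro z hz
    have hz0 : z ≠ 0 := norm_pos_iff.1 (hR'0.trans hz.1)
    have h1 : riemannXi (xiPoint v z) ≠ 0 := by
      rw [← exp_xiExponent (hRS z hz).2]
      exact exp_ne_zero _
    rw [hD]
    simp only
    rw [exp_add, exp_sub, hτ.exp_logDelta_eq hv hθ hz.2, exp_xiExponent (hRS z hz).2, exp_log hne,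
      normalizedXi, riemannXiSq_add_eq v hz0]
    field_simp
  have ha : ((R' + 1 : ℝ) : ℂ) ∈ S := by
    refine ⟨?_, ?_⟩
    · rw [norm_real, Real.norm_eq_abs, abs_of_pos (by positivity)]
      linarith
    · rw [arg_ofReal_of_nonneg (by positivity)]
      simpa using hθ0
  have hpre : IsPreconnected S := isPreconnected_sector hR'0 (by linarith [Real.pi_pos])
  refine ⟨D ((R' + 1 : ℝ) : ℂ) - log (riemannXiSq v), ?_, ?_⟩
  · refine eventually_sectorAtInfinity.2 ⟨R' + 1, fun z hz hzθ => ?_⟩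
    have := eqOn_of_exp_eq_one hpre hDc hDe (b := z) ha ⟨by linarith, hzθ⟩
    rw [this, hD]
    ring
  · rw [exp_sub, hDe _ ha, exp_log hne]
    field_simp

include hτ hv in
/-- For `v ≥ 0` the function `logDelta` is real on the positive axis. -/
theorem im_logDelta_ofReal {θ : ℝ} (hθ0 : 0 < θ)
    (hθ : ∀ k, |arg (τ k ^ 2 + (v : ℂ))| ≤ Real.pi - θ) (hv0 : 0 ≤ v) {y : ℝ} (hy : 0 ≤ y) :
    (logDelta (fun k => τ k ^ 2 + (v : ℂ)) y).im = 0 := by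
  have hmem : ∀ y ∈ Set.Ici (0 : ℝ), |arg (y : ℂ)| < θ := fun y hy => by
    rw [arg_ofReal_of_nonneg hy]
    simpa using hθ0
  have hc : ContinuousOn (fun y : ℝ => logDelta (fun k => τ k ^ 2 + (v : ℂ)) y) (Set.Ici 0) :=
    (hτ.continuousOn_logDelta_sector hv hθ).comp continuous_ofReal.continuousOn hmem
  -- For v ≥ 0 the value Ξ(y+v)/Ξ(v) is positive, so the imaginary part takes values in 2πℤ; it is
  -- continuous and vanishes at y = 0.
  set D : ℝ → ℂ := fun y => I * ((logDelta (fun k => τ k ^ 2 + (v : ℂ)) y).im : ℂ)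
  have hDc : ContinuousOn D (Set.Ici 0) :=
    continuousOn_const.mul ((continuous_ofReal.comp continuous_im).comp_continuousOn hc)
  have hDe : ∀ y ∈ Set.Ici (0 : ℝ), exp (D y) = 1 := by
    intro y hy
    set L := logDelta (fun k => τ k ^ 2 + (v : ℂ)) y with hL
    have h1 : exp L = normalizedXi v y := hτ.exp_logDelta_eq hv hθ (hmem y hy)
    obtain ⟨r, hr, hr'⟩ := riemannXiSq_ofReal_pos (u := y + v) (add_nonneg hy hv0)
    obtain ⟨s, hs, hs'⟩ := riemannXiSq_ofReal_pos hv0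
    have h2 : exp L = ((r / s : ℝ) : ℂ) := by
      rw [h1, normalizedXi, ← ofReal_add, hr', hs', ofReal_div]
    have h3 : exp L = exp (L.re : ℂ) * exp (D y) := by
      rw [← exp_add]
      congr 1
      conv_lhs => rw [← re_add_im L]
      simp only [D, ← hL]
      ring
    have h4 : Real.exp L.re = r / s := by
      rw [← norm_exp, h2, norm_real, Real.norm_eq_abs, abs_of_pos (by positivity)]
    rw [← ofReal_exp, h4, h2] at h3
    have h5 : ((r / s : ℝ) : ℂ) ≠ 0 := by exact_mod_cast (div_pos hr hs).ne'
    exact mul_left_cancel₀ h5 (by rw [← h3, mul_one])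
  have h0 : D 0 = 0 := by simp [D, logDelta]
  have := eqOn_of_exp_eq_one isPreconnected_Ici hDc hDe (a := 0) (b := y) (by simp) hy
  rw [h0] at this
  simpa [D] using this.symm

include hτ in
/-- The constant of `exists_logDelta_eq` vanishes for `v = 1 / 4`. -/
theorem logDelta_const_eq_zero (hv4 : -(τ 0 ^ 2).re < ((1 / 4 : ℝ) : ℝ)) {θ : ℝ} (hθ0 : 0 < θ)
    (hθ4 : θ ≤ Real.pi / 4) (hθ : ∀ k, |arg (τ k ^ 2 + ((1 / 4 : ℝ) : ℂ))| ≤ Real.pi - θ) {κ : ℂ}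
    (hκ : ∀ᶠ z in sectorAtInfinity θ, logDelta (fun k => τ k ^ 2 + ((1 / 4 : ℝ) : ℂ)) z =
      xiExponent (xiPoint (1 / 4) z) + κ) (hexp : exp κ * riemannXiSq ((1 / 4 : ℝ) : ℂ) = 1) :
    κ = 0 := by
  -- Ξ((1/2)²) = ξ(1) = 1, hence κ lies in 2πiℤ.
  have h1 : riemannXiSq ((1 / 4 : ℝ) : ℂ) = 1 := by
    have := riemannXiSq_sq (1 / 2)
    norm_num [riemannXi_one] at this
    rw [← this]
    norm_num
  rw [h1, mul_one] at hexp
  have hR := tendsto_ofReal_sectorAtInfinity hθ0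
  have hlim : Tendsto (fun y : ℝ => -(xiRemainder (1 / 4) y).im) atTop (𝓝 0) := by
    have := (continuous_im.tendsto _).comp ((tendsto_xiRemainder (1 / 4) hθ4).comp hR)
    simpa using this.neg
  -- On the positive axis log Δ and the main part are real, so Im κ is minus the imaginary part of a
  -- remainder that tends to 0.
  have him : κ.im = 0 := by
    refine tendsto_nhds_unique (Tendsto.congr' ?_ tendsto_const_nhds) hlim
    filter_upwards [hR.eventually hκ, hR.eventually (xiExponent_xiPoint_eq (1 / 4) hθ4),
      eventually_im_mainPart (1 / 4), eventually_ge_atTop 0] with y e1 e2 e3 hy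
    have e4 := hτ.im_logDelta_ofReal hv4 hθ0 hθ (by norm_num) hy
    rw [e1, e2, add_im, add_im, e3] at e4
    linarith
  obtain ⟨n, hn⟩ := exp_eq_one_iff.1 hexp
  have h2 : κ.im = n * (2 * Real.pi) := by
    rw [hn]
    simp
  rw [him, eq_comm, mul_eq_zero] at h2
  have h3 : (n : ℝ) = 0 := h2.resolve_right Real.two_pi_pos.ne'
  rw [hn, show n = 0 by exact_mod_cast h3]
  simp

include hτ hv in
theorem exists_stirlingExpansion : ∃ θ : ℝ, 0 < θ ∧ θ ≤ Real.pi / 4 ∧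
    (∀ k, |arg (τ k ^ 2 + (v : ℂ))| ≤ Real.pi - θ) ∧ ∃ a' a : ℕ → ℂ,
      HasStirlingExpansion (fun k => τ k ^ 2 + (v : ℂ)) θ (fun n => (1 - (n : ℝ)) / 2) a' a ∧
      a' 0 = 1 / 4 ∧ a 0 = ((-(1 + Real.log (2 * Real.pi)) / 2 : ℝ) : ℂ) ∧
      a' 1 = 7 / 8 ∧ (∀ m : ℕ, 1 ≤ m → a' (2 * m + 1) = 0) ∧
      (v = 1 / 4 → a 1 = ((Real.log (8 * Real.pi) / 4 : ℝ) : ℂ)) := by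
  obtain ⟨θ, hθ0, hθ4, hθ⟩ := hτ.exists_sector hv
  have : Fact (0 < θ) := ⟨hθ0⟩
  obtain ⟨κ, hκ, hexp⟩ := hτ.exists_logDelta_eq hv hθ0 hθ4 hθ
  obtain ⟨a', a, h, h0, h1, h2, h3, h4⟩ := exists_xiExponent_expansion v hθ4 κ
  refine ⟨θ, hθ0, hθ4, hθ, a', a, fun N => ?_, h0, h1, h2, h3, ?_⟩
  · refine (h N).congr' ?_ EventuallyEq.rfl
    filter_upwards [hκ] with z hz
    rw [hz]
  · rintro rfl
    rw [h4, hτ.logDelta_const_eq_zero hv hθ0 hθ4 hθ hκ hexp, add_zero]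

end IsRiemannZeroSequence

/-! ### Admissibility -/

/-- The leading term of a Stirling expansion bounds `logDelta`. -/
theorem HasStirlingExpansion.isLittleO {x : ℕ → ℂ} {θ : ℝ} {μ : ℕ → ℝ} {a' a : ℕ → ℂ}
    (h : HasStirlingExpansion x θ μ a' a) {δ : ℝ} (hδ : 0 < δ) :
    logDelta x =o[sectorAtInfinity θ] fun z : ℂ => ‖z‖ ^ (μ 0 + δ) := by
  have hn := tendsto_norm_sectorAtInfinity θ
  have hpow : (fun z : ℂ => ‖z‖ ^ μ 0) =o[sectorAtInfinity θ] fun z : ℂ => ‖z‖ ^ (μ 0 + δ) :=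
    (isLittleO_rpow_rpow_atTop (by linarith)).comp_tendsto hn
  have hlead : (fun z : ℂ => (a' 0 * log z + a 0) * z ^ (μ 0 : ℂ)) =o[sectorAtInfinity θ]
      fun z : ℂ => ‖z‖ ^ (μ 0 + δ) := by
    have hc : (fun z : ℂ => a' 0 * log z + a 0) =o[sectorAtInfinity θ] fun z : ℂ => ‖z‖ ^ δ := by
      have h1 : (fun x : ℝ => Real.log x) =o[atTop] fun x : ℝ => x ^ δ := isLittleO_log_rpow_atTop hδ
      have h2 : (fun _ : ℝ => (1 : ℝ)) =o[atTop] fun x : ℝ => x ^ δ := by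
        simpa using isLittleO_rpow_rpow_atTop hδ
      have h3 : (fun x : ℝ => |Real.log x| + Real.pi * 1) =o[atTop] fun x : ℝ => x ^ δ :=
        h1.abs_left.add (h2.const_mul_left _)
      refine IsLittleO.add (IsLittleO.const_mul_left ?_ _) ?_
      · refine IsBigO.trans_isLittleO (IsBigO.of_bound 1 (.of_forall fun z => ?_)) (h3.comp_tendsto hn)
        refine (norm_le_abs_re_add_abs_im _).trans ?_
        rw [log_re, log_im, one_mul]
        refine le_trans ?_ (le_abs_self _)
        have := abs_arg_le_pi z
        simp only [Function.comp, mul_one]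
        linarith
      · refine IsBigO.trans_isLittleO (isBigO_const_const _ one_ne_zero _) (h2.comp_tendsto hn)
    refine (hc.mul_isBigO (IsBigO.of_bound 1 ?_)).congr' EventuallyEq.rfl ?_ (g₁ := fun z => ‖z‖ ^ δ * ‖z‖ ^ μ 0)
    · filter_upwards [hn.eventually_gt_atTop 0] with z hz
      rw [norm_cpow_real, Real.norm_eq_abs, one_mul, abs_of_nonneg (by positivity)]
    · filter_upwards [hn.eventually_gt_atTop 0] with z hz
      rw [← Real.rpow_add hz, add_comm]
  have h0 := (h 0).trans hpow
  simp only [zero_add, Finset.range_one, Finset.sum_singleton] at h0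
  simpa using h0.add hlead

theorem IsRiemannZeroSequence.isAdmissible {τ : ℕ → ℂ} (hτ : IsRiemannZeroSequence τ) {v : ℝ}
    (hv : -(τ 0 ^ 2).re < v) : IsAdmissible (fun k => τ k ^ 2 + (v : ℂ)) (1 / 2) := by
  obtain ⟨θ, hθ0, -, hθ, a', a, h, h0, -⟩ := hτ.exists_stirlingExpansion hv
  refine ⟨by norm_num, by norm_num, hτ.ne_zero hv, hτ.tendsto_norm hv, hτ.summable_norm_inv hv,
    fun δ hδ ε hε => hτ.eventually_norm_deltaFn_le hv hδ hε, θ, hθ0, hθ, fun δ hδ => ?_,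
    fun n => (1 - (n : ℝ)) / 2, a', a, by norm_num, fun m n hmn => ?_, ?_, ?_, h⟩
  · simpa using h.isLittleO hδ
  · have : (m : ℝ) < n := by exact_mod_cast hmn
    simp only
    linarith
  · refine Tendsto.atBot_div_const two_pos ?_
    exact tendsto_atBot_add_const_left _ _ (tendsto_neg_atTop_atBot.comp tendsto_natCast_atTop_atTop)
  · left
    rw [h0]
    norm_num

/-! ### Mellin transforms of log(1 + y/x) and of log Δ -/

open MeasureTheory

section SectorBounds

variable {x : ℂ} {θ : ℝ}

/-- With s = sin(θ/2) the cosine of arg x is at least 2s² - 1, so |x+y|² ≥ (|x|-y)² + 4s²|x|y ≥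
s²(|x|+y)². -/
theorem sin_half_mul_le_norm_add_ofReal (hθ0 : 0 ≤ θ) (hθ : θ ≤ Real.pi)
    (hx : |arg x| ≤ Real.pi - θ) {y : ℝ} (hy : 0 ≤ y) :
    Real.sin (θ / 2) * (‖x‖ + y) ≤ ‖x + y‖ := by
  have hs0 : 0 ≤ Real.sin (θ / 2) :=
    Real.sin_nonneg_of_nonneg_of_le_pi (by linarith) (by linarith)
  refine abs_le_of_sq_le_sq' ?_ (norm_nonneg _) |>.2
  have hcos : -Real.cos θ ≤ Real.cos (arg x) := by
    rw [← Real.cos_pi_sub, ← Real.cos_abs (arg x)]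
    exact Real.cos_le_cos_of_nonneg_of_le_pi (abs_nonneg _) (by linarith) hx
  have hre : x.re = ‖x‖ * Real.cos (arg x) := (norm_mul_cos_arg x).symm
  have h1 : ‖x + y‖ ^ 2 = ‖x‖ ^ 2 + y ^ 2 + 2 * y * x.re := by
    rw [Complex.sq_norm, Complex.sq_norm, normSq_apply, normSq_apply]
    simp only [add_re, ofReal_re, add_im, ofReal_im]
    ring
  have h2 : Real.cos θ = 1 - 2 * Real.sin (θ / 2) ^ 2 := by
    have h := Real.cos_two_mul (θ / 2)
    rw [mul_div_cancel₀ _ (two_ne_zero' ℝ)] at h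
    have := Real.sin_sq_add_cos_sq (θ / 2)
    linarith
  rw [h1, hre, mul_pow]
  rw [h2] at hcos
  have h3 : 0 ≤ y * ‖x‖ * (Real.cos (arg x) + (1 - 2 * Real.sin (θ / 2) ^ 2)) := by
    apply mul_nonneg (by positivity)
    linarith
  have h4 : 0 ≤ (1 - Real.sin (θ / 2) ^ 2) * (‖x‖ - y) ^ 2 := by
    apply mul_nonneg _ (sq_nonneg _)
    linarith [Real.sin_sq_le_one (θ / 2)]
  nlinarith

theorem one_add_ofReal_div_mem_slitPlane (hx : x ∈ slitPlane) {y : ℝ} (hy : 0 ≤ y) :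
    1 + (y : ℂ) / x ∈ slitPlane := by
  refine one_add_div_mem_slitPlane (slitPlane_ne_zero hx) (θ := Real.pi - |arg x|) ?_ (by linarith)
  rw [arg_ofReal_of_nonneg hy, abs_zero]
  linarith [abs_arg_lt_pi_of_mem_slitPlane hx]

theorem continuousOn_log_one_add_div (hx : x ∈ slitPlane) :
    ContinuousOn (fun y : ℝ => log (1 + (y : ℂ) / x)) (Set.Ici 0) :=
  ContinuousOn.clog (by fun_prop) fun _ hy => one_add_ofReal_div_mem_slitPlane hx hy

/-- In y the two sides have derivatives 1/(x+y) and a multiple of 1/(|x|+y), which the preceding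
inequality compares; both sides vanish at y = 0. -/
theorem norm_log_one_add_div_le (hx0 : x ≠ 0) (hθ0 : 0 < θ) (hθ : θ ≤ Real.pi)
    (hx : |arg x| ≤ Real.pi - θ) {y : ℝ} (hy : 0 ≤ y) :
    ‖log (1 + (y : ℂ) / x)‖ ≤ (Real.sin (θ / 2))⁻¹ * Real.log (1 + y / ‖x‖) := by
  have hn := norm_pos_iff.2 hx0
  have hs0 : 0 < Real.sin (θ / 2) :=
    Real.sin_pos_of_pos_of_lt_pi (by linarith) (by linarith [Real.pi_pos])
  have hsl : x ∈ slitPlane := mem_slitPlane_of_abs_arg_lt hx0 (by linarith)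
  have hpos : ∀ u ∈ Set.Ici (0 : ℝ), 1 + u / ‖x‖ ≠ 0 := fun u hu => by
    have : 0 ≤ u / ‖x‖ := div_nonneg hu hn.le
    linarith
  refine image_norm_le_of_norm_deriv_right_le_deriv_boundary' (a := 0) (b := y)
    (f := fun y : ℝ => log (1 + (y : ℂ) / x)) (f' := fun u : ℝ => (x + u)⁻¹)
    (B := fun y => (Real.sin (θ / 2))⁻¹ * Real.log (1 + y / ‖x‖))
    (B' := fun u => (Real.sin (θ / 2))⁻¹ * (‖x‖ + u)⁻¹)
    ((continuousOn_log_one_add_div hsl).mono Set.Icc_subset_Ici_self) ?_ (by simp) ?_ ?_ ?_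
    ⟨hy, le_rfl⟩
  · intro u hu
    have h1 := one_add_ofReal_div_mem_slitPlane hsl hu.1
    have h2 : HasDerivAt (fun u : ℂ => 1 + u / x) (1 / x) (u : ℂ) :=
      ((hasDerivAt_id _).div_const x).const_add 1
    have h3 := (h2.clog h1).comp_ofReal
    convert! h3.hasDerivWithinAt using 1
    have h4 := slitPlane_ne_zero h1
    have h5 : x + u = x * (1 + u / x) := by field_simp
    rw [h5]
    field_simp
  · exact continuousOn_const.mul (ContinuousOn.log (by fun_prop) fun u hu => hpos u hu.1)
  · intro u hu
    have h2 : HasDerivAt (fun u : ℝ => 1 + u / ‖x‖) (1 / ‖x‖) u :=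
      ((hasDerivAt_id _).div_const ‖x‖).const_add 1
    have h3 := (h2.log (hpos u hu.1)).const_mul (Real.sin (θ / 2))⁻¹
    convert! h3.hasDerivWithinAt using 2
    have h4 := hpos u hu.1
    have h5 : ‖x‖ + u = ‖x‖ * (1 + u / ‖x‖) := by field_simp
    rw [h5]
    field_simp
  · intro u hu
    have hu0 : 0 ≤ u := hu.1
    rw [norm_inv, ← mul_inv]
    exact inv_anti₀ (by positivity) (sin_half_mul_le_norm_add_ofReal hθ0.le hθ hx hu0)

end SectorBounds

theorem log_one_add_isBigO_rpow {ε : ℝ} (hε : 0 < ε) :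
    (fun y : ℝ => Real.log (1 + y)) =O[atTop] fun y => y ^ ε := by
  refine IsBigO.of_bound (2 ^ ε / ε) ?_
  filter_upwards [eventually_ge_atTop 1] with y hy
  rw [Real.norm_eq_abs, Real.norm_eq_abs, abs_of_nonneg (Real.log_nonneg (by linarith)),
    abs_of_nonneg (by positivity)]
  calc Real.log (1 + y) ≤ (1 + y) ^ ε / ε := Real.log_le_rpow_div (by linarith) hε
    _ ≤ (2 * y) ^ ε / ε := by gcongr; linarith
    _ = 2 ^ ε / ε * y ^ ε := by
      rw [Real.mul_rpow (by norm_num) (by linarith)]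
      ring

theorem log_one_add_isBigO_nhds_zero :
    (fun y : ℝ => Real.log (1 + y)) =O[𝓝[>] 0] fun y => y := by
  refine IsBigO.of_bound 1 ?_
  filter_upwards [self_mem_nhdsWithin] with y hy
  have hy0 : (0 : ℝ) < y := hy
  rw [Real.norm_eq_abs, Real.norm_eq_abs, abs_of_nonneg (Real.log_nonneg (by linarith)),
    abs_of_pos hy0]
  linarith [Real.log_le_sub_one_of_pos (show (0 : ℝ) < 1 + y by linarith)]

section MellinLog

variable {σ : ℂ}

theorem mellinConvergent_log_one_add (h0 : 0 < σ.re) (h1 : σ.re < 1) :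
    MellinConvergent (fun y : ℝ => ((Real.log (1 + y) : ℝ) : ℂ)) (-σ) := by
  refine mellinConvergent_of_isBigO_rpow (a := -(σ.re / 2)) (b := -1) ?_ ?_ ?_ ?_ ?_
  · refine ContinuousOn.locallyIntegrableOn ?_ measurableSet_Ioi
    refine continuous_ofReal.comp_continuousOn (ContinuousOn.log (by fun_prop) fun y hy => ?_)
    have : (0 : ℝ) < y := hy
    positivity
  · rw [neg_neg]
    exact (isBigO_norm_left.1 (by simpa using (log_one_add_isBigO_rpow (half_pos h0)).norm_left))
  · rw [neg_re]
    linarith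
  · rw [neg_neg]
    simp only [Real.rpow_one]
    exact (isBigO_norm_left.1 (by simpa using log_one_add_isBigO_nhds_zero.norm_left))
  · rw [neg_re]
    linarith

theorem mellinConvergent_inv_one_add (h0 : 0 < σ.re) (h1 : σ.re < 1) :
    MellinConvergent (fun y : ℝ => (1 + (y : ℂ))⁻¹) (1 - σ) := by
  have hpos : ∀ y ∈ Set.Ioi (0 : ℝ), 1 + (y : ℂ) ≠ 0 := fun y hy => by
    have : (0 : ℝ) < y := hy
    exact_mod_cast (show (1 : ℝ) + y ≠ 0 by linarith)
  have hnorm : ∀ y : ℝ, 0 < y → ‖(1 + (y : ℂ))⁻¹‖ = (1 + y)⁻¹ := fun y hy => by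
    rw [norm_inv, ← ofReal_one, ← ofReal_add, norm_real, Real.norm_eq_abs, abs_of_pos (by linarith)]
  refine mellinConvergent_of_isBigO_rpow (a := 1) (b := 0) ?_ ?_ ?_ ?_ ?_
  · exact ContinuousOn.locallyIntegrableOn (ContinuousOn.inv₀ (by fun_prop) hpos) measurableSet_Ioi
  · refine IsBigO.of_bound 1 ?_
    filter_upwards [eventually_gt_atTop 0] with y hy
    rw [hnorm y hy, Real.rpow_neg_one, Real.norm_eq_abs, abs_of_pos (by positivity), one_mul]
    exact inv_anti₀ hy (by linarith)
  · rw [sub_re, one_re]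
    linarith
  · refine IsBigO.of_bound 1 ?_
    filter_upwards [self_mem_nhdsWithin] with y hy
    have hy0 : (0 : ℝ) < y := hy
    rw [hnorm y hy, neg_zero, Real.rpow_zero, norm_one, mul_one]
    exact inv_le_one_of_one_le₀ (by linarith)
  · rw [sub_re, one_re]
    linarith

/-- The substitution u = y/(1+y) turns the beta integral B(1-σ, σ) = Γ(1-σ)Γ(σ) into this Mellin
transform, and the reflection formula evaluates it. -/
theorem mellin_inv_one_add (h0 : 0 < σ.re) (h1 : σ.re < 1) :
    mellin (fun y : ℝ => (1 + (y : ℂ))⁻¹) (1 - σ) = Real.pi / sin (Real.pi * σ) := by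
  have h1σ : 0 < (1 - σ).re := by
    rw [sub_re, one_re]
    linarith
  have hbeta := Gamma_mul_Gamma_eq_betaIntegral h1σ h0
  rw [sub_add_cancel, Gamma_one, one_mul, mul_comm, Gamma_mul_Gamma_one_sub] at hbeta
  rw [hbeta, betaIntegral, intervalIntegral.integral_of_le zero_le_one,
    ← integral_Ioc_eq_integral_Ioo.symm]
  have himg : Set.Ioo (0 : ℝ) 1 = (fun y : ℝ => y / (1 + y)) '' Set.Ioi 0 := by
    ext u
    simp only [Set.mem_Ioo, Set.mem_image, Set.mem_Ioi]
    constructor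
    · rintro ⟨hu0, hu1⟩
      have : 0 < 1 - u := by linarith
      refine ⟨u / (1 - u), by positivity, ?_⟩
      field_simp
      ring
    · rintro ⟨y, hy, rfl⟩
      refine ⟨by positivity, ?_⟩
      rw [div_lt_one (by positivity)]
      linarith
  rw [himg, integral_image_eq_integral_abs_deriv_smul (f' := fun y => ((1 + y) ^ 2)⁻¹)
    measurableSet_Ioi, mellin]
  · refine setIntegral_congr_fun measurableSet_Ioi fun y hy => ?_
    have hy0 : (0 : ℝ) < y := hy
    have hy1 : 0 < 1 + y := by linarith
    have hc : (1 : ℂ) + y ≠ 0 := by exact_mod_cast hy1.ne'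
    have e1 : ((y / (1 + y) : ℝ) : ℂ) = (y : ℂ) * (((1 + y)⁻¹ : ℝ) : ℂ) := by
      push_cast
      rw [div_eq_mul_inv]
    have e2 : (1 : ℂ) - ((y / (1 + y) : ℝ) : ℂ) = (((1 + y)⁻¹ : ℝ) : ℂ) := by
      push_cast
      field_simp
      ring
    have hi : (((1 + y)⁻¹ : ℝ) : ℂ) ≠ 0 := by exact_mod_cast (inv_pos.2 hy1).ne'
    rw [e2, e1, mul_cpow_ofReal_nonneg hy0.le (by positivity), mul_assoc, ← cpow_add _ _ hi,
      abs_of_pos (by positivity), real_smul, show 1 - σ - 1 + (σ - 1) = -1 by ring, cpow_neg_one,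
      smul_eq_mul]
    push_cast
    field_simp
  · intro y hy
    have hy0 : (0 : ℝ) < y := hy
    have hy1 : 1 + y ≠ 0 := by linarith
    have := (hasDerivAt_id y).div ((hasDerivAt_id y).const_add 1) hy1
    convert! this.hasDerivWithinAt using 1
    simp only [id]
    field_simp
    ring
  · intro y hy w hw h
    have hy0 : (0 : ℝ) < y := hy
    have hw0 : (0 : ℝ) < w := hw
    have hy1 : 1 + y ≠ 0 := by linarith
    have hw1 : 1 + w ≠ 0 := by linarith
    have h' : y / (1 + y) = w / (1 + w) := h
    field_simp at h'
    linarith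

/-- Integration by parts against y^(-σ) reduces to the transform of 1/(1+y); the condition 0 < Re σ
< 1 kills the boundary terms at ∞ and at 0. -/
theorem mellin_log_one_add (h0 : 0 < σ.re) (h1 : σ.re < 1) :
    mellin (fun y : ℝ => ((Real.log (1 + y) : ℝ) : ℂ)) (-σ) =
      Real.pi / (σ * sin (Real.pi * σ)) := by
  have hσ : σ ≠ 0 := by
    rintro rfl
    simp at h0
  have hlim : ∀ l : Filter ℝ, (∀ᶠ y in l, 0 < y) → Tendsto (fun y => Real.log (1 + y) * y ^ (-σ.re)) l (𝓝 0) →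
      Tendsto ((fun y : ℝ => ((Real.log (1 + y) : ℝ) : ℂ)) * fun y : ℝ => (y : ℂ) ^ (-σ)) l (𝓝 0) := by
    intro l hl h
    rw [tendsto_zero_iff_norm_tendsto_zero] at h ⊢
    refine h.congr' ?_
    filter_upwards [hl] with y hy
    rw [Pi.mul_apply, norm_mul, norm_mul, norm_real, norm_cpow_eq_rpow_re_of_pos hy, neg_re,
      Real.norm_eq_abs (y ^ _), abs_of_nonneg (by positivity)]
  have hparts := integral_Ioi_mul_deriv_eq_deriv_mul (a := 0) (a' := 0) (b' := 0)
    (u := fun y : ℝ => ((Real.log (1 + y) : ℝ) : ℂ)) (u' := fun y : ℝ => (1 + (y : ℂ))⁻¹)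
    (v := fun y : ℝ => (y : ℂ) ^ (-σ)) (v' := fun y : ℝ => -σ * (y : ℂ) ^ (-σ - 1)) ?_ ?_ ?_ ?_ ?_ ?_
  · rw [mellin]
    have e1 : ∀ y : ℝ, ((Real.log (1 + y) : ℝ) : ℂ) * (-σ * (y : ℂ) ^ (-σ - 1)) =
        -σ * ((y : ℂ) ^ (-σ - 1) • ((Real.log (1 + y) : ℝ) : ℂ)) := fun y => by
      rw [smul_eq_mul]
      ring
    have e2 : ∀ y : ℝ, (1 + (y : ℂ))⁻¹ * (y : ℂ) ^ (-σ) =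
        (y : ℂ) ^ (1 - σ - 1) • (1 + (y : ℂ))⁻¹ := fun y => by
      rw [smul_eq_mul, mul_comm]
      ring_nf
    simp only [e1, e2] at hparts
    rw [integral_const_mul] at hparts
    have e3 := mellin_inv_one_add h0 h1
    rw [mellin] at e3
    rw [e3] at hparts
    have hsin : sin (Real.pi * σ) ≠ 0 := by
      intro h
      have h2 := mellin_inv_one_add h0 h1
      obtain ⟨k, hk⟩ := Complex.sin_eq_zero_iff.1 h
      have hpi : (Real.pi : ℂ) ≠ 0 := by exact_mod_cast Real.pi_ne_zero
      have h3 : σ = k := by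
        apply mul_left_cancel₀ hpi
        rw [hk, mul_comm]
      rw [h3] at h0 h1
      simp only [intCast_re] at h0 h1
      have h4 : (0 : ℤ) < k := by exact_mod_cast h0
      have h5 : k < (1 : ℤ) := by exact_mod_cast h1
      omega
    field_simp at hparts ⊢
    linear_combination -hparts
  · intro y hy
    have hy0 : (0 : ℝ) < y := hy
    have h2 := (((hasDerivAt_id y).const_add 1).log (by simp only [id]; linarith)).ofReal_comp
    convert! h2 using 1
    simp
  · intro y hy
    have hy0 : (y : ℝ) ≠ 0 := ne_of_gt hy
    exact hasDerivAt_ofReal_cpow_const hy0 (neg_ne_zero.2 hσ) |>.congr_deriv (by ring)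
  · refine (MellinConvergent.const_smul (mellinConvergent_log_one_add h0 h1) (-σ)).congr_fun (fun y _ => ?_) measurableSet_Ioi
    simp only [Pi.mul_apply, smul_eq_mul]
    ring
  · refine (mellinConvergent_inv_one_add h0 h1).congr_fun (fun y _ => ?_) measurableSet_Ioi
    simp only [Pi.mul_apply, smul_eq_mul]
    rw [mul_comm]
    ring_nf
  · refine hlim _ self_mem_nhdsWithin ?_
    have h2 : Tendsto (fun y : ℝ => y ^ (1 - σ.re)) (𝓝[>] 0) (𝓝 0) := by
      have := (Real.continuousAt_rpow_const 0 (1 - σ.re) (Or.inr (by linarith))).tendsto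
      rw [Real.zero_rpow (by linarith)] at this
      exact this.mono_left nhdsWithin_le_nhds
    have h3 := (log_one_add_isBigO_nhds_zero.mul (isBigO_refl (fun y : ℝ => y ^ (-σ.re)) _))
    refine (h3.congr' EventuallyEq.rfl ?_).trans_tendsto h2
    filter_upwards [self_mem_nhdsWithin] with y hy
    have hy0 : (0 : ℝ) < y := hy
    rw [sub_eq_add_neg, Real.rpow_add hy0, Real.rpow_one]
  · refine hlim _ (eventually_gt_atTop 0) ?_
    have h2 : Tendsto (fun y : ℝ => y ^ (-(σ.re / 2))) atTop (𝓝 0) :=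
      tendsto_rpow_neg_atTop (by linarith)
    have h3 := ((log_one_add_isBigO_rpow (half_pos h0)).mul (isBigO_refl (fun y : ℝ => y ^ (-σ.re)) _))
    refine (h3.congr' EventuallyEq.rfl ?_).trans_tendsto h2
    filter_upwards [eventually_gt_atTop 0] with y hy0
    rw [← Real.rpow_add hy0]
    congr 1
    ring

end MellinLog

open MeasureTheory

section MellinLog

variable {σ : ℂ}

theorem mellinConvergent_log_one_add_div (h0 : 0 < σ.re) (h1 : σ.re < 1) {a : ℝ} (ha : 0 < a) :
    MellinConvergent (fun y : ℝ => ((Real.log (1 + y / a) : ℝ) : ℂ)) (-σ) := by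
  have := (MellinConvergent.comp_mul_left (inv_pos.2 ha)).2 (mellinConvergent_log_one_add h0 h1)
  simpa only [div_eq_inv_mul] using this

theorem mellin_log_one_add_div_ofReal (h0 : 0 < σ.re) (h1 : σ.re < 1) {a : ℝ} (ha : 0 < a) :
    mellin (fun y : ℝ => log (1 + (y : ℂ) / a)) (-σ) =
      (a : ℂ) ^ (-σ) * (Real.pi / (σ * sin (Real.pi * σ))) := by
  have h := mellin_comp_mul_left (fun y : ℝ => ((Real.log (1 + y) : ℝ) : ℂ)) (-σ) (inv_pos.2 ha)
  rw [mellin_log_one_add h0 h1, neg_neg, ofReal_inv, inv_cpow _ _ ?_, ← cpow_neg, smul_eq_mul] at h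
  · rw [← h]
    refine setIntegral_congr_fun measurableSet_Ioi fun y hy => ?_
    have hy0 : (0 : ℝ) < y := hy
    simp only
    rw [ofReal_log (by positivity)]
    push_cast
    rw [div_eq_inv_mul]
  · rw [arg_ofReal_of_nonneg ha.le]
    exact Real.pi_ne_zero.symm

/-- Scaling in y. With a = |x_k| this produces the majorant |x_k|^(-Re σ) that justifies
interchanging sum and integral. -/
theorem integral_norm_log_one_add_div {a : ℝ} (ha : 0 < a) :
    ∫ y in Set.Ioi (0 : ℝ), ‖(y : ℂ) ^ (-σ - 1) • ((Real.log (1 + y / a) : ℝ) : ℂ)‖ =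
      a ^ (-σ.re) * ∫ y in Set.Ioi (0 : ℝ), ‖(y : ℂ) ^ (-σ - 1) • ((Real.log (1 + y) : ℝ) : ℂ)‖ := by
  have h := integral_comp_mul_left_Ioi
    (fun y : ℝ => ‖(y : ℂ) ^ (-σ - 1) • ((Real.log (1 + y) : ℝ) : ℂ)‖) 0 (inv_pos.2 ha)
  rw [mul_zero, inv_inv, smul_eq_mul] at h
  have h2 : a ^ (-σ.re) = a ^ (-σ.re - 1) * a := by
    rw [Real.rpow_sub_one ha.ne']
    field_simp
  rw [h2, mul_assoc, ← h, ← integral_const_mul]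
  refine setIntegral_congr_fun measurableSet_Ioi fun y hy => ?_
  have hy0 : (0 : ℝ) < y := hy
  simp only [norm_smul]
  rw [norm_cpow_eq_rpow_re_of_pos hy0, norm_cpow_eq_rpow_re_of_pos (by positivity), ← mul_assoc]
  have h3 : (-σ - 1).re = -σ.re - 1 := by simp
  rw [h3, ← Real.mul_rpow ha.le (by positivity), mul_inv_cancel_left₀ ha.ne', div_eq_inv_mul]

theorem norm_cpow_smul_log_le {x : ℂ} {θ : ℝ} (hx0 : x ≠ 0) (hθ0 : 0 < θ) (hθ : θ ≤ Real.pi)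
    (hx : |arg x| ≤ Real.pi - θ) (c : ℂ) {y : ℝ} (hy : 0 ≤ y) :
    ‖c • log (1 + (y : ℂ) / x)‖ ≤
      (Real.sin (θ / 2))⁻¹ * ‖c • ((Real.log (1 + y / ‖x‖) : ℝ) : ℂ)‖ := by
  have h1 : 0 ≤ Real.log (1 + y / ‖x‖) :=
    Real.log_nonneg (by linarith [div_nonneg hy (norm_nonneg x)])
  rw [norm_smul, norm_smul, norm_real, Real.norm_eq_abs, abs_of_nonneg h1, mul_left_comm]
  exact mul_le_mul_of_nonneg_left (norm_log_one_add_div_le hx0 hθ0 hθ hx hy) (norm_nonneg _)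

theorem aestronglyMeasurable_cpow_smul_log {x : ℂ} (hx : x ∈ slitPlane) (s : ℂ) :
    AEStronglyMeasurable (fun y : ℝ => (y : ℂ) ^ s • log (1 + (y : ℂ) / x))
      (volume.restrict (Set.Ioi 0)) := by
  refine ContinuousOn.aestronglyMeasurable (ContinuousOn.fun_smul (fun y hy => ?_)
    ((continuousOn_log_one_add_div hx).mono Set.Ioi_subset_Ici_self)) measurableSet_Ioi
  exact (continuousAt_ofReal_cpow_const _ _ (Or.inr (ne_of_gt hy))).continuousWithinAt

theorem mellinConvergent_log_one_add_div_of_slitPlane (h0 : 0 < σ.re) (h1 : σ.re < 1) {x : ℂ}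
    (hx : x ∈ slitPlane) : MellinConvergent (fun y : ℝ => log (1 + (y : ℂ) / x)) (-σ) := by
  have hx0 := slitPlane_ne_zero hx
  have harg := abs_arg_lt_pi_of_mem_slitPlane hx
  refine Integrable.mono' (Integrable.const_mul
    (mellinConvergent_log_one_add_div h0 h1 (norm_pos_iff.2 hx0)).norm
    (Real.sin ((Real.pi - |arg x|) / 2))⁻¹) (aestronglyMeasurable_cpow_smul_log hx _) ?_
  refine (ae_restrict_mem measurableSet_Ioi).mono fun y hy => ?_
  exact norm_cpow_smul_log_le hx0 (by linarith) (by linarith [abs_nonneg (arg x)]) (by linarith) _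
    (le_of_lt hy)

/-- Differentiation under the integral near a point of the slit plane, dominated through y/(r+y) ≤
log(1+y/r). Holomorphy in x is needed to leave the positive axis. -/
theorem differentiableAt_mellin_log (h0 : 0 < σ.re) (h1 : σ.re < 1) {x₀ : ℂ}
    (hx₀ : x₀ ∈ slitPlane) :
    DifferentiableAt ℂ (fun x => mellin (fun y : ℝ => log (1 + (y : ℂ) / x)) (-σ)) x₀ := by
  have hx0 := slitPlane_ne_zero hx₀
  have hn0 := norm_pos_iff.2 hx0
  have harg := abs_arg_lt_pi_of_mem_slitPlane hx₀
  set θ : ℝ := (Real.pi - |arg x₀|) / 2 with hθ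
  have hθ0 : 0 < θ := by linarith
  have hθpi : θ ≤ Real.pi := by linarith [abs_nonneg (arg x₀), Real.pi_pos]
  set r : ℝ := ‖x₀‖ / 2 with hr
  have hr0 : 0 < r := by positivity
  have hc0 : 0 < Real.sin (θ / 2) := Real.sin_pos_of_pos_of_lt_pi (by linarith) (by linarith)
  set s : Set ℂ := {x | |arg x| < Real.pi - θ} ∩ {x | r < ‖x‖} with hs
  have hsn : s ∈ 𝓝 x₀ := by
    refine inter_mem ?_ ?_
    · exact (continuousAt_arg hx₀).abs.eventually (eventually_lt_nhds (by linarith))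
    · exact continuous_norm.continuousAt.eventually (eventually_gt_nhds (by linarith))
  have hsl : ∀ x ∈ s, x ∈ slitPlane := fun x hx =>
    mem_slitPlane_of_abs_arg_lt (norm_pos_iff.1 (hr0.trans hx.2)) (hx.1.trans (by linarith))
  refine (hasDerivAt_integral_of_dominated_loc_of_deriv_le (s := s)
    (μ := volume.restrict (Set.Ioi (0 : ℝ)))
    (F := fun x y => (y : ℂ) ^ (-σ - 1) • log (1 + (y : ℂ) / x))
    (F' := fun x y => (y : ℂ) ^ (-σ - 1) • (-(y : ℂ) / (x * (x + y))))
    (bound := fun y => (r * Real.sin (θ / 2))⁻¹ *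
      ‖(y : ℂ) ^ (-σ - 1) • ((Real.log (1 + y / r) : ℝ) : ℂ)‖)
    hsn ?_ ?_ ?_ ?_ ?_ ?_).2.differentiableAt
  · filter_upwards [isOpen_slitPlane.mem_nhds hx₀] with x hx
    exact aestronglyMeasurable_cpow_smul_log hx _
  · exact mellinConvergent_log_one_add_div_of_slitPlane h0 h1 hx₀
  · refine ContinuousOn.aestronglyMeasurable (ContinuousOn.fun_smul (fun y hy => ?_) ?_)
      measurableSet_Ioi
    · exact (continuousAt_ofReal_cpow_const _ _ (Or.inr (ne_of_gt hy))).continuousWithinAt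
    · refine ContinuousOn.div (by fun_prop) (by fun_prop) fun y hy => ?_
      have hy0 : (0 : ℝ) < y := hy
      have h2 := slitPlane_ne_zero (one_add_ofReal_div_mem_slitPlane hx₀ hy0.le)
      have h3 : x₀ + y = x₀ * (1 + y / x₀) := by field_simp
      rw [h3]
      exact mul_ne_zero hx0 (mul_ne_zero hx0 h2)
  · refine (ae_restrict_mem measurableSet_Ioi).mono fun y hy x hx => ?_
    have hy0 : (0 : ℝ) < y := hy
    have hxr : r < ‖x‖ := hx.2
    have h2 := sin_half_mul_le_norm_add_ofReal hθ0.le hθpi hx.1.le hy0.le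
    have h3 : y / (r + y) ≤ Real.log (1 + y / r) := by
      have := Real.one_sub_inv_le_log_of_pos (show 0 < 1 + y / r by positivity)
      refine le_trans (le_of_eq ?_) this
      field_simp
      ring
    have h4 : 0 ≤ Real.log (1 + y / r) := le_trans (by positivity) h3
    rw [norm_smul, norm_smul, norm_real, Real.norm_eq_abs, abs_of_nonneg h4, mul_left_comm]
    refine mul_le_mul_of_nonneg_left ?_ (norm_nonneg _)
    rw [norm_div, norm_neg, norm_real, Real.norm_eq_abs, abs_of_pos hy0, norm_mul]
    calc y / (‖x‖ * ‖x + y‖) ≤ y / (r * (Real.sin (θ / 2) * (r + y))) := by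
          gcongr
          exact le_trans (by gcongr) h2
      _ = (r * Real.sin (θ / 2))⁻¹ * (y / (r + y)) := by field_simp
      _ ≤ (r * Real.sin (θ / 2))⁻¹ * Real.log (1 + y / r) := by gcongr
  · exact (mellinConvergent_log_one_add_div h0 h1 hr0).norm.const_mul _
  · refine (ae_restrict_mem measurableSet_Ioi).mono fun y hy x hx => ?_
    have hy0 : (0 : ℝ) < y := hy
    have hxs := hsl x hx
    have hxne := slitPlane_ne_zero hxs
    have h2 := one_add_ofReal_div_mem_slitPlane hxs hy0.le
    have h3 : HasDerivAt (fun x : ℂ => 1 + (y : ℂ) / x) (y * -(x ^ 2)⁻¹) x := by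
      simpa [div_eq_mul_inv] using ((hasDerivAt_inv hxne).const_mul (y : ℂ)).const_add 1
    have h4 := (h3.clog h2).const_smul ((y : ℂ) ^ (-σ - 1))
    convert! h4 using 2
    have h5 := slitPlane_ne_zero h2
    have h6 : x + y = x * (1 + y / x) := by field_simp
    rw [h6]
    field_simp

/-- Both sides are holomorphic in x on the connected slit plane and agree for positive x, in
particular at the points (n+2)/(n+1) accumulating at 1. -/
theorem mellin_log_one_add_div (h0 : 0 < σ.re) (h1 : σ.re < 1) {x : ℂ} (hx : x ∈ slitPlane) :
    mellin (fun y : ℝ => log (1 + (y : ℂ) / x)) (-σ) =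
      x ^ (-σ) * (Real.pi / (σ * sin (Real.pi * σ))) := by
  have hf : AnalyticOnNhd ℂ (fun x => mellin (fun y : ℝ => log (1 + (y : ℂ) / x)) (-σ)) slitPlane :=
    DifferentiableOn.analyticOnNhd
      (fun x hx => (differentiableAt_mellin_log h0 h1 hx).differentiableWithinAt) isOpen_slitPlane
  have hg : AnalyticOnNhd ℂ (fun x => x ^ (-σ) * (Real.pi / (σ * sin (Real.pi * σ)))) slitPlane :=
    fun x hx => (analyticAt_id.cpow analyticAt_const hx).mul analyticAt_const
  refine hf.eqOn_of_preconnected_of_frequently_eq hg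
    ((starConvex_one_slitPlane.isPathConnected one_mem_slitPlane).isConnected.isPreconnected)
    one_mem_slitPlane ?_ hx
  have ht : Tendsto (fun n : ℕ => (((n : ℝ) + 2) / (n + 1) : ℝ)) atTop (𝓝 1) := by
    have := tendsto_one_div_add_atTop_nhds_zero_nat (𝕜 := ℝ)
    have h2 := this.const_add 1
    rw [add_zero] at h2
    refine h2.congr fun n => ?_
    field_simp
    ring
  have ht2 : Tendsto (fun n : ℕ => ((((n : ℝ) + 2) / (n + 1) : ℝ) : ℂ)) atTop (𝓝[≠] 1) := by
    refine tendsto_nhdsWithin_iff.2 ⟨?_, .of_forall fun n => ?_⟩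
    · exact_mod_cast (continuous_ofReal.tendsto 1).comp ht
    · have : ((n : ℝ) + 2) / (n + 1) ≠ 1 := by
        rw [Ne, div_eq_one_iff_eq (by positivity)]
        intro h
        linarith
      simpa only [Set.mem_compl_iff, Set.mem_singleton_iff] using! by exact_mod_cast this
  exact ht2.frequently (Frequently.of_forall fun n =>
    mellin_log_one_add_div_ofReal h0 h1 (by positivity))

/-- The Mellin transform of `logDelta` is a multiple of the Dirichlet series of the sequence. -/
theorem hasSum_mellin_logDelta (h0 : 0 < σ.re) (h1 : σ.re < 1) {x : ℕ → ℂ} {θ : ℝ}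
    (hx0 : ∀ k, x k ≠ 0) (hθ0 : 0 < θ) (hθ : θ ≤ Real.pi) (hx : ∀ k, |arg (x k)| ≤ Real.pi - θ)
    (hs : Summable fun k => ‖x k‖ ^ (-σ.re)) :
    HasSum (fun k => x k ^ (-σ) * (Real.pi / (σ * sin (Real.pi * σ))))
      (mellin (fun y : ℝ => logDelta x y) (-σ)) := by
  have hsl : ∀ k, x k ∈ slitPlane := fun k =>
    mem_slitPlane_of_abs_arg_lt (hx0 k) (by linarith [hx k])
  have h := hasSum_integral_of_summable_integral_norm (μ := volume.restrict (Set.Ioi (0 : ℝ)))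
    (F := fun k y => (y : ℂ) ^ (-σ - 1) • log (1 + (y : ℂ) / x k))
    (fun k => mellinConvergent_log_one_add_div_of_slitPlane h0 h1 (hsl k)) ?_
  · have e1 : ∀ k, ∫ y in Set.Ioi (0 : ℝ), (y : ℂ) ^ (-σ - 1) • log (1 + (y : ℂ) / x k) =
        x k ^ (-σ) * (Real.pi / (σ * sin (Real.pi * σ))) := fun k =>
      mellin_log_one_add_div h0 h1 (hsl k)
    simp only [e1] at h
    convert! h using 1
    rw [mellin]
    congr 1
    funext y
    rw [logDelta]
    simp only [smul_eq_mul]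
    rw [tsum_mul_left]
  · refine Summable.of_nonneg_of_le (fun k => integral_nonneg fun y => norm_nonneg _) (fun k => ?_)
      ((hs.mul_right (∫ y in Set.Ioi (0 : ℝ),
        ‖(y : ℂ) ^ (-σ - 1) • ((Real.log (1 + y) : ℝ) : ℂ)‖)).mul_left (Real.sin (θ / 2))⁻¹)
    rw [← integral_norm_log_one_add_div (norm_pos_iff.2 (hx0 k)), ← integral_const_mul]
    refine setIntegral_mono_on
      (mellinConvergent_log_one_add_div_of_slitPlane h0 h1 (hsl k)).norm
      ((mellinConvergent_log_one_add_div h0 h1 (norm_pos_iff.2 (hx0 k))).norm.const_mul _)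
      measurableSet_Ioi fun y hy => ?_
    exact norm_cpow_smul_log_le (hx0 k) hθ0 hθ (hx k) _ (le_of_lt hy)

/-- Near the origin `logDelta` is bounded by a multiple of its argument. -/
theorem logDelta_isBigO_nhds_zero {x : ℕ → ℂ} {θ : ℝ} (hx0 : ∀ k, x k ≠ 0) (hθ0 : 0 < θ)
    (hθ : θ ≤ Real.pi) (hx : ∀ k, |arg (x k)| ≤ Real.pi - θ) (hs : Summable fun k => ‖x k‖⁻¹) :
    (fun y : ℝ => logDelta x y) =O[𝓝[>] 0] fun y => y := by
  refine IsBigO.of_bound ((Real.sin (θ / 2))⁻¹ * ∑' k, ‖x k‖⁻¹) ?_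
  filter_upwards [self_mem_nhdsWithin] with y hy
  have hy0 : (0 : ℝ) < y := hy
  have hc0 : 0 < Real.sin (θ / 2) :=
    Real.sin_pos_of_pos_of_lt_pi (by linarith) (by linarith [Real.pi_pos])
  have hb : ∀ k, ‖log (1 + (y : ℂ) / x k)‖ ≤ (Real.sin (θ / 2))⁻¹ * y * ‖x k‖⁻¹ := fun k => by
    refine (norm_log_one_add_div_le (hx0 k) hθ0 hθ (hx k) hy0.le).trans ?_
    rw [mul_assoc]
    refine mul_le_mul_of_nonneg_left ?_ (inv_pos.2 hc0).le
    have h1 : 0 < 1 + y / ‖x k‖ := by positivity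
    have := Real.log_le_sub_one_of_pos h1
    rw [div_eq_mul_inv] at this ⊢
    linarith
  refine (tsum_of_norm_bounded (hs.mul_left _).hasSum hb).trans (le_of_eq ?_)
  rw [tsum_mul_left, Real.norm_eq_abs, abs_of_pos hy0]
  ring

end MellinLog

/-! ### Mellin transforms of truncated powers and logarithms -/

open MeasureTheory

section Tail

variable {s : ℂ}

theorem mellin_indicator_one (hs : s.re < 0) :
    MellinConvergent ((Set.Ioi (1 : ℝ)).indicator fun _ => (1 : ℂ)) s ∧
      mellin ((Set.Ioi (1 : ℝ)).indicator fun _ => (1 : ℂ)) s = -1 / s := by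
  have e : ∀ y : ℝ, (y : ℂ) ^ (s - 1) • (Set.Ioi (1 : ℝ)).indicator (fun _ => (1 : ℂ)) y =
      (Set.Ioi (1 : ℝ)).indicator (fun y : ℝ => (y : ℂ) ^ (s - 1)) y := fun y => by
    by_cases hy : y ∈ Set.Ioi (1 : ℝ)
    · simp [hy]
    · simp [hy]
  have hre : (s - 1).re < -1 := by
    rw [sub_re, one_re]
    linarith
  have hsub : Set.Ioi (1 : ℝ) ∩ Set.Ioi 0 = Set.Ioi 1 := by
    rw [Set.Ioi_inter_Ioi]
    norm_num
  rw [MellinConvergent, mellin]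
  simp only [e]
  constructor
  · rw [integrableOn_indicator_iff measurableSet_Ioi, hsub]
    exact integrableOn_Ioi_cpow_of_lt hre one_pos
  · rw [setIntegral_indicator measurableSet_Ioi, Set.inter_comm, hsub,
      integral_Ioi_cpow_of_lt hre one_pos]
    simp

theorem locallyIntegrableOn_indicator_Ioi {g : ℝ → ℂ} (hg : ContinuousOn g (Set.Ioi 0)) :
    LocallyIntegrableOn ((Set.Ioi (1 : ℝ)).indicator g) (Set.Ioi 0) := by
  intro y hy
  obtain ⟨t, ht, h⟩ := hg.locallyIntegrableOn (μ := volume) measurableSet_Ioi y hy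
  exact ⟨t, ht, h.indicator measurableSet_Ioi⟩

theorem indicator_Ioi_eventuallyEq_zero (g : ℝ → ℂ) :
    (Set.Ioi (1 : ℝ)).indicator g =ᶠ[𝓝[>] 0] 0 := by
  filter_upwards [nhdsWithin_le_nhds (eventually_lt_nhds (zero_lt_one' ℝ))] with y hy
  exact Set.indicator_of_notMem (by simpa using hy.le) g

/-- Inserting log y differentiates the Mellin transform, here -1/s, with respect to s. -/
theorem mellin_indicator_log (hs : s.re < 0) :
    MellinConvergent (fun y => Real.log y • (Set.Ioi (1 : ℝ)).indicator (fun _ => (1 : ℂ)) y) s ∧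
      mellin (fun y => Real.log y • (Set.Ioi (1 : ℝ)).indicator (fun _ => (1 : ℂ)) y) s =
        1 / s ^ 2 := by
  have h := mellin_hasDerivAt_of_isBigO_rpow (a := 0) (b := s.re - 1) (s := s)
    (f := (Set.Ioi (1 : ℝ)).indicator fun _ => (1 : ℂ))
    (locallyIntegrableOn_indicator_Ioi continuousOn_const) ?_ hs ?_ (by linarith)
  · refine ⟨h.1, h.2.unique ?_⟩
    have hs0 : s ≠ 0 := by
      rintro rfl
      simp at hs
    have h2 : HasDerivAt (fun s : ℂ => -1 / s) (1 / s ^ 2) s := by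
      simpa [div_eq_mul_inv] using (hasDerivAt_inv hs0).const_mul (-1)
    refine h2.congr_of_eventuallyEq ?_
    have : ∀ᶠ z : ℂ in 𝓝 s, z.re < 0 := continuous_re.continuousAt.eventually (eventually_lt_nhds hs)
    filter_upwards [this] with z hz
    exact (mellin_indicator_one hz).2
  · refine IsBigO.of_bound 1 (.of_forall fun y => ?_)
    simp only [neg_zero, Real.rpow_zero, norm_one, mul_one]
    exact (norm_indicator_le_norm_self _ _).trans (by simp)
  · exact (indicator_Ioi_eventuallyEq_zero _).trans_isBigO (isBigO_zero _ _)

theorem mellin_indicator_log_rpow {σ : ℂ} {μ : ℝ} (h : μ < σ.re) (b c : ℂ) :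
    HasMellin ((Set.Ioi (1 : ℝ)).indicator fun y => (b * log y + c) * (y : ℂ) ^ (μ : ℂ)) (-σ)
      (b / (σ - μ) ^ 2 + c / (σ - μ)) := by
  have hs : (-σ + μ).re < 0 := by
    rw [add_re, neg_re, ofReal_re]
    linarith
  obtain ⟨h1, h2⟩ := mellin_indicator_one hs
  obtain ⟨h3, h4⟩ := mellin_indicator_log hs
  have e : (Set.Ioi (1 : ℝ)).indicator (fun y => (b * log y + c) * (y : ℂ) ^ (μ : ℂ)) =
      fun y : ℝ => (y : ℂ) ^ (μ : ℂ) •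
        (b • (Real.log y • (Set.Ioi (1 : ℝ)).indicator (fun _ => (1 : ℂ)) y) +
          c • (Set.Ioi (1 : ℝ)).indicator (fun _ => (1 : ℂ)) y) := by
    funext y
    by_cases hy : y ∈ Set.Ioi (1 : ℝ)
    · have hy1 : (1 : ℝ) < y := hy
      rw [Set.indicator_of_mem hy, Set.indicator_of_mem hy, ← ofReal_log (by linarith)]
      simp only [smul_eq_mul, real_smul]
      ring
    · rw [Set.indicator_of_notMem hy, Set.indicator_of_notMem hy]
      simp
  have hsum := hasMellin_add (h3.const_smul b) (h1.const_smul c)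
  rw [e]
  refine ⟨MellinConvergent.cpow_smul.2 hsum.1, ?_⟩
  rw [mellin_cpow_smul, hsum.2, mellin_const_smul, mellin_const_smul, h2, h4,
    show -σ + (μ : ℂ) = -(σ - μ) by ring, neg_sq, neg_div_neg_eq, smul_eq_mul, smul_eq_mul,
    mul_one_div, mul_one_div]

end Tail

/-! ### Continuation of a Mellin transform by its asymptotic expansion -/

section Regularization

variable (f : ℝ → ℂ) (a' a : ℕ → ℂ)

/-- A term `(b log y + c) y ^ μ` of an expansion with exponents `μ = (1 - n) / 2`. -/
def expansionTerm (n : ℕ) (y : ℝ) : ℂ :=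
  (a' n * log y + a n) * (y : ℂ) ^ (((1 - (n : ℝ)) / 2 : ℝ) : ℂ)

/-- The polar part contributed to a Mellin transform by a term of an expansion. -/
def expansionPole (n : ℕ) (σ : ℂ) : ℂ :=
  a' n / (σ - (((1 - (n : ℝ)) / 2 : ℝ) : ℂ)) ^ 2 + a n / (σ - (((1 - (n : ℝ)) / 2 : ℝ) : ℂ))

/-- `f` with the head of its expansion removed on `(1, ∞)`. -/
def expansionRemainder (N : ℕ) (y : ℝ) : ℂ :=
  f y - ∑ n ∈ Finset.range (N + 1), (Set.Ioi (1 : ℝ)).indicator (expansionTerm a' a n) y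

/-- The continuation of the Mellin transform of `f`, at `-σ`, to `σ.re > (1 - N) / 2`. -/
def regMellin (N : ℕ) (σ : ℂ) : ℂ :=
  mellin (expansionRemainder f a' a N) (-σ) +
    ∑ n ∈ Finset.range (N + 1), expansionPole a' a n σ

/-- The continuation of the Mellin transform of `f`, at `-σ`, to the half-plane `σ.re < 1`. -/
def extMellin (σ : ℂ) : ℂ := regMellin f a' a (⌈|1 - 2 * σ.re|⌉₊ + 1) σ

variable {f a' a}

theorem analyticAt_expansionPole {n : ℕ} {σ : ℂ} (h : σ ≠ (((1 - (n : ℝ)) / 2 : ℝ) : ℂ)) :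
    AnalyticAt ℂ (expansionPole a' a n) σ := by
  have h1 := sub_ne_zero.2 h
  unfold expansionPole
  have h2 : AnalyticAt ℂ (fun σ => σ - (((1 - (n : ℝ)) / 2 : ℝ) : ℂ)) σ := by fun_prop
  exact (analyticAt_const.div (h2.pow 2) (pow_ne_zero 2 h1)).add (analyticAt_const.div h2 h1)

theorem continuousOn_expansionTerm (n : ℕ) : ContinuousOn (expansionTerm a' a n) (Set.Ioi 0) := by
  unfold expansionTerm
  refine ContinuousOn.mul (ContinuousOn.add (continuousOn_const.mul fun y hy => ?_)
    continuousOn_const) fun y hy => ?_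
  · have hy0 : (0 : ℝ) < y := hy
    have : ContinuousAt (fun y : ℝ => (y : ℂ)) y := by fun_prop
    exact (this.clog (Or.inl (by simpa using hy0))).continuousWithinAt
  · exact (continuousAt_ofReal_cpow_const _ _ (Or.inr (ne_of_gt hy))).continuousWithinAt

theorem expansionRemainder_succ (N : ℕ) (y : ℝ) : expansionRemainder f a' a N y =
    expansionRemainder f a' a (N + 1) y +
      (Set.Ioi (1 : ℝ)).indicator (expansionTerm a' a (N + 1)) y := by
  rw [expansionRemainder, expansionRemainder, Finset.sum_range_succ _ (N + 1)]
  ring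

variable (hf : ContinuousOn f (Set.Ioi 0)) (hf0 : f =O[𝓝[>] 0] fun y => y)
  (hfe : ∀ N : ℕ, (fun y : ℝ => f y - ∑ n ∈ Finset.range (N + 1), expansionTerm a' a n y)
    =O[atTop] fun y : ℝ => y ^ ((1 - (N : ℝ)) / 2))

include hf in
theorem locallyIntegrableOn_expansionRemainder (N : ℕ) :
    LocallyIntegrableOn (expansionRemainder f a' a N) (Set.Ioi 0) := by
  have h1 := hf.locallyIntegrableOn measurableSet_Ioi (μ := volume)
  have h2 : ∀ N : ℕ, LocallyIntegrableOn (fun y => ∑ n ∈ Finset.range N,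
      (Set.Ioi (1 : ℝ)).indicator (expansionTerm a' a n) y) (Set.Ioi 0) := by
    intro N
    induction N with
    | zero => simpa using locallyIntegrableOn_zero
    | succ N ih =>
      simp only [Finset.sum_range_succ]
      exact ih.add (locallyIntegrableOn_indicator_Ioi (continuousOn_expansionTerm N))
  exact h1.sub (h2 (N + 1))

include hfe in
theorem expansionRemainder_isBigO_atTop (N : ℕ) :
    expansionRemainder f a' a N =O[atTop] fun y : ℝ => y ^ ((1 - (N : ℝ)) / 2) := by
  refine (hfe N).congr' ?_ EventuallyEq.rfl
  filter_upwards [eventually_gt_atTop 1] with y hy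
  rw [expansionRemainder]
  congr 1
  exact Finset.sum_congr rfl fun n _ => (Set.indicator_of_mem hy _).symm

include hf0 in
theorem expansionRemainder_isBigO_zero (N : ℕ) :
    expansionRemainder f a' a N =O[𝓝[>] 0] fun y : ℝ => y := by
  refine hf0.congr' ?_ EventuallyEq.rfl
  filter_upwards [nhdsWithin_le_nhds (eventually_lt_nhds (zero_lt_one' ℝ))] with y hy
  rw [expansionRemainder, Finset.sum_eq_zero, sub_zero]
  exact fun n _ => Set.indicator_of_notMem (by simpa using hy.le) _

include hf hf0 hfe in
theorem mellinConvergent_expansionRemainder {N : ℕ} {σ : ℂ} (hN : (1 - (N : ℝ)) / 2 < σ.re)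
    (h1 : σ.re < 1) : MellinConvergent (expansionRemainder f a' a N) (-σ) :=
  mellinConvergent_of_isBigO_rpow (a := -((1 - (N : ℝ)) / 2)) (b := -1)
    (locallyIntegrableOn_expansionRemainder hf N)
    (by simpa only [neg_neg] using expansionRemainder_isBigO_atTop hfe N)
    (by rw [neg_re]; linarith)
    (by simpa only [neg_neg, Real.rpow_one] using expansionRemainder_isBigO_zero hf0 N)
    (by rw [neg_re]; linarith)

include hf hf0 hfe in
theorem analyticAt_mellin_expansionRemainder {N : ℕ} {σ : ℂ} (hN : (1 - (N : ℝ)) / 2 < σ.re)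
    (h1 : σ.re < 1) : AnalyticAt ℂ (fun σ => mellin (expansionRemainder f a' a N) (-σ)) σ := by
  rw [analyticAt_iff_eventually_differentiableAt]
  filter_upwards [continuous_re.continuousAt.eventually (eventually_gt_nhds hN),
    continuous_re.continuousAt.eventually (eventually_lt_nhds h1)] with z hz1 hz2
  refine DifferentiableAt.comp (g := mellin (expansionRemainder f a' a N)) (f := fun σ => -σ) z
    (mellin_differentiableAt_of_isBigO_rpow (a := -((1 - (N : ℝ)) / 2)) (b := -1)
      (locallyIntegrableOn_expansionRemainder hf N)
      (by simpa only [neg_neg] using expansionRemainder_isBigO_atTop hfe N)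
      (by rw [neg_re]; linarith)
      (by simpa only [neg_neg, Real.rpow_one] using expansionRemainder_isBigO_zero hf0 N)
      (by rw [neg_re]; linarith)) differentiableAt_fun_id.neg

-- The next term removed from f is restored as its exact Mellin transform on (1,∞), so the order of
-- regularisation does not matter where both are defined.
include hf hf0 hfe in
theorem regMellin_succ {N : ℕ} {σ : ℂ} (hN : (1 - (N : ℝ)) / 2 < σ.re) (h1 : σ.re < 1) :
    regMellin f a' a (N + 1) σ = regMellin f a' a N σ := by
  have hN' : (1 - ((N + 1 : ℕ) : ℝ)) / 2 < σ.re := by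
    push_cast
    linarith
  have h2 := mellin_indicator_log_rpow hN' (a' (N + 1)) (a (N + 1))
  have h3 := mellinConvergent_expansionRemainder hf hf0 hfe hN' h1
  have h4 := (hasMellin_add h3 h2.1).2
  rw [h2.2] at h4
  have h5 : expansionRemainder f a' a N = fun y => expansionRemainder f a' a (N + 1) y +
      (Set.Ioi (1 : ℝ)).indicator (fun y => (a' (N + 1) * log y + a (N + 1)) *
        (y : ℂ) ^ (((1 - ((N + 1 : ℕ) : ℝ)) / 2 : ℝ) : ℂ)) y :=
    funext fun y => expansionRemainder_succ N y
  rw [regMellin, regMellin, h5, h4, Finset.sum_range_succ _ (N + 1), expansionPole]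
  ring

include hf hf0 hfe in
theorem regMellin_eq_of_le {N M : ℕ} (h : N ≤ M) {σ : ℂ} (hN : (1 - (N : ℝ)) / 2 < σ.re)
    (h1 : σ.re < 1) : regMellin f a' a M σ = regMellin f a' a N σ := by
  induction M, h using Nat.le_induction with
  | base => rfl
  | succ M hM ih =>
    have : (N : ℝ) ≤ M := by exact_mod_cast hM
    rw [regMellin_succ hf hf0 hfe (by linarith) h1, ih]

-- The order built into `extMellin` satisfies (1-N)/2 < Re σ at the point in question, so it may be
-- replaced by any fixed admissible order. This makes `extMellin` locally a single holomorphic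
-- expression.
include hf hf0 hfe in
theorem extMellin_eq {N : ℕ} {σ : ℂ} (hN : (1 - (N : ℝ)) / 2 < σ.re) (h1 : σ.re < 1) :
    extMellin f a' a σ = regMellin f a' a N σ := by
  set K := ⌈|1 - 2 * σ.re|⌉₊ + 1 with hK
  have hK' : (1 - (K : ℝ)) / 2 < σ.re := by
    have h2 := Nat.le_ceil |1 - 2 * σ.re|
    have h3 := le_abs_self (1 - 2 * σ.re)
    rw [hK]
    push_cast
    linarith
  rw [extMellin, ← hK]
  rcases le_total K N with h | h
  · exact (regMellin_eq_of_le hf hf0 hfe h hK' h1).symm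
  · exact regMellin_eq_of_le hf hf0 hfe h hN h1

include hf hf0 hfe in
theorem extMellin_eq_mellin {σ : ℂ} (h0 : 1 / 2 < σ.re) (h1 : σ.re < 1) :
    extMellin f a' a σ = mellin f (-σ) := by
  have hN : (1 - ((0 : ℕ) : ℝ)) / 2 < σ.re := by simpa using h0
  have h2 := mellin_indicator_log_rpow hN (a' 0) (a 0)
  have h3 := mellinConvergent_expansionRemainder hf hf0 hfe hN h1
  have h4 := (hasMellin_add h3 h2.1).2
  rw [h2.2] at h4
  have h5 : f = fun y => expansionRemainder f a' a 0 y +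
      (Set.Ioi (1 : ℝ)).indicator (fun y => (a' 0 * log y + a 0) *
        (y : ℂ) ^ (((1 - ((0 : ℕ) : ℝ)) / 2 : ℝ) : ℂ)) y := by
    funext y
    rw [expansionRemainder]
    simp only [zero_add, Finset.range_one, Finset.sum_singleton]
    exact (sub_add_cancel _ _).symm
  rw [extMellin_eq hf hf0 hfe hN h1]
  conv_rhs => rw [h5, h4]
  rw [regMellin]
  simp [expansionPole]

include hf hf0 hfe in
/-- Away from the exponents the continuation is holomorphic. -/
theorem analyticAt_extMellin {σ₀ : ℂ} (h1 : σ₀.re < 1)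
    (hσ : ∀ n : ℕ, σ₀ ≠ (((1 - (n : ℝ)) / 2 : ℝ) : ℂ)) :
    AnalyticAt ℂ (extMellin f a' a) σ₀ := by
  obtain ⟨N, hN⟩ := exists_nat_gt (1 - 2 * σ₀.re)
  have hN' : (1 - (N : ℝ)) / 2 < σ₀.re := by linarith
  have h2 : AnalyticAt ℂ (regMellin f a' a N) σ₀ := by
    unfold regMellin
    exact (analyticAt_mellin_expansionRemainder hf hf0 hfe hN' h1).add
      (Finset.analyticAt_fun_sum _ fun n _ => analyticAt_expansionPole (hσ n))
  refine h2.congr ?_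
  filter_upwards [continuous_re.continuousAt.eventually (eventually_gt_nhds hN'),
    continuous_re.continuousAt.eventually (eventually_lt_nhds h1)] with z hz1 hz2
  exact (extMellin_eq hf hf0 hfe hz1 hz2).symm

include hf hf0 hfe in
/-- At an exponent the continuation has the polar part given by the term of the expansion. -/
theorem exists_extMellin_eq_add_pole (p : ℕ) : ∃ G : ℂ → ℂ,
    AnalyticAt ℂ G (((1 - (p : ℝ)) / 2 : ℝ) : ℂ) ∧
      ∀ᶠ σ in 𝓝 ((((1 - (p : ℝ)) / 2 : ℝ) : ℂ)),
        extMellin f a' a σ = G σ + expansionPole a' a p σ := by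
  set σ₀ : ℂ := (((1 - (p : ℝ)) / 2 : ℝ) : ℂ) with hσ₀
  have hre : σ₀.re = (1 - (p : ℝ)) / 2 := ofReal_re _
  have hp0 : (0 : ℝ) ≤ p := Nat.cast_nonneg p
  -- With order p the exponent would lie on the boundary of the half-plane of convergence; one term
  -- more makes it interior.
  have hN' : (1 - ((p + 1 : ℕ) : ℝ)) / 2 < σ₀.re := by
    rw [hre]
    push_cast
    linarith
  have h1 : σ₀.re < 1 := by
    rw [hre]
    linarith
  refine ⟨fun σ => mellin (expansionRemainder f a' a (p + 1)) (-σ) +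
    ∑ n ∈ (Finset.range (p + 1 + 1)).erase p, expansionPole a' a n σ, ?_, ?_⟩
  · refine (analyticAt_mellin_expansionRemainder hf hf0 hfe hN' h1).add
      (Finset.analyticAt_fun_sum _ fun n hn => analyticAt_expansionPole fun h => ?_)
    have h2 : (1 - (p : ℝ)) / 2 = (1 - (n : ℝ)) / 2 := ofReal_injective h
    have h3 : (n : ℝ) = p := by linarith
    exact (Finset.mem_erase.1 hn).1 (by exact_mod_cast h3)
  · filter_upwards [continuous_re.continuousAt.eventually (eventually_gt_nhds hN'),
      continuous_re.continuousAt.eventually (eventually_lt_nhds h1)] with z hz1 hz2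
    rw [extMellin_eq hf hf0 hfe hz1 hz2, regMellin, ← Finset.sum_erase_add _ _
      (show p ∈ Finset.range (p + 1 + 1) by simp)]
    exact (add_assoc _ _ _).symm

end Regularization

/-! ### The sine factor and meromorphic normal forms -/

theorem analyticAt_dslope {f : ℂ → ℂ} (hf : Differentiable ℂ f) (a b : ℂ) :
    AnalyticAt ℂ (dslope f a) b := by
  have h : DifferentiableOn ℂ (dslope f a) Set.univ :=
    (differentiableOn_dslope univ_mem).2 hf.differentiableOn
  exact (differentiableOn_univ.1 h).analyticAt b

/-- The factor `σ sin (π σ) / π` of the Mellin transform of `log (1 + y)`. -/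
def sineFactor (σ : ℂ) : ℂ := σ * sin (Real.pi * σ) / Real.pi

theorem differentiable_sineFactor : Differentiable ℂ sineFactor := by
  unfold sineFactor
  fun_prop

theorem deriv_sin_pi_mul (σ : ℂ) :
    HasDerivAt (fun σ : ℂ => sin (Real.pi * σ)) (cos (Real.pi * σ) * Real.pi) σ := by
  simpa using ((hasDerivAt_id σ).const_mul (Real.pi : ℂ)).csin

theorem sineFactor_half : sineFactor (1 / 2) = 1 / (2 * Real.pi) := by
  have h : (Real.pi : ℂ) * (1 / 2) = ((Real.pi / 2 : ℝ) : ℂ) := by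
    push_cast
    ring
  rw [sineFactor, h, ← ofReal_sin, Real.sin_pi_div_two, ofReal_one]
  ring

theorem deriv_sineFactor_half : deriv sineFactor (1 / 2) = 1 / Real.pi := by
  have h : (Real.pi : ℂ) * (1 / 2) = ((Real.pi / 2 : ℝ) : ℂ) := by
    push_cast
    ring
  have h1 := ((hasDerivAt_id (1 / 2 : ℂ)).mul (deriv_sin_pi_mul (1 / 2))).div_const (Real.pi : ℂ)
  have h2 : deriv sineFactor (1 / 2) = _ := h1.deriv
  rw [h2, h, ← ofReal_sin, ← ofReal_cos, Real.sin_pi_div_two, Real.cos_pi_div_two]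
  simp

theorem sineFactor_neg_natCast (m : ℕ) : sineFactor (-m) = 0 := by
  rw [sineFactor, show (Real.pi : ℂ) * -m = -(m * Real.pi) by ring, sin_neg, sin_nat_mul_pi]
  simp

theorem sineFactor_ne_zero {σ : ℂ} (h0 : 0 < σ.re) (h1 : σ.re < 1) : sineFactor σ ≠ 0 := by
  have hpi : (Real.pi : ℂ) ≠ 0 := by exact_mod_cast Real.pi_ne_zero
  refine div_ne_zero (mul_ne_zero ?_ fun h => ?_) hpi
  · rintro rfl
    simp at h0
  · obtain ⟨k, hk⟩ := Complex.sin_eq_zero_iff.1 h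
    have h3 : σ = k := by
      apply mul_left_cancel₀ hpi
      rw [hk, mul_comm]
    rw [h3] at h0 h1
    simp only [intCast_re] at h0 h1
    have h4 : (0 : ℤ) < k := by exact_mod_cast h0
    have h5 : k < (1 : ℤ) := by exact_mod_cast h1
    omega

/-- `sin (π σ) / (π σ)`, continued to `σ = 0`. -/
def sincFactor (σ : ℂ) : ℂ := dslope (fun σ : ℂ => sin (Real.pi * σ)) 0 σ / Real.pi

theorem sineFactor_eq_sq_mul (σ : ℂ) : sineFactor σ = σ ^ 2 * sincFactor σ := by
  have h := sub_smul_dslope (fun σ : ℂ => sin (Real.pi * σ)) 0 σ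
  simp only [sub_zero, smul_eq_mul, mul_zero, sin_zero] at h
  rw [sineFactor, sincFactor, ← h]
  ring

theorem analyticAt_sincFactor (σ : ℂ) : AnalyticAt ℂ sincFactor σ := by
  have := analyticAt_dslope (f := fun σ : ℂ => sin (Real.pi * σ)) (by fun_prop) 0 σ
  exact this.div_const

theorem sincFactor_zero : sincFactor 0 = 1 := by
  have hpi : (Real.pi : ℂ) ≠ 0 := by exact_mod_cast Real.pi_ne_zero
  rw [sincFactor, dslope_same, (deriv_sin_pi_mul 0).deriv]
  simp [hpi]

/-- The function is even. Hence the sine factor does not mix the value at 0 of the continued series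
into its derivative. -/
theorem hasDerivAt_sincFactor_zero : HasDerivAt sincFactor 0 0 := by
  have heven : ∀ σ, sincFactor (-σ) = sincFactor σ := fun σ => by
    rcases eq_or_ne σ 0 with rfl | h
    · simp
    · have h1 := sineFactor_eq_sq_mul σ
      have h2 := sineFactor_eq_sq_mul (-σ)
      have h3 : sineFactor (-σ) = sineFactor σ := by
        rw [sineFactor, sineFactor, mul_neg, sin_neg]
        ring
      rw [h3, h1, neg_sq] at h2
      exact (mul_left_cancel₀ (pow_ne_zero 2 h) h2).symm
  have h := (analyticAt_sincFactor 0).differentiableAt.hasDerivAt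
  have h2 := deriv_comp_neg sincFactor 0
  simp only [heven, neg_zero] at h2
  rwa [self_eq_neg.1 h2] at h

/-- Passing to the normal form fills in removable singularities with the correct value: agreement on
a punctured neighbourhood with an analytic function becomes agreement at the point. -/
theorem MeromorphicOn.toMeromorphicNFOn_eventuallyEq {F g : ℂ → ℂ} {σ : ℂ}
    (hF : MeromorphicOn F Set.univ) (hg : AnalyticAt ℂ g σ) (h : F =ᶠ[𝓝[≠] σ] g) :
    toMeromorphicNFOn F Set.univ =ᶠ[𝓝 σ] g :=
  (MeromorphicNFAt.eventuallyEq_nhdsNE_iff_eventuallyEq_nhds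
    (meromorphicNFOn_toMeromorphicNFOn F Set.univ (Set.mem_univ σ)) hg.meromorphicNFAt).1
    ((hF.toMeromorphicNFOn_eq_self_on_nhdsNE (Set.mem_univ σ)).trans h)

/-! ### Convergence and holomorphy of the Dirichlet series -/

section Dirichlet

variable {x : ℕ → ℂ} (hx0 : ∀ k, x k ≠ 0) {α : ℝ}
  (hs : ∀ β : ℝ, α < β → Summable fun k => ‖x k‖ ^ (-β))

-- The modulus is |x|^(-Re σ) exp(arg x · Im σ). Two powers appear because |x| may lie on either
-- side of 1.
include hx0 in
theorem norm_cpow_neg_le {b c R : ℝ} {σ : ℂ} (hb : b ≤ σ.re) (hc : σ.re ≤ c) (hR : |σ.im| ≤ R)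
    (k : ℕ) : ‖x k ^ (-σ)‖ ≤ (‖x k‖ ^ (-b) + ‖x k‖ ^ (-c)) * Real.exp (Real.pi * R) := by
  have hn := norm_pos_iff.2 (hx0 k)
  rw [norm_cpow_of_ne_zero (hx0 k), div_eq_mul_inv, ← Real.exp_neg, neg_re, neg_im]
  gcongr
  · rcases le_total 1 ‖x k‖ with h | h
    · have h1 := Real.rpow_le_rpow_of_exponent_le h (neg_le_neg hb)
      have h2 : 0 ≤ ‖x k‖ ^ (-c) := by positivity
      linarith
    · have h1 := Real.rpow_le_rpow_of_exponent_ge hn h (neg_le_neg hc)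
      have h2 : 0 ≤ ‖x k‖ ^ (-b) := by positivity
      linarith
  · refine (le_abs_self _).trans ?_
    rw [mul_neg, neg_neg, abs_mul]
    exact mul_le_mul (abs_arg_le_pi _) hR (abs_nonneg _) Real.pi_pos.le

include hx0 hs in
theorem summable_cpow_neg {σ : ℂ} (hσ : α < σ.re) : Summable fun k => x k ^ (-σ) :=
  .of_norm_bounded (((hs _ hσ).add (hs _ hσ)).mul_right _)
    (norm_cpow_neg_le hx0 le_rfl le_rfl le_rfl)

include hx0 hs in
theorem analyticAt_tsum_cpow_neg {σ : ℂ} (hσ : α < σ.re) :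
    AnalyticAt ℂ (fun σ => ∑' k, x k ^ (-σ)) σ := by
  obtain ⟨b, hb, hb'⟩ := exists_between hσ
  set U : Set ℂ := {z | b < z.re} ∩ ({z | z.re < σ.re + 1} ∩ {z | |z.im| < |σ.im| + 1}) with hU
  have hUo : IsOpen U := by
    refine (isOpen_lt continuous_const continuous_re).inter
      ((isOpen_lt continuous_re continuous_const).inter
        (isOpen_lt continuous_im.abs continuous_const))
  have hUσ : σ ∈ U := ⟨hb', by simp, by simp⟩
  refine DifferentiableOn.analyticAt (s := U) ?_ (hUo.mem_nhds hUσ)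
  refine differentiableOn_tsum_of_summable_norm
    (((hs b hb).add (hs (σ.re + 1) (by linarith))).mul_right (Real.exp (Real.pi * (|σ.im| + 1))))
    (fun k => ?_) hUo fun k z hz =>
      norm_cpow_neg_le hx0 (le_of_lt hz.1) (le_of_lt hz.2.1) (le_of_lt hz.2.2) k
  exact fun z _ => (differentiableAt_id.neg.const_cpow (Or.inl (hx0 k))).differentiableWithinAt

end Dirichlet

/-! ### Meromorphic continuation of the Dirichlet series -/

section Continuation

/-- The Dirichlet series `∑ x_k ^ (-σ)` to the right of `σ.re = 3 / 4`, and its continuation given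
by the expansion of `logDelta` to the left, with unspecified values at the singularities. -/
def dirichletAux (x a' a : ℕ → ℂ) (σ : ℂ) : ℂ :=
  if 3 / 4 < σ.re then ∑' k, x k ^ (-σ)
  else sineFactor σ * extMellin (fun y : ℝ => logDelta x y) a' a σ

/-- The meromorphic continuation of the Dirichlet series `∑ x_k ^ (-σ)`. -/
def dirichletExt (x a' a : ℕ → ℂ) : ℂ → ℂ := toMeromorphicNFOn (dirichletAux x a' a) Set.univ

variable {x a' a : ℕ → ℂ} {θ : ℝ}

theorem meromorphicOn_dirichletExt : MeromorphicOn (dirichletExt x a' a) Set.univ :=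
  (meromorphicNFOn_toMeromorphicNFOn _ _).meromorphicOn

/-- A sequence with exponent of convergence `1 / 2` and a Stirling expansion in powers of `√z`. -/
structure HasSqrtExpansion (x : ℕ → ℂ) (θ : ℝ) (a' a : ℕ → ℂ) : Prop where
  ne_zero : ∀ k, x k ≠ 0
  tendsto : Tendsto (fun k => ‖x k‖) atTop atTop
  summable : ∀ β : ℝ, 1 / 2 < β → Summable fun k => ‖x k‖ ^ (-β)
  pos : 0 < θ
  le_pi : θ ≤ Real.pi
  abs_arg_le : ∀ k, |arg (x k)| ≤ Real.pi - θ
  expansion : HasStirlingExpansion x θ (fun n => (1 - (n : ℝ)) / 2) a' a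

namespace HasSqrtExpansion

variable (h : HasSqrtExpansion x θ a' a)

include h

theorem summable_inv : Summable fun k => ‖x k‖⁻¹ := by
  simpa [Real.rpow_neg_one] using h.summable 1 (by norm_num)

theorem abs_arg_ofReal_lt {y : ℝ} (hy : 0 ≤ y) : |arg (y : ℂ)| < θ := by
  rw [arg_ofReal_of_nonneg hy, abs_zero]
  exact h.pos

theorem continuousOn_logDelta_ofReal :
    ContinuousOn (fun y : ℝ => logDelta x y) (Set.Ioi 0) :=
  (continuousOn_logDelta h.tendsto h.summable_inv).comp continuous_ofReal.continuousOn
    fun _ hy k => one_add_div_mem_slitPlane (h.ne_zero k) (h.abs_arg_ofReal_lt (le_of_lt hy))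
      (h.abs_arg_le k)

theorem logDelta_isBigO_zero : (fun y : ℝ => logDelta x y) =O[𝓝[>] 0] fun y => y :=
  logDelta_isBigO_nhds_zero h.ne_zero h.pos h.le_pi h.abs_arg_le h.summable_inv

theorem logDelta_isBigO_atTop (N : ℕ) :
    (fun y : ℝ => logDelta x y - ∑ n ∈ Finset.range (N + 1), expansionTerm a' a n y)
      =O[atTop] fun y : ℝ => y ^ ((1 - (N : ℝ)) / 2) := by
  refine ((h.expansion N).isBigO.comp_tendsto (tendsto_ofReal_sectorAtInfinity h.pos)).congr'
    EventuallyEq.rfl ?_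
  filter_upwards [eventually_ge_atTop 0] with y hy
  simp [abs_of_nonneg hy]

/-- For 1/2 < Re σ < 1 the sine factor inverts the multiplier in the Mellin transform of log Δ. The
two defining formulas thus agree on an overlap, and the threshold 3/4 is an arbitrary point of it.
-/
theorem dirichletAux_eq_tsum {σ : ℂ} (hσ : 1 / 2 < σ.re) :
    dirichletAux x a' a σ = ∑' k, x k ^ (-σ) := by
  rw [dirichletAux]
  split_ifs with h1
  · rfl
  · have h2 : σ.re < 1 := by linarith
    rw [extMellin_eq_mellin h.continuousOn_logDelta_ofReal h.logDelta_isBigO_zero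
      h.logDelta_isBigO_atTop hσ h2, ← (hasSum_mellin_logDelta (by linarith) h2 h.ne_zero h.pos
        h.le_pi h.abs_arg_le (h.summable _ hσ)).tsum_eq, tsum_mul_right, mul_left_comm]
    have h3 := sineFactor_ne_zero (σ := σ) (by linarith) h2
    have h4 : (Real.pi : ℂ) / (σ * sin (Real.pi * σ)) = (sineFactor σ)⁻¹ := by
      rw [sineFactor, inv_div]
    rw [h4, mul_inv_cancel₀ h3, mul_one]

theorem dirichletAux_eq_extMellin {σ : ℂ} (hσ : σ.re < 1) :
    dirichletAux x a' a σ =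
      sineFactor σ * extMellin (fun y : ℝ => logDelta x y) a' a σ := by
  by_cases h1 : 3 / 4 < σ.re
  · have h2 : 1 / 2 < σ.re := by linarith
    have h3 := sineFactor_ne_zero (σ := σ) (by linarith) hσ
    have h4 : (Real.pi : ℂ) / (σ * sin (Real.pi * σ)) = (sineFactor σ)⁻¹ := by
      rw [sineFactor, inv_div]
    rw [h.dirichletAux_eq_tsum h2,
      extMellin_eq_mellin h.continuousOn_logDelta_ofReal h.logDelta_isBigO_zero
      h.logDelta_isBigO_atTop h2 hσ, ← (hasSum_mellin_logDelta (by linarith) hσ h.ne_zero h.pos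
        h.le_pi h.abs_arg_le (h.summable _ h2)).tsum_eq, tsum_mul_right, h4, mul_left_comm,
      mul_inv_cancel₀ h3, mul_one]
  · rw [dirichletAux, if_neg h1]

theorem analyticAt_dirichletAux_of_lt {σ : ℂ} (hσ : 1 / 2 < σ.re) :
    AnalyticAt ℂ (dirichletAux x a' a) σ := by
  refine (analyticAt_tsum_cpow_neg h.ne_zero h.summable hσ).congr ?_
  filter_upwards [continuous_re.continuousAt.eventually (eventually_gt_nhds hσ)] with z hz
  exact (h.dirichletAux_eq_tsum hz).symm

theorem analyticAt_dirichletAux {σ : ℂ} (hσ : ∀ n : ℕ, σ ≠ (((1 - (n : ℝ)) / 2 : ℝ) : ℂ)) :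
    AnalyticAt ℂ (dirichletAux x a' a) σ := by
  rcases lt_or_ge (1 / 2) σ.re with h1 | h1
  · exact h.analyticAt_dirichletAux_of_lt h1
  · have h2 : σ.re < 1 := by linarith
    refine ((differentiable_sineFactor.analyticAt σ).mul (analyticAt_extMellin
      h.continuousOn_logDelta_ofReal h.logDelta_isBigO_zero h.logDelta_isBigO_atTop h2 hσ)).congr ?_
    filter_upwards [continuous_re.continuousAt.eventually (eventually_lt_nhds h2)] with z hz
    exact (h.dirichletAux_eq_extMellin hz).symm

theorem exists_dirichletAux_eq (p : ℕ) : ∃ G : ℂ → ℂ,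
    AnalyticAt ℂ G (((1 - (p : ℝ)) / 2 : ℝ) : ℂ) ∧
      ∀ᶠ σ in 𝓝 ((((1 - (p : ℝ)) / 2 : ℝ) : ℂ)),
        dirichletAux x a' a σ = sineFactor σ * (G σ + expansionPole a' a p σ) := by
  obtain ⟨G, hG, hGe⟩ := exists_extMellin_eq_add_pole h.continuousOn_logDelta_ofReal
    h.logDelta_isBigO_zero h.logDelta_isBigO_atTop p
  have h2 : ((((1 - (p : ℝ)) / 2 : ℝ) : ℂ)).re < 1 := by
    rw [ofReal_re]
    linarith [Nat.cast_nonneg (α := ℝ) p]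
  refine ⟨G, hG, ?_⟩
  filter_upwards [hGe, continuous_re.continuousAt.eventually (eventually_lt_nhds h2)] with z h3 h4
  rw [h.dirichletAux_eq_extMellin h4, h3]

/-- At an exponent the continuation has at most a double pole. -/
theorem exists_dirichletAux_eq_zpow_mul (p : ℕ) : ∃ H : ℂ → ℂ,
    AnalyticAt ℂ H (((1 - (p : ℝ)) / 2 : ℝ) : ℂ) ∧
      dirichletAux x a' a =ᶠ[𝓝[≠] ((((1 - (p : ℝ)) / 2 : ℝ) : ℂ))]
        fun σ => (σ - (((1 - (p : ℝ)) / 2 : ℝ) : ℂ)) ^ (-2 : ℤ) * H σ := by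
  obtain ⟨G, hG, hGe⟩ := h.exists_dirichletAux_eq p
  set μ : ℂ := (((1 - (p : ℝ)) / 2 : ℝ) : ℂ)
  have h1 : AnalyticAt ℂ (fun σ : ℂ => σ - μ) μ := by fun_prop
  refine ⟨fun σ => sineFactor σ * (G σ * (σ - μ) ^ 2 + a' p + a p * (σ - μ)), ?_, ?_⟩
  · exact (differentiable_sineFactor.analyticAt μ).mul
      (((hG.mul (h1.pow 2)).add analyticAt_const).add (analyticAt_const.mul h1))
  · filter_upwards [nhdsWithin_le_nhds hGe, self_mem_nhdsWithin] with σ h2 h3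
    have h4 : σ - μ ≠ 0 := sub_ne_zero.2 h3
    have h5 : expansionPole a' a p σ = a' p / (σ - μ) ^ 2 + a p / (σ - μ) := rfl
    rw [h2, h5, show (-2 : ℤ) = -((2 : ℕ) : ℤ) from rfl, zpow_neg, zpow_natCast]
    field_simp
    ring

theorem meromorphicOn_dirichletAux : MeromorphicOn (dirichletAux x a' a) Set.univ := by
  intro σ _
  by_cases h1 : ∀ n : ℕ, σ ≠ (((1 - (n : ℝ)) / 2 : ℝ) : ℂ)
  · exact (h.analyticAt_dirichletAux h1).meromorphicAt
  · push Not at h1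
    obtain ⟨p, rfl⟩ := h1
    obtain ⟨H, hH, hHe⟩ := h.exists_dirichletAux_eq_zpow_mul p
    refine MeromorphicAt.congr ?_ hHe.symm
    have : MeromorphicAt (fun σ : ℂ => σ - (((1 - (p : ℝ)) / 2 : ℝ) : ℂ))
      (((1 - (p : ℝ)) / 2 : ℝ) : ℂ) := by fun_prop
    exact (this.zpow (-2)).mul hH.meromorphicAt

theorem dirichletExt_eventuallyEq {g : ℂ → ℂ} {σ : ℂ} (hg : AnalyticAt ℂ g σ)
    (he : dirichletAux x a' a =ᶠ[𝓝[≠] σ] g) : dirichletExt x a' a =ᶠ[𝓝 σ] g :=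
  h.meromorphicOn_dirichletAux.toMeromorphicNFOn_eventuallyEq hg he

theorem dirichletExt_eventuallyEq_aux (σ : ℂ) :
    dirichletExt x a' a =ᶠ[𝓝[≠] σ] dirichletAux x a' a :=
  h.meromorphicOn_dirichletAux.toMeromorphicNFOn_eq_self_on_nhdsNE (Set.mem_univ σ)

theorem hasSum_dirichletExt {σ : ℂ} (hσ : 1 / 2 < σ.re) :
    HasSum (fun k => x k ^ (-σ)) (dirichletExt x a' a σ) := by
  have h1 := (h.dirichletExt_eventuallyEq (h.analyticAt_dirichletAux_of_lt hσ)
    EventuallyEq.rfl).eq_of_nhds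
  rw [h1, h.dirichletAux_eq_tsum hσ]
  exact (summable_cpow_neg h.ne_zero h.summable hσ).hasSum

theorem neg_two_le_meromorphicOrderAt (p : ℕ) : ((-2 : ℤ) : WithTop ℤ) ≤
    meromorphicOrderAt (dirichletExt x a' a) (((1 - (p : ℝ)) / 2 : ℝ) : ℂ) := by
  obtain ⟨H, hH, hHe⟩ := h.exists_dirichletAux_eq_zpow_mul p
  rw [meromorphicOrderAt_congr ((h.dirichletExt_eventuallyEq_aux _).trans hHe)]
  have h1 : MeromorphicAt (fun σ : ℂ => σ - (((1 - (p : ℝ)) / 2 : ℝ) : ℂ))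
    (((1 - (p : ℝ)) / 2 : ℝ) : ℂ) := by fun_prop
  have h2 : MeromorphicAt (fun σ : ℂ => (σ - (((1 - (p : ℝ)) / 2 : ℝ) : ℂ)) ^ (-2 : ℤ))
    (((1 - (p : ℝ)) / 2 : ℝ) : ℂ) := h1.zpow (-2)
  rw [fun_meromorphicOrderAt_mul h2 hH.meromorphicAt,
    fun_meromorphicOrderAt_zpow_id_sub_const]
  exact le_add_of_nonneg_right hH.meromorphicOrderAt_nonneg

/-- The polar part at `σ = 1 / 2`. -/
theorem exists_dirichletExt_eq_half : ∃ g : ℂ → ℂ, AnalyticAt ℂ g (1 / 2) ∧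
    ∀ᶠ σ in 𝓝[≠] (1 / 2 : ℂ), dirichletExt x a' a σ =
      a' 0 / (2 * Real.pi) * ((σ - 1 / 2) ^ 2)⁻¹ +
        (a' 0 / Real.pi + a 0 / (2 * Real.pi)) * (σ - 1 / 2)⁻¹ + g σ := by
  obtain ⟨G, hG, hGe⟩ := h.exists_dirichletAux_eq 0
  have hμ : (((1 - ((0 : ℕ) : ℝ)) / 2 : ℝ) : ℂ) = 1 / 2 := by norm_num
  rw [hμ] at hG hGe
  -- Two divided differences give sineFactor σ = 1/(2π) + ε/π + ε² s₂(σ) with ε = σ - 1/2;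
  -- multiplication by the double pole yields the polar part.
  set s₁ := dslope sineFactor (1 / 2) with hs₁
  have hd₁ : Differentiable ℂ s₁ := fun z =>
    (analyticAt_dslope differentiable_sineFactor _ z).differentiableAt
  set s₂ := dslope s₁ (1 / 2) with hs₂
  refine ⟨fun σ => sineFactor σ * G σ + s₂ σ * a' 0 + s₁ σ * a 0, ?_, ?_⟩
  · exact (((differentiable_sineFactor.analyticAt _).mul hG).add
      ((analyticAt_dslope hd₁ _ _).mul analyticAt_const)).add
      ((hd₁.analyticAt _).mul analyticAt_const)
  · filter_upwards [h.dirichletExt_eventuallyEq_aux _, nhdsWithin_le_nhds hGe,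
      self_mem_nhdsWithin] with σ h1 h2 h3
    have h4 : σ - 1 / 2 ≠ 0 := sub_ne_zero.2 h3
    have e1 : (σ - 1 / 2) * s₁ σ = sineFactor σ - 1 / (2 * Real.pi) := by
      rw [← sineFactor_half]
      exact sub_smul_dslope sineFactor (1 / 2) σ
    have e2 : (σ - 1 / 2) * s₂ σ = s₁ σ - 1 / Real.pi := by
      rw [← deriv_sineFactor_half, ← dslope_same]
      exact sub_smul_dslope s₁ (1 / 2) σ
    rw [h1, h2, expansionPole, hμ]
    generalize σ - 1 / 2 = ε at *
    have e3 : sineFactor σ = 1 / (2 * Real.pi) + ε * (1 / Real.pi + ε * s₂ σ) := by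
      rw [e2]
      linear_combination -e1
    have e4 : s₁ σ = 1 / Real.pi + ε * s₂ σ := by linear_combination -e2
    have hpi : (Real.pi : ℂ) ≠ 0 := by exact_mod_cast Real.pi_ne_zero
    rw [mul_add, e4]
    have e5 : sineFactor σ * (a' 0 / ε ^ 2 + a 0 / ε) =
        (1 / (2 * Real.pi) + ε * (1 / Real.pi + ε * s₂ σ)) * (a' 0 / ε ^ 2 + a 0 / ε) := by
      rw [e3]
    rw [e5]
    field_simp
    ring

/-- The poles at the negative integers are cancelled by the sine if there is no logarithm. -/
theorem analyticAt_dirichletExt_neg_natCast {m : ℕ} (ha' : a' (2 * m + 1) = 0) :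
    AnalyticAt ℂ (dirichletExt x a' a) (-m) := by
  obtain ⟨G, hG, hGe⟩ := h.exists_dirichletAux_eq (2 * m + 1)
  have hμ : (((1 - ((2 * m + 1 : ℕ) : ℝ)) / 2 : ℝ) : ℂ) = -m := by
    push_cast
    ring
  rw [hμ] at hG hGe
  have hg : AnalyticAt ℂ (fun σ => sineFactor σ * G σ + dslope sineFactor (-m) σ * a (2 * m + 1))
      (-m) := ((differentiable_sineFactor.analyticAt _).mul hG).add
    ((analyticAt_dslope differentiable_sineFactor _ _).mul analyticAt_const)
  refine hg.congr (h.dirichletExt_eventuallyEq hg ?_).symm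
  filter_upwards [nhdsWithin_le_nhds hGe, self_mem_nhdsWithin] with σ h2 h3
  have h4 : σ - -m ≠ 0 := sub_ne_zero.2 h3
  have e1 : (σ - -m) * dslope sineFactor (-m) σ = sineFactor σ := by
    rw [← sub_zero (sineFactor σ), ← sineFactor_neg_natCast m]
    exact sub_smul_dslope sineFactor (-m) σ
  rw [h2, expansionPole, hμ, ha', mul_add]
  congr 1
  rw [← e1]
  field_simp
  ring

/-- The sine factor is σ² times an even function equal to 1 at 0, which clears the double pole a'
1/σ² + a 1/σ completely. Value and derivative at 0 are then read off as a' 1 and a 1. -/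
theorem dirichletExt_eventuallyEq_zero : ∃ G : ℂ → ℂ, AnalyticAt ℂ G 0 ∧
    dirichletExt x a' a =ᶠ[𝓝 0]
      fun σ => sincFactor σ * (σ ^ 2 * G σ + a' 1 + a 1 * σ) := by
  obtain ⟨G, hG, hGe⟩ := h.exists_dirichletAux_eq 1
  have hμ : (((1 - ((1 : ℕ) : ℝ)) / 2 : ℝ) : ℂ) = 0 := by norm_num
  rw [hμ] at hG hGe
  refine ⟨G, hG, h.dirichletExt_eventuallyEq ?_ ?_⟩
  · exact (analyticAt_sincFactor 0).mul
      ((((analyticAt_id.pow 2).mul hG).add analyticAt_const).add (analyticAt_const.mul analyticAt_id))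
  · filter_upwards [nhdsWithin_le_nhds hGe, self_mem_nhdsWithin] with σ h2 h3
    have h4 : σ ≠ 0 := h3
    rw [h2, expansionPole, hμ, sineFactor_eq_sq_mul, sub_zero]
    field_simp
    ring

theorem analyticAt_dirichletExt_zero : AnalyticAt ℂ (dirichletExt x a' a) 0 := by
  obtain ⟨G, hG, hGe⟩ := h.dirichletExt_eventuallyEq_zero
  refine AnalyticAt.congr ?_ hGe.symm
  exact (analyticAt_sincFactor 0).mul
    ((((analyticAt_id.pow 2).mul hG).add analyticAt_const).add (analyticAt_const.mul analyticAt_id))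

theorem dirichletExt_zero : dirichletExt x a' a 0 = a' 1 := by
  obtain ⟨G, -, hGe⟩ := h.dirichletExt_eventuallyEq_zero
  rw [hGe.eq_of_nhds, sincFactor_zero]
  ring

theorem hasDerivAt_dirichletExt_zero : HasDerivAt (dirichletExt x a' a) (a 1) 0 := by
  obtain ⟨G, hG, hGe⟩ := h.dirichletExt_eventuallyEq_zero
  have hG' := hG.differentiableAt.hasDerivAt
  have hid := hasDerivAt_id (0 : ℂ)
  have h1 := hasDerivAt_sincFactor_zero.mul
    ((((hid.pow 2).mul hG').add_const (a' 1)).add (hid.const_mul (a 1)))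
  refine (h1.congr_deriv ?_).congr_of_eventuallyEq (hGe.trans (.of_forall fun σ => ?_))
  · simp [sincFactor_zero]
  · simp

/-- Even indices 2m carry the exponents 1/2 - m, which are excluded; odd indices 2m+1 carry -m,
where the sine factor removes the pole. -/
theorem analyticAt_dirichletExt (ha' : ∀ m : ℕ, 1 ≤ m → a' (2 * m + 1) = 0) {σ : ℂ}
    (hσ : ∀ m : ℕ, σ ≠ 1 / 2 - (m : ℂ)) : AnalyticAt ℂ (dirichletExt x a' a) σ := by
  by_cases h1 : ∀ n : ℕ, σ ≠ (((1 - (n : ℝ)) / 2 : ℝ) : ℂ)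
  · have h2 := h.analyticAt_dirichletAux h1
    exact h2.congr (h.dirichletExt_eventuallyEq h2 EventuallyEq.rfl).symm
  · push Not at h1
    obtain ⟨p, rfl⟩ := h1
    rcases Nat.even_or_odd' p with ⟨m, rfl | rfl⟩
    · refine absurd ?_ (hσ m)
      push_cast
      ring
    · have hμ : (((1 - ((2 * m + 1 : ℕ) : ℝ)) / 2 : ℝ) : ℂ) = -m := by
        push_cast
        ring
      rw [hμ]
      rcases Nat.eq_zero_or_pos m with rfl | hm
      · simpa using h.analyticAt_dirichletExt_zero
      · exact h.analyticAt_dirichletExt_neg_natCast (ha' m hm)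

end HasSqrtExpansion

end Continuation

end

/-! ### Assembly of the statement -/

theorem mainTheorem2 (τ : ℕ → ℂ) (hτ : IsRiemannZeroSequence τ)
    (v : ℝ) (hv : -(τ 0 ^ 2).re < v) :
    IsAdmissible (fun k => τ k ^ 2 + (v : ℂ)) (1 / 2) ∧
    (∃ θ : ℝ, 0 < θ ∧ (∀ k, |Complex.arg (τ k ^ 2 + (v : ℂ))| ≤ Real.pi - θ) ∧
      ∃ a' a : ℕ → ℂ,
        HasStirlingExpansion (fun k => τ k ^ 2 + (v : ℂ)) θ (fun n => (1 - (n : ℝ)) / 2) a' a ∧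
        a' 0 = 1 / 4 ∧ a 0 = ((-(1 + Real.log (2 * Real.pi)) / 2 : ℝ) : ℂ) ∧
        a' 1 = 7 / 8 ∧ (∀ m : ℕ, 1 ≤ m → a' (2 * m + 1) = 0) ∧
        (v = 1 / 4 → a 1 = ((Real.log (8 * Real.pi) / 4 : ℝ) : ℂ))) ∧
    ∃ Z : ℂ → ℂ,
      (∀ σ : ℂ, 1 / 2 < σ.re → HasSum (zetaTerm τ v σ) (Z σ)) ∧
      MeromorphicOn Z Set.univ ∧
      (∀ σ : ℂ, (∀ m : ℕ, σ ≠ 1 / 2 - (m : ℂ)) → AnalyticAt ℂ Z σ) ∧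
      (∀ m : ℕ, ((-2 : ℤ) : WithTop ℤ) ≤ meromorphicOrderAt Z (1 / 2 - (m : ℂ))) ∧
      (∃ g : ℂ → ℂ, AnalyticAt ℂ g (1 / 2) ∧ ∀ᶠ σ in 𝓝[≠] (1 / 2 : ℂ),
        Z σ = (1 / (8 * Real.pi) : ℂ) * ((σ - 1 / 2) ^ 2)⁻¹
          - ((Real.log (2 * Real.pi) / (4 * Real.pi) : ℝ) : ℂ) * (σ - 1 / 2)⁻¹ + g σ) ∧
      Z 0 = 7 / 8 ∧
      (v = 1 / 4 → HasDerivAt Z ((Real.log (8 * Real.pi) / 4 : ℝ) : ℂ) 0) := by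
  obtain ⟨θ, hθ0, hθ4, hθ, a', a, hexp, ha'0, ha0, ha'1, ha', ha1⟩ := hτ.exists_stirlingExpansion hv
  have h : HasSqrtExpansion (fun k => τ k ^ 2 + (v : ℂ)) θ a' a :=
    ⟨hτ.ne_zero hv, hτ.tendsto_norm hv, fun β hβ => hτ.summable_norm_rpow hv hβ, hθ0,
      by linarith [Real.pi_pos], hθ, hexp⟩
  refine ⟨hτ.isAdmissible hv, ⟨θ, hθ0, hθ, a', a, hexp, ha'0, ha0, ha'1, ha', ha1⟩,
    dirichletExt (fun k => τ k ^ 2 + (v : ℂ)) a' a, fun σ hσ => h.hasSum_dirichletExt hσ,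
    meromorphicOn_dirichletExt, fun σ hσ => h.analyticAt_dirichletExt ha' hσ, fun m => ?_, ?_,
    by rw [h.dirichletExt_zero, ha'1], fun hv4 => ?_⟩
  -- The point 1/2 - m is the exponent of index 2m.
  · have h1 := h.neg_two_le_meromorphicOrderAt (2 * m)
    have h2 : (((1 - ((2 * m : ℕ) : ℝ)) / 2 : ℝ) : ℂ) = 1 / 2 - m := by
      push_cast
      ring
    rwa [h2] at h1
  -- In the residue the term 1/(4π) from the derivative of the sine factor cancels the 1 in -(1 +
  -- log 2π)/(4π), leaving -log 2π/(4π).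
  · obtain ⟨g, hg, hge⟩ := h.exists_dirichletExt_eq_half
    refine ⟨g, hg, hge.mono fun σ hσ => ?_⟩
    have hpi : (Real.pi : ℂ) ≠ 0 := by exact_mod_cast Real.pi_ne_zero
    rw [hσ, ha'0, ha0]
    push_cast
    field_simp
    ring
  · rw [← ha1 hv4]
    exact h.hasDerivAt_dirichletExt_zero
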